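/- **Setting.** Let $\mathbb G\cong\mathbb R^{d_1}\oplus\mathbb R^{d_2}$ be a step-2 Carnot group in exponential coordinates with respect to an orthonormal basis adapted to the stratification. That is, $w_{ij}=-w_{ji}\in\mathbb R^{d_2}$ ($1\le i,j\le d_1$) are structure constants spanning $\mathbb R^{d_2}$, $[x,y]=\sum_{i,j}w_{ij}x_iy_j$ for $x,y\in\mathbb R^{d_1}$, and $\mathbf x\mathbf y=\big(x^{(1)}+y^{(1)},\,x^{(2)}+y^{(2)}+\tfrac12[x^{(1)},y^{(1)}]\big)$. The identity is $0$, $\pi_i\mathbf x=x^{(i)}$, and $d_{cc}$ is the Carnot–Carathéodory distance. Let $\Omega_{\mathbb G}=C_0([0,1],\mathbb G)$ be the space of continuous paths started at $0$, with the topology of the uniform metric $d_\infty(\omega,\bar\omega)=\sup_t d_{cc}(\omega_t,\bar\omega_t)$ and its Borel $\sigma$-algebra, and write $\omega_{s,t}=\omega_s^{-1}\omega_t$. For $h:[0,1]\to\mathbb R^{d_1}$ absolutely continuous with $h_0=0$ let $\Psi(h)_t=\big(h_t,\tfrac12\int_0^t[h_s,\dot h_s]\,ds\big)$ be its lift. Let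 $T_h\omega=\lim_m\Psi(\omega^m+h)$ be the shift of $\omega$, where $\omega^m$ are absolutely continuous with $\omega^m_0=0$ and $\Psi(\omega^m)\to\omega$ uniformly. Let $\mathcal H=W^{1,2}_0([0,1],\mathbb R^{d_1})$ with $\|h\|_{\mathcal H}^2=\int_0^1|\dot h_t|^2dt$. With $t^n_k=k2^{-n}$, define the costs $$C_n(\omega,\bar\omega)=\Big(2^n\sum_{k=1}^{2^n}d_{cc}\big(\omega_{t^n_{k-1},t^n_k},\bar\omega_{t^n_{k-1},t^n_k}\big)^2\Big)^{1/2},\qquad C_{\mathcal H}(\omega,\bar\omega)=\begin{cases}\|h\|_{\mathcal H},&\bar\omega=T_h\omega\text{ for some }h\in\mathcal H,\\+\infty,&\text{otherwise,}\end{cases}$$ and $\mathcal T_{c,2}(\eta,\nu)=\big(\inf_{\lambda\in\Pi(\eta,\nu)}\int c^2\,d\lambda\big)^{1/2}\in[0,\infty]$, where $\Pi(\eta,\nu)$ is the set of couplings. **Recovery map.** Let $\Phi^n(\omega,\bar\omega)=(\omega,\bar\omega^n)$, with $\bar\omega^n$ as follows. If $h:=\pi_1\bar\omega-\pi_1\omega\in\mathcal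 H$ and $\bar\omega=T_h\omega$, then $\bar\omega^n_t=\bar\omega_t\,(0,\vartheta^n_t)^{-1}$, where $$\vartheta^n_t=\sum_{k=1}^{2^n}\theta_{t^n_{k-1}\wedge t,\;t^n_k\wedge t},\qquad \theta_{s,t}=\pi_2\big(\mathbf h_{s,t}^{-1}\,\omega_{s,t}^{-1}\,\bar\omega_{s,t}\big),\qquad \mathbf h=\Psi(h);$$ otherwise $\bar\omega^n=\bar\omega$. **Theorem.** Let $\eta\in\mathcal P(\Omega_{\mathbb G})$. Then $\mathcal T_{C_n,2}(\eta,\cdot)\xrightarrow{\ \Gamma\ }\mathcal T_{C_{\mathcal H},2}(\eta,\cdot)$ with respect to the weak topology on $\mathcal P(\Omega_{\mathbb G})$. That is: 1. if $\nu^n\rightharpoonup\nu$ in $\mathcal P(\Omega_{\mathbb G})$, then $\liminf_{n\to\infty}\mathcal T_{C_n,2}(\eta,\nu^n)\ge\mathcal T_{C_{\mathcal H},2}(\eta,\nu)$; 2. for every $\nu\in\mathcal P(\Omega_{\mathbb G})$ there are $\tilde\nu^n\in\mathcal P(\Omega_{\mathbb G})$ with $\tilde\nu^n\rightharpoonup\nu$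 and $\limsup_{n\to\infty}\mathcal T_{C_n,2}(\eta,\tilde\nu^n)\le\mathcal T_{C_{\mathcal H},2}(\eta,\nu)$. Moreover, for every $\nu\in\mathcal P(\Omega_{\mathbb G})$ there is an optimal plan $\lambda\in\Pi(\eta,\nu)$ for $\mathcal T_{C_{\mathcal H},2}(\eta,\nu)$ such that the second marginals $\tilde\nu^n$ of the push-forwards $\Phi^n_\sharp\lambda$ are probability measures satisfying $\tilde\nu^n\rightharpoonup\nu$ and $\lim_{n\to\infty}\mathcal T_{C_n,2}(\eta,\tilde\nu^n)=\mathcal T_{C_{\mathcal H},2}(\eta,\nu)$. -/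

import Mathlib

open MeasureTheory Set Filter Topology
open scoped ENNReal unitInterval

noncomputable section

/-- A step-`2` Carnot group in exponential coordinates adapted to the stratification
`𝔤 = V₁ ⊕ V₂`, `[V₁, V₂] = 0`, `V₂ = [V₁, V₁]`, with respect to an orthonormal adapted basis. It is
determined by the antisymmetric structure constants `w i j = [eᵢ, eⱼ] ∈ ℝ^{d₂}`, which span
`ℝ^{d₂}` because `V₂ = [V₁, V₁]`. -/
structure StepTwoCarnotGroup (d₁ d₂ : ℕ) where
  w : Fin d₁ → Fin d₁ → EuclideanSpace ℝ (Fin d₂)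
  antisymm : ∀ i j, w i j = - w j i
  span_eq_top : Submodule.span ℝ (Set.range fun p : Fin d₁ × Fin d₁ => w p.1 p.2) = ⊤

/-- The underlying space `ℝ^{d₁} ⊕ ℝ^{d₂}` of the group, with identity element `0`. -/
abbrev CarnotPoint (d₁ d₂ : ℕ) : Type :=
  EuclideanSpace ℝ (Fin d₁) × EuclideanSpace ℝ (Fin d₂)

namespace StepTwoCarnotGroup

variable {d₁ d₂ : ℕ} (G : StepTwoCarnotGroup d₁ d₂)

/-- The bracket of two horizontal vectors, `∑ᵢⱼ w_{ij} xᵢ yⱼ`. -/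
def bracket (x y : EuclideanSpace ℝ (Fin d₁)) : EuclideanSpace ℝ (Fin d₂) :=
  ∑ i, ∑ j, (x i * y j) • G.w i j

/-- The group law `𝐱𝐲 = 𝐱 + 𝐲 + ½[𝐱, 𝐲]`. -/
def mul (x y : CarnotPoint d₁ d₂) : CarnotPoint d₁ d₂ :=
  (x.1 + y.1, x.2 + y.2 + (1 / 2 : ℝ) • G.bracket x.1 y.1)

/-- The inverse `𝐱⁻¹ = -𝐱`. -/
def inv (_G : StepTwoCarnotGroup d₁ d₂) (x : CarnotPoint d₁ d₂) : CarnotPoint d₁ d₂ :=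
  -x

/-- The group increment `𝐱⁻¹𝐲`. -/
def incr (x y : CarnotPoint d₁ d₂) : CarnotPoint d₁ d₂ :=
  G.mul (G.inv x) y

/-- The value at `x` of the horizontal left-invariant vector field `∑ᵢ vᵢ Vᵢ`, that is, the image of
`(v, 0)` under the differential at the identity of the left multiplication by `x`. -/
def horizontalField (v : EuclideanSpace ℝ (Fin d₁)) (x : CarnotPoint d₁ d₂) :
    CarnotPoint d₁ d₂ :=
  (v, (1 / 2 : ℝ) • G.bracket x.1 v)

/-- `γ : [0, 1] → 𝔾` is an absolutely continuous horizontal curve whose velocity has, for almost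
every `t`, the coefficients `v t` in the frame `V₁, …, V_{d₁}`. Only the values of `γ` on `[0, 1]`
matter. -/
def IsHorizontalCurve (γ : ℝ → CarnotPoint d₁ d₂) (v : ℝ → EuclideanSpace ℝ (Fin d₁)) : Prop :=
  AbsolutelyContinuousOnInterval γ 0 1 ∧
    ∀ᵐ t ∂(volume.restrict (Icc (0 : ℝ) 1)), HasDerivAt γ (G.horizontalField (v t) (γ t)) t

/-- The Carnot–Carathéodory distance: the infimum of the lengths of the horizontal curves joining
`x` to `y`. The frame is orthonormal, so the speed is the Euclidean norm of the coefficients. -/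
def dcc (x y : CarnotPoint d₁ d₂) : ℝ≥0∞ :=
  ⨅ (γ : ℝ → CarnotPoint d₁ d₂) (v : ℝ → EuclideanSpace ℝ (Fin d₁))
    (_ : G.IsHorizontalCurve γ v ∧ γ 0 = x ∧ γ 1 = y), ∫⁻ t in Icc (0 : ℝ) 1, ‖v t‖ₑ

/-- The uniform distance `sup_{t ∈ [0, 1]} d_cc(X_t, Y_t)`. -/
def dInf (X Y : ℝ → CarnotPoint d₁ d₂) : ℝ≥0∞ :=
  ⨆ t ∈ Icc (0 : ℝ) 1, G.dcc (X t) (Y t)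

/-- The canonical lift `Ψ(h)` of an absolutely continuous curve `h` with `h 0 = 0`:
`Ψ(h)_t = (h_t, ½ ∫₀ᵗ [h_s, ḣ_s] ds)`. -/
def lift (h : ℝ → EuclideanSpace ℝ (Fin d₁)) (t : ℝ) : CarnotPoint d₁ d₂ :=
  (h t, (1 / 2 : ℝ) • ∫ s in (0 : ℝ)..t, G.bracket (h s) (deriv h s))

end StepTwoCarnotGroup

/-- Membership in `AC₀([0, 1], ℝᵈ)`; only the values on `[0, 1]` matter. -/
def IsACZero {d : ℕ} (h : ℝ → EuclideanSpace ℝ (Fin d)) : Prop :=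
  AbsolutelyContinuousOnInterval h 0 1 ∧ h 0 = 0

/-- Membership in the Cameron–Martin space `W₀^{1,2}([0, 1], ℝᵈ)`. -/
def IsCameronMartin {d : ℕ} (h : ℝ → EuclideanSpace ℝ (Fin d)) : Prop :=
  IsACZero h ∧ MemLp (deriv h) 2 (volume.restrict (Icc (0 : ℝ) 1))

/-- The Cameron–Martin norm `(∫₀¹ |ḣ_t|² dt)^{1/2}`. -/
def cameronMartinNorm {d : ℕ} (h : ℝ → EuclideanSpace ℝ (Fin d)) : ℝ≥0∞ :=
  (∫⁻ t in Icc (0 : ℝ) 1, ‖deriv h t‖ₑ ^ 2) ^ (1 / 2 : ℝ)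

/-- The space `C₀([0, 1], 𝔾)` of continuous `𝔾`-valued paths started from the identity. -/
structure CarnotPath {d₁ d₂ : ℕ} (G : StepTwoCarnotGroup d₁ d₂) where
  toContinuousMap : C(I, CarnotPoint d₁ d₂)
  map_zero : toContinuousMap 0 = 0

namespace CarnotPath

open StepTwoCarnotGroup

variable {d₁ d₂ : ℕ} {G : StepTwoCarnotGroup d₁ d₂}

/-- Evaluation of a path at a time in `[0, 1]`, extended by constants outside of `[0, 1]`. -/
instance : CoeFun (CarnotPath G) (fun _ => ℝ → CarnotPoint d₁ d₂) where
  coe X := IccExtend (zero_le_one' ℝ) X.toContinuousMap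

/-- The topology of the uniform metric: `U` is open if it contains a `d_∞`-ball around each of its
points. -/
instance : TopologicalSpace (CarnotPath G) where
  IsOpen U := ∀ X ∈ U, ∃ r : ℝ≥0∞, 0 < r ∧ ∀ Y : CarnotPath G, G.dInf X Y < r → Y ∈ U
  isOpen_univ := fun _ _ => ⟨1, one_pos, fun _ _ => mem_univ _⟩
  isOpen_inter := by
    rintro U V hU hV X ⟨hXU, hXV⟩
    obtain ⟨r, hr, hrU⟩ := hU X hXU
    obtain ⟨s, hs, hsV⟩ := hV X hXV
    exact ⟨min r s, lt_min hr hs, fun Y hY =>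
      ⟨hrU Y (hY.trans_le (min_le_left _ _)), hsV Y (hY.trans_le (min_le_right _ _))⟩⟩
  isOpen_sUnion := by
    rintro S hS X ⟨U, hUS, hXU⟩
    obtain ⟨r, hr, hrU⟩ := hS U hUS X hXU
    exact ⟨r, hr, fun Y hY => ⟨U, hUS, hrU Y hY⟩⟩

instance : MeasurableSpace (CarnotPath G) := borel _

instance : BorelSpace (CarnotPath G) := ⟨rfl⟩

/-- `Y = T_h X`: the path `Y` is the uniform limit of the lifts `Ψ(ωⁿ + h)`, where `Ψ(ωⁿ)`,
`ωⁿ ∈ AC₀`, are lifts converging uniformly to `X` (the limit does not depend on their choice). -/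
def IsShift (h : ℝ → EuclideanSpace ℝ (Fin d₁)) (X Y : CarnotPath G) : Prop :=
  ∃ ω : ℕ → ℝ → EuclideanSpace ℝ (Fin d₁), (∀ n, IsACZero (ω n)) ∧
    Tendsto (fun n => G.dInf (G.lift (ω n)) X) atTop (𝓝 0) ∧
    Tendsto (fun n => G.dInf (G.lift (ω n + h)) Y) atTop (𝓝 0)

/-- The cost `C_ℋ(X, Y)`, equal to `‖h‖_ℋ` if `Y = T_h X` for some `h ∈ ℋ` and to `∞` if there is no
such `h`; there is at most one such `h` on `[0, 1]`. -/
def costH (X Y : CarnotPath G) : ℝ≥0∞ :=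
  ⨅ (h : ℝ → EuclideanSpace ℝ (Fin d₁)) (_ : IsCameronMartin h ∧ IsShift h X Y),
    cameronMartinNorm h

/-- The discretised cost `C_n(X, Y) = (2ⁿ ∑ₖ d_cc(X_{tₖ,tₖ₊₁}, Y_{tₖ,tₖ₊₁})²)^{1/2}`, `tₖ = k 2⁻ⁿ`,
built from the group increments over the dyadic intervals. -/
def cost (n : ℕ) (X Y : CarnotPath G) : ℝ≥0∞ :=
  (2 ^ n * ∑ k ∈ Finset.range (2 ^ n),
    G.dcc (G.incr (X ((k : ℝ) / 2 ^ n)) (X (((k : ℝ) + 1) / 2 ^ n)))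
      (G.incr (Y ((k : ℝ) / 2 ^ n)) (Y (((k : ℝ) + 1) / 2 ^ n))) ^ 2) ^ (1 / 2 : ℝ)

/-- The difference of the first levels, `h = π₁Y - π₁X`. -/
def firstLevelDiff (X Y : CarnotPath G) (t : ℝ) : EuclideanSpace ℝ (Fin d₁) :=
  (Y t).1 - (X t).1

/-- The non-commutativity error `θ_{s,t} = π₂(𝐡_{s,t}⁻¹ X_{s,t}⁻¹ Y_{s,t})`, where `𝐡 = Ψ(h)` and
`h = π₁Y - π₁X`. -/
def commError (X Y : CarnotPath G) (s t : ℝ) : EuclideanSpace ℝ (Fin d₂) :=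
  (G.mul (G.inv (G.incr (G.lift (firstLevelDiff X Y) s) (G.lift (firstLevelDiff X Y) t)))
    (G.mul (G.inv (G.incr (X s) (X t))) (G.incr (Y s) (Y t)))).2

/-- The corrector `ϑⁿ_t`, which adds up the errors `θ` over the dyadic intervals of length `2⁻ⁿ`, the
interval containing `t` being cut at `t`. -/
def corrector (n : ℕ) (X Y : CarnotPath G) (t : ℝ) : EuclideanSpace ℝ (Fin d₂) :=
  ∑ k ∈ Finset.range (2 ^ n),
    commError X Y (min ((k : ℝ) / 2 ^ n) t) (min (((k : ℝ) + 1) / 2 ^ n) t)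

/-- The corrected path `t ↦ Y_t (0, ϑⁿ_t)⁻¹`. -/
def correctedCurve (n : ℕ) (X Y : CarnotPath G) (t : ℝ) : CarnotPoint d₁ d₂ :=
  G.mul (Y t) (G.inv (0, corrector n X Y t))

end CarnotPath

theorem StepTwoCarnotGroup.continuousOn_lift {d₁ d₂ : ℕ} (G : StepTwoCarnotGroup d₁ d₂)
    {h : ℝ → EuclideanSpace ℝ (Fin d₁)} (hh : IsCameronMartin h) :
    ContinuousOn (G.lift h) (Icc 0 1) := by
  have hc : ContinuousOn h (Icc 0 1) := by
    have := hh.1.1.continuousOn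
    rwa [uIcc_of_le zero_le_one] at this
  refine hc.prodMk (ContinuousOn.fun_const_smul ?_ _)
  have hd : IntegrableOn (deriv h) (Icc (0 : ℝ) 1) := hh.2.integrable (by norm_num)
  have hi : IntegrableOn (fun s => G.bracket (h s) (deriv h s)) (Icc (0 : ℝ) 1) := by
    unfold StepTwoCarnotGroup.bracket
    refine integrable_finsetSum _ fun i _ => integrable_finsetSum _ fun j _ => ?_
    refine Integrable.smul_const ?_ _
    have h1 : IntegrableOn (fun s => (deriv h s) j) (Icc (0 : ℝ) 1) :=
      (EuclideanSpace.proj j : EuclideanSpace ℝ (Fin d₁) →L[ℝ] ℝ).integrable_comp hd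
    refine IntegrableOn.continuousOn_mul ?_ h1 isCompact_Icc
    exact (EuclideanSpace.proj i : EuclideanSpace ℝ (Fin d₁) →L[ℝ] ℝ).continuous.comp_continuousOn hc
  exact intervalIntegral.continuousOn_primitive_interval (by rwa [uIcc_of_le zero_le_one])
    |>.mono (by rw [uIcc_of_le zero_le_one])

namespace StepTwoCarnotGroup

variable {d₁ d₂ : ℕ} (G : StepTwoCarnotGroup d₁ d₂)

theorem bracket_zero_right (x : EuclideanSpace ℝ (Fin d₁)) : G.bracket x 0 = 0 := by
  simp [bracket]

theorem bracket_self (x : EuclideanSpace ℝ (Fin d₁)) : G.bracket x x = 0 := by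
  have h : G.bracket x x = - G.bracket x x := by
    conv_lhs => rw [bracket, Finset.sum_comm]
    simp only [bracket, ← Finset.sum_neg_distrib]
    refine Finset.sum_congr rfl fun i _ => Finset.sum_congr rfl fun j _ => ?_
    rw [G.antisymm j i, smul_neg, mul_comm]
  have h2 : (2 : ℝ) • G.bracket x x = 0 := by
    rw [two_smul]
    nth_rw 1 [h]
    simp
  exact (smul_eq_zero.mp h2).resolve_left two_ne_zero

theorem incr_self (x : CarnotPoint d₁ d₂) : G.incr x x = 0 := by
  have h : G.bracket (-x.1) x.1 = 0 := by
    have := G.bracket_self x.1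
    simp only [bracket, PiLp.neg_apply, neg_mul, neg_smul, Finset.sum_neg_distrib] at this ⊢
    rw [this, neg_zero]
  simp [incr, mul, inv, h]

theorem continuous_bracket :
    Continuous fun p : EuclideanSpace ℝ (Fin d₁) × EuclideanSpace ℝ (Fin d₁) =>
      G.bracket p.1 p.2 := by
  unfold bracket
  fun_prop

theorem continuous_mul :
    Continuous fun p : CarnotPoint d₁ d₂ × CarnotPoint d₁ d₂ => G.mul p.1 p.2 := by
  unfold mul
  have := G.continuous_bracket.comp
    (f := fun p : CarnotPoint d₁ d₂ × CarnotPoint d₁ d₂ => (p.1.1, p.2.1)) (by fun_prop)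
  exact Continuous.prodMk (by fun_prop)
    (Continuous.add (by fun_prop) (Continuous.fun_const_smul this _))

end StepTwoCarnotGroup

namespace CarnotPath

variable {d₁ d₂ : ℕ} {G : StepTwoCarnotGroup d₁ d₂}

theorem continuous_coe (X : CarnotPath G) : Continuous (X : ℝ → CarnotPoint d₁ d₂) :=
  X.toContinuousMap.continuous.Icc_extend'

theorem coe_zero (X : CarnotPath G) : X (0 : ℝ) = 0 :=
  (IccExtend_left (zero_le_one' ℝ) X.toContinuousMap).trans X.map_zero

theorem continuous_correctedCurve (n : ℕ) (X Y : CarnotPath G)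
    (h : IsCameronMartin (firstLevelDiff X Y)) :
    Continuous fun t : I => correctedCurve n X Y t := by
  have hmul : ∀ {f g : I → CarnotPoint d₁ d₂}, Continuous f → Continuous g →
      Continuous fun t => G.mul (f t) (g t) := fun hf hg => G.continuous_mul.comp (hf.prodMk hg)
  have hinv : ∀ {f : I → CarnotPoint d₁ d₂}, Continuous f →
      Continuous fun t => G.inv (f t) := fun hf => hf.neg
  have hmin : ∀ a : ℝ, Continuous fun t : I => min a (t : ℝ) := fun a => by fun_prop
  have hl : ∀ a : ℝ, 0 ≤ a → Continuous fun t : I => G.lift (firstLevelDiff X Y) (min a t) :=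
    fun a ha => (G.continuousOn_lift h).comp_continuous (hmin a)
      fun t => ⟨le_min ha t.2.1, (min_le_right _ _).trans t.2.2⟩
  have hX : ∀ (Z : CarnotPath G) (a : ℝ), Continuous fun t : I => Z (min a (t : ℝ)) :=
    fun Z a => Z.continuous_coe.comp (hmin a)
  refine hmul (Y.continuous_coe.comp continuous_subtype_val)
    (hinv (continuous_const.prodMk (continuous_finsetSum _ fun k _ => ?_)))
  have h0 : (0 : ℝ) ≤ (k : ℝ) / 2 ^ n := by positivity
  have h1 : (0 : ℝ) ≤ ((k : ℝ) + 1) / 2 ^ n := by positivity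
  exact (hmul (hinv (hmul (hinv (hl _ h0)) (hl _ h1)))
    (hmul (hinv (hmul (hinv (hX X _)) (hX X _))) (hmul (hinv (hX Y _)) (hX Y _)))).snd

theorem correctedCurve_zero (n : ℕ) (X Y : CarnotPath G) : correctedCurve n X Y 0 = 0 := by
  have h : corrector n X Y 0 = 0 := by
    refine Finset.sum_eq_zero fun k _ => ?_
    have h0 : min ((k : ℝ) / 2 ^ n) 0 = 0 := min_eq_right (by positivity)
    have h1 : min (((k : ℝ) + 1) / 2 ^ n) 0 = 0 := min_eq_right (by positivity)
    rw [h0, h1]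
    simp [commError, G.incr_self, StepTwoCarnotGroup.mul, StepTwoCarnotGroup.inv,
      G.bracket_zero_right]
  rw [correctedCurve, h, Y.coe_zero]
  simp [StepTwoCarnotGroup.mul, StepTwoCarnotGroup.inv, G.bracket_zero_right]

open Classical in
/-- The second component of the recovery map `Φⁿ(X, Y) = (X, Yⁿ)`: with `h = π₁Y - π₁X`, it is
`Yⁿ_t = Y_t (0, ϑⁿ_t)⁻¹` if `h ∈ ℋ` and `Y = T_h X`, and `Yⁿ = Y` otherwise. -/
def recovery (n : ℕ) (X Y : CarnotPath G) : CarnotPath G :=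
  if h : IsCameronMartin (firstLevelDiff X Y) ∧ IsShift (firstLevelDiff X Y) X Y then
    { toContinuousMap :=
        ⟨fun t : I => correctedCurve n X Y t, continuous_correctedCurve n X Y h.1⟩
      map_zero := correctedCurve_zero n X Y }
  else Y

/-- The recovery map `Φⁿ` on pairs of paths. -/
def recoveryMap (n : ℕ) (p : CarnotPath G × CarnotPath G) : CarnotPath G × CarnotPath G :=
  (p.1, recovery n p.1 p.2)

end CarnotPath

/-- The couplings (transport plans) of two probability measures. -/
def couplings {E : Type*} [MeasurableSpace E] (μ ν : ProbabilityMeasure E) :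
    Set (ProbabilityMeasure (E × E)) :=
  {π | (π : Measure (E × E)).map Prod.fst = μ ∧ (π : Measure (E × E)).map Prod.snd = ν}

/-- The transport cost `𝒯_{c,p}(μ, ν) = (inf_{π ∈ Π(μ, ν)} ∫ cᵖ dπ)^{1/p}`. -/
def transportCost {E : Type*} [MeasurableSpace E] (c : E → E → ℝ≥0∞) (p : ℝ)
    (μ ν : ProbabilityMeasure E) : ℝ≥0∞ :=
  (⨅ π ∈ couplings μ ν, ∫⁻ z, c z.1 z.2 ^ p ∂(π : Measure (E × E))) ^ (1 / p)

/-- `π` is an optimal transport plan for `𝒯_{c,p}(μ, ν)`. -/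
def IsOptimalPlan {E : Type*} [MeasurableSpace E] (c : E → E → ℝ≥0∞) (p : ℝ)
    (μ ν : ProbabilityMeasure E) (π : ProbabilityMeasure (E × E)) : Prop :=
  π ∈ couplings μ ν ∧ ∀ π' ∈ couplings μ ν,
    ∫⁻ z, c z.1 z.2 ^ p ∂(π : Measure (E × E)) ≤ ∫⁻ z, c z.1 z.2 ^ p ∂(π' : Measure (E × E))

/-- (Sequential) `Γ`-convergence of functionals with values in `[0, ∞]`. -/
def GammaConverges {E : Type*} [TopologicalSpace E] (F : ℕ → E → ℝ≥0∞) (Finf : E → ℝ≥0∞) : Prop :=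
  (∀ (x : E) (u : ℕ → E), Tendsto u atTop (𝓝 x) →
      Finf x ≤ liminf (fun n => F n (u n)) atTop) ∧
    ∀ x : E, ∃ u : ℕ → E, Tendsto u atTop (𝓝 x) ∧
      limsup (fun n => F n (u n)) atTop ≤ Finf x

end

/-!
The topology of `d_∞` on the path space is that of uniform convergence of the coordinates, because
`d_cc` and the coordinates control each other locally (`exists_dcc_le`, `norm_sub_le_of_dcc_le`); in
particular the path space is Polish. Every continuous path is a uniform limit of lifts
(`isLimitOfLifts_of_continuous`: rapidly oscillating loops create any vertical drift), and after an
integration by parts `T_h X` depends on `X` through its values only. Hence `Y = T_h X` says that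
`h = π₁Y - π₁X` and that a vertical function `drift X Y` equals `∫ [x, dh] + ½ ∫ [h, dh]`, where
`x = π₁X` (`isShift_iff_drift`).

The heart of the proof is a sequence of continuous functions `costLowerBound m` with
`costLowerBound m ≤ C_n²` for `n ≥ m` and `⨆ m, costLowerBound m = C_ℋ²`. The increment
`X_{s,t}⁻¹ Y_{s,t}` has the horizontal part `h_t - h_s` and a vertical part, the germ of `drift X Y`,
and its distance `δ` to the identity bounds the norm of the former by `δ` and that of the latter by a
multiple of `δ²`. The dyadic energies of `h` therefore are at most `C_n²`. The germs are almost
additive (`germSum_le_add`), so the sum of their norms at level `m` is at most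
`K (w_m + 2⁻ᵐ)(1 + C_n²)`, with `w_m` the modulus of continuity of `x`. Conversely, if all these
bounds hold with a common constant `S` in place of `C_n²`, then weak compactness in `L²` shows that
`h` belongs to `ℋ` with energy at most `S`, and since the sums of the germs tend to zero, `drift X Y`
is the drift of a shift (`isShift_of_costLowerBound_le`).

The `liminf` inequality and the existence of optimal plans follow by Prokhorov's theorem and monotone
convergence (`transportCost_le_liminf`, `exists_isOptimalPlan`). For the recovery sequence, the error
`θ_{s,t}` equals `∫ [x_r - x_t, dh_r]` over `[s, t]`, so the corrector tends to zero uniformly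
(`norm_corrector_le`), while the corrected path has `X_{s,t}⁻¹ Yⁿ_{s,t}` equal to the increment of the
lift of `h` on every dyadic interval. The length of `h` there and the Cauchy–Schwarz inequality give
`C_n(X, Yⁿ) ≤ C_ℋ(X, Y)` for every pair of paths (`cost_recovery_le`).
-/

open scoped NNReal BoundedContinuousFunction

/-! ### Absolutely continuous functions with values in a Euclidean space -/

namespace AbsolutelyContinuousOnInterval

theorem of_dist_le {X Y : Type*} [PseudoMetricSpace X] [PseudoMetricSpace Y] {f : ℝ → X}
    {g : ℝ → Y} {a b : ℝ} (K : ℝ) (hg : AbsolutelyContinuousOnInterval g a b)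
    (h : ∀ s ∈ uIcc a b, ∀ t ∈ uIcc a b, dist (f s) (f t) ≤ K * dist (g s) (g t)) :
    AbsolutelyContinuousOnInterval f a b := by
  refine squeeze_zero' (Eventually.of_forall fun _ => Finset.sum_nonneg fun _ _ => dist_nonneg) ?_
    (by simpa using Tendsto.const_mul K hg)
  filter_upwards [mem_inf_of_right (mem_principal_self _)] with E hE
  rw [Finset.mul_sum]
  exact Finset.sum_le_sum fun i hi => h _ (hE.1 i hi).1 _ (hE.1 i hi).2

theorem congr {X : Type*} [PseudoMetricSpace X] {f g : ℝ → X} {a b : ℝ}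
    (hg : AbsolutelyContinuousOnInterval g a b) (h : EqOn f g (uIcc a b)) :
    AbsolutelyContinuousOnInterval f a b :=
  hg.of_dist_le 1 fun s hs t ht => by rw [h hs, h ht, one_mul]

theorem prodMk {X Y : Type*} [PseudoMetricSpace X] [PseudoMetricSpace Y] {f : ℝ → X}
    {g : ℝ → Y} {a b : ℝ} (hf : AbsolutelyContinuousOnInterval f a b)
    (hg : AbsolutelyContinuousOnInterval g a b) :
    AbsolutelyContinuousOnInterval (fun t => (f t, g t)) a b := by
  refine squeeze_zero (fun _ => Finset.sum_nonneg fun _ _ => dist_nonneg) (fun E => ?_)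
    (by simpa using Tendsto.add hf hg)
  rw [← Finset.sum_add_distrib]
  refine Finset.sum_le_sum fun i _ => ?_
  rw [Prod.dist_eq]
  exact max_le_add_of_nonneg dist_nonneg dist_nonneg

variable {d : ℕ} {f : ℝ → EuclideanSpace ℝ (Fin d)} {a b : ℝ}

theorem coord (hf : AbsolutelyContinuousOnInterval f a b) (i : Fin d) :
    AbsolutelyContinuousOnInterval (fun t => f t i) a b :=
  hf.of_dist_le 1 fun s _ t _ => by
    rw [one_mul, dist_eq_norm, dist_eq_norm]
    exact PiLp.norm_apply_le (f s - f t) i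

theorem ae_differentiableAt_euclidean (hf : AbsolutelyContinuousOnInterval f a b) :
    ∀ᵐ x : ℝ, x ∈ uIcc a b → DifferentiableAt ℝ f x := by
  have := ae_all_iff.2 fun i => (hf.coord i).ae_differentiableAt
  filter_upwards [this] with x hx hxm
  exact differentiableAt_euclidean.2 fun i => hx i hxm

theorem ae_deriv_coord (hf : AbsolutelyContinuousOnInterval f a b) (i : Fin d) :
    ∀ᵐ x : ℝ, x ∈ uIcc a b → deriv (fun t => f t i) x = deriv f x i := by
  filter_upwards [hf.ae_differentiableAt_euclidean] with x hx hxm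
  exact ((EuclideanSpace.proj i : EuclideanSpace ℝ (Fin d) →L[ℝ] ℝ).hasFDerivAt.comp_hasDerivAt x
    (hx hxm).hasDerivAt).deriv

theorem intervalIntegrable_deriv_euclidean (hf : AbsolutelyContinuousOnInterval f a b) :
    IntervalIntegrable (deriv f) volume a b := by
  rw [intervalIntegrable_iff]
  refine Integrable.of_eval_piLp fun i => ?_
  refine (intervalIntegrable_iff.1 (hf.coord i).intervalIntegrable_deriv).congr ?_
  rw [EventuallyEq, ae_restrict_iff' measurableSet_uIoc]
  filter_upwards [hf.ae_deriv_coord i] with x hx hxm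
  exact hx (uIoc_subset_uIcc hxm)

theorem integral_deriv_eq_sub_euclidean (hf : AbsolutelyContinuousOnInterval f a b) :
    ∫ x in a..b, deriv f x = f b - f a := by
  ext i
  have h1 := (EuclideanSpace.proj i : EuclideanSpace ℝ (Fin d) →L[ℝ] ℝ).intervalIntegral_comp_comm
    hf.intervalIntegrable_deriv_euclidean
  simp only [PiLp.proj_apply] at h1
  rw [← h1, PiLp.sub_apply, ← (hf.coord i).integral_deriv_eq_sub]
  refine intervalIntegral.integral_congr_ae ?_
  filter_upwards [hf.ae_deriv_coord i] with x hx hxm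
  exact (hx (uIoc_subset_uIcc hxm)).symm

end AbsolutelyContinuousOnInterval

theorem IntervalIntegrable.absolutelyContinuousOnInterval_primitive {F : Type*}
    [NormedAddCommGroup F] [NormedSpace ℝ F] {f : ℝ → F} {a b : ℝ}
    (h : IntervalIntegrable f volume a b) :
    AbsolutelyContinuousOnInterval (fun t => ∫ x in a..t, f x) a b := by
  have hn : IntervalIntegrable (fun t => ‖f t‖) volume a b := h.norm
  refine (hn.absolutelyContinuousOnInterval_intervalIntegral left_mem_uIcc).of_dist_le 1
    fun s hs t ht => ?_
  have hi : ∀ {u}, u ∈ uIcc a b → IntervalIntegrable f volume a u := fun hu =>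
    h.mono_set (uIcc_subset_uIcc left_mem_uIcc hu)
  rw [one_mul, dist_eq_norm, Real.dist_eq,
    intervalIntegral.integral_interval_sub_left (hi hs) (hi ht),
    intervalIntegral.integral_interval_sub_left (hi hs).norm (hi ht).norm]
  exact intervalIntegral.norm_integral_le_abs_integral_norm

namespace StepTwoCarnotGroup

variable {d₁ d₂ : ℕ} (G : StepTwoCarnotGroup d₁ d₂)

/-! ### The bracket as a bounded bilinear map -/

/-- The bracket as a continuous bilinear map. -/
noncomputable def bracketL :
    EuclideanSpace ℝ (Fin d₁) →L[ℝ] EuclideanSpace ℝ (Fin d₁) →L[ℝ] EuclideanSpace ℝ (Fin d₂) :=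
  (LinearMap.mk₂ ℝ G.bracket
    (fun x x' y => by simp only [bracket, PiLp.add_apply, add_mul, add_smul, Finset.sum_add_distrib])
    (fun c x y => by
      simp only [bracket, PiLp.smul_apply, smul_eq_mul, Finset.smul_sum, smul_smul, mul_assoc])
    (fun x y y' => by
      simp only [bracket, PiLp.add_apply, mul_add, add_smul, Finset.sum_add_distrib])
    (fun c x y => by
      simp only [bracket, PiLp.smul_apply, smul_eq_mul, Finset.smul_sum, smul_smul,
        mul_left_comm])).toContinuousBilinearMap

theorem bracketL_apply (x y : EuclideanSpace ℝ (Fin d₁)) : G.bracketL x y = G.bracket x y := rfl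

/-- A bound for the bracket: `‖[x, y]‖ ≤ K ‖x‖ ‖y‖`. -/
noncomputable def bracketBound : ℝ := ‖G.bracketL‖

theorem bracketBound_nonneg : 0 ≤ G.bracketBound := norm_nonneg G.bracketL

theorem norm_bracket_le (x y : EuclideanSpace ℝ (Fin d₁)) :
    ‖G.bracket x y‖ ≤ G.bracketBound * ‖x‖ * ‖y‖ :=
  G.bracketL.le_opNorm₂ x y

theorem bracket_add_left (x x' y : EuclideanSpace ℝ (Fin d₁)) :
    G.bracket (x + x') y = G.bracket x y + G.bracket x' y := by
  simp only [← bracketL_apply, map_add, add_apply]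

theorem bracket_add_right (x y y' : EuclideanSpace ℝ (Fin d₁)) :
    G.bracket x (y + y') = G.bracket x y + G.bracket x y' := by
  simp only [← bracketL_apply, map_add]

theorem bracket_sub_left (x x' y : EuclideanSpace ℝ (Fin d₁)) :
    G.bracket (x - x') y = G.bracket x y - G.bracket x' y := by
  simp only [← bracketL_apply, map_sub, sub_apply]

theorem bracket_sub_right (x y y' : EuclideanSpace ℝ (Fin d₁)) :
    G.bracket x (y - y') = G.bracket x y - G.bracket x y' := by
  simp only [← bracketL_apply, map_sub]

theorem bracket_neg_left (x y : EuclideanSpace ℝ (Fin d₁)) :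
    G.bracket (-x) y = -G.bracket x y := by
  simp only [← bracketL_apply, map_neg, neg_apply]

theorem bracket_neg_right (x y : EuclideanSpace ℝ (Fin d₁)) :
    G.bracket x (-y) = -G.bracket x y := by
  simp only [← bracketL_apply, map_neg]

theorem bracket_smul_left (c : ℝ) (x y : EuclideanSpace ℝ (Fin d₁)) :
    G.bracket (c • x) y = c • G.bracket x y := by
  simp only [← bracketL_apply, map_smul, smul_apply]

theorem bracket_smul_right (c : ℝ) (x y : EuclideanSpace ℝ (Fin d₁)) :
    G.bracket x (c • y) = c • G.bracket x y := by
  simp only [← bracketL_apply, map_smul]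

theorem bracket_zero_left (y : EuclideanSpace ℝ (Fin d₁)) : G.bracket 0 y = 0 := by
  simp only [← bracketL_apply, map_zero, zero_apply]

theorem bracket_swap (x y : EuclideanSpace ℝ (Fin d₁)) : G.bracket y x = -G.bracket x y := by
  have h := G.bracket_self (x + y)
  rw [bracket_add_left, bracket_add_right, bracket_add_right, bracket_self, bracket_self, zero_add,
    add_zero] at h
  exact eq_neg_of_add_eq_zero_right h

theorem bracket_single (i j : Fin d₁) (a b : ℝ) :
    G.bracket (EuclideanSpace.single i a) (EuclideanSpace.single j b) = (a * b) • G.w i j := by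
  unfold bracket
  rw [Finset.sum_eq_single i, Finset.sum_eq_single j]
  · simp
  · intro k _ hk; simp [hk]
  · simp
  · intro k _ hk; simp [hk]
  · simp

/-! ### Group law -/

theorem mul_assoc' (x y z : CarnotPoint d₁ d₂) : G.mul (G.mul x y) z = G.mul x (G.mul y z) := by
  refine Prod.ext (add_assoc _ _ _) ?_
  simp only [mul, bracket_add_left, bracket_add_right]
  module

theorem zero_mul' (x : CarnotPoint d₁ d₂) : G.mul 0 x = x := by
  simp [mul, bracket_zero_left]

theorem mul_zero' (x : CarnotPoint d₁ d₂) : G.mul x 0 = x := by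
  simp [mul, bracket_zero_right]

theorem mul_incr (x y : CarnotPoint d₁ d₂) : G.mul x (G.incr x y) = y := by
  rw [incr, ← mul_assoc']
  have : G.mul x (G.inv x) = 0 := by
    have := G.incr_self (G.inv x)
    simpa [incr, inv] using this
  rw [this, zero_mul']

theorem incr_fst (x y : CarnotPoint d₁ d₂) : (G.incr x y).1 = y.1 - x.1 := by
  simp [incr, mul, inv]; abel

theorem incr_snd (x y : CarnotPoint d₁ d₂) :
    (G.incr x y).2 = y.2 - x.2 - (1 / 2 : ℝ) • G.bracket x.1 y.1 := by
  simp only [incr, mul, inv, Prod.snd_neg, Prod.fst_neg, bracket_neg_left]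
  module

/-! ### Integration by parts for the bracket -/

variable {x y : ℝ → EuclideanSpace ℝ (Fin d₁)} {a b : ℝ}

theorem intervalIntegrable_bracket (hx : ContinuousOn x (uIcc a b))
    (hy : IntervalIntegrable y volume a b) :
    IntervalIntegrable (fun t => G.bracket (x t) (y t)) volume a b := by
  obtain ⟨C, hC⟩ := isCompact_uIcc.exists_bound_of_continuousOn hx
  rw [intervalIntegrable_iff] at hy ⊢
  refine Integrable.mono' (hy.norm.const_mul (G.bracketBound * C)) ?_ ?_
  · exact G.bracketL.aestronglyMeasurable_comp₂
      ((hx.mono uIoc_subset_uIcc).aestronglyMeasurable measurableSet_uIoc) hy.1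
  · refine (ae_restrict_iff' measurableSet_uIoc).2 (Eventually.of_forall fun t ht => ?_)
    refine (G.norm_bracket_le _ _).trans ?_
    gcongr
    · exact G.bracketBound_nonneg
    · exact hC t (uIoc_subset_uIcc ht)

theorem absolutelyContinuousOnInterval_bracket (hx : AbsolutelyContinuousOnInterval x a b)
    (hy : AbsolutelyContinuousOnInterval y a b) :
    AbsolutelyContinuousOnInterval (fun t => G.bracket (x t) (y t)) a b := by
  obtain ⟨C, hC⟩ := hx.exists_bound
  obtain ⟨D, hD⟩ := hy.exists_bound
  refine (hx.prodMk hy).of_dist_le (G.bracketBound * (C + D)) fun s hs t ht => ?_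
  have h : G.bracket (x s) (y s) - G.bracket (x t) (y t) =
      G.bracket (x s) (y s - y t) + G.bracket (x s - x t) (y t) := by
    rw [bracket_sub_left, bracket_sub_right]; abel
  rw [dist_eq_norm, h]
  have h1 : ‖x s - x t‖ ≤ dist (x s, y s) (x t, y t) := by
    rw [← dist_eq_norm, Prod.dist_eq]; exact le_max_left _ _
  have h2 : ‖y s - y t‖ ≤ dist (x s, y s) (x t, y t) := by
    rw [← dist_eq_norm, Prod.dist_eq]; exact le_max_right _ _
  have hK := G.bracketBound_nonneg
  calc _ ≤ G.bracketBound * ‖x s‖ * ‖y s - y t‖ + G.bracketBound * ‖x s - x t‖ * ‖y t‖ :=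
        (norm_add_le _ _).trans (add_le_add (G.norm_bracket_le _ _) (G.norm_bracket_le _ _))
    _ ≤ G.bracketBound * C * dist (x s, y s) (x t, y t) +
          G.bracketBound * dist (x s, y s) (x t, y t) * D := by
        have := hC s hs
        have := hD t ht
        have : 0 ≤ C := (norm_nonneg _).trans (hC s hs)
        gcongr
    _ = _ := by ring

theorem hasDerivAt_bracket {x' y' : EuclideanSpace ℝ (Fin d₁)} {t : ℝ} (hx : HasDerivAt x x' t)
    (hy : HasDerivAt y y' t) :
    HasDerivAt (fun t => G.bracket (x t) (y t)) (G.bracket (x t) y' + G.bracket x' (y t)) t := by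
  exact G.bracketL.hasDerivAt_of_bilinear (fun _ => hx) fun _ => hy

theorem integral_bracket_deriv (hx : AbsolutelyContinuousOnInterval x a b)
    (hy : AbsolutelyContinuousOnInterval y a b) :
    ∫ t in a..b, G.bracket (x t) (deriv y t) =
      G.bracket (x b) (y b) - G.bracket (x a) (y a) + ∫ t in a..b, G.bracket (y t) (deriv x t) := by
  have h1 := G.intervalIntegrable_bracket hx.continuousOn hy.intervalIntegrable_deriv_euclidean
  have h2 := G.intervalIntegrable_bracket hy.continuousOn hx.intervalIntegrable_deriv_euclidean
  rw [← sub_eq_iff_eq_add, ← intervalIntegral.integral_sub h1 h2,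
    ← (G.absolutelyContinuousOnInterval_bracket hx hy).integral_deriv_eq_sub_euclidean]
  refine intervalIntegral.integral_congr_ae ?_
  filter_upwards [hx.ae_differentiableAt_euclidean, hy.ae_differentiableAt_euclidean]
    with t h3 h4 ht
  have ht := uIoc_subset_uIcc ht
  rw [(G.hasDerivAt_bracket (h3 ht).hasDerivAt (h4 ht).hasDerivAt).deriv,
    G.bracket_swap (deriv x t) (y t), sub_neg_eq_add]

end StepTwoCarnotGroup

theorem IsACZero.mono {d : ℕ} {h : ℝ → EuclideanSpace ℝ (Fin d)} (hh : IsACZero h) {s t : ℝ}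
    (hs : s ∈ Icc (0 : ℝ) 1) (ht : t ∈ Icc (0 : ℝ) 1) : AbsolutelyContinuousOnInterval h s t := by
  refine AbsolutelyContinuousOnInterval.mono hh.1 ?_
  rw [← uIcc_of_le (zero_le_one' ℝ)] at hs ht
  exact uIcc_subset_uIcc hs ht

theorem IsACZero.add {d : ℕ} {f g : ℝ → EuclideanSpace ℝ (Fin d)} (hf : IsACZero f)
    (hg : IsACZero g) : IsACZero (f + g) :=
  ⟨AbsolutelyContinuousOnInterval.add hf.1 hg.1, by simp [hf.2, hg.2]⟩

namespace StepTwoCarnotGroup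

variable {d₁ d₂ : ℕ} (G : StepTwoCarnotGroup d₁ d₂)

/-- The second level of the lift of a sum; the mixed integral is moved onto `h` by an integration
by parts, which is what makes the shift `T_h` meaningful for a path that is merely continuous. -/
theorem lift_add_snd {ω h : ℝ → EuclideanSpace ℝ (Fin d₁)} (hω : IsACZero ω) (hh : IsACZero h)
    {t : ℝ} (ht : t ∈ Icc (0 : ℝ) 1) :
    (G.lift (ω + h) t).2 = (G.lift ω t).2 + (G.lift h t).2 +
      (∫ s in (0 : ℝ)..t, G.bracket (ω s) (deriv h s)) + (1 / 2 : ℝ) • G.bracket (h t) (ω t) := by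
  have h0 : (0 : ℝ) ∈ Icc (0 : ℝ) 1 := ⟨le_rfl, zero_le_one⟩
  have aω := hω.mono h0 ht
  have ah := hh.mono h0 ht
  have iω := aω.intervalIntegrable_deriv_euclidean
  have ih := ah.intervalIntegrable_deriv_euclidean
  have key : ∫ s in (0 : ℝ)..t, G.bracket ((ω + h) s) (deriv (ω + h) s) =
      ∫ s in (0 : ℝ)..t, ((G.bracket (ω s) (deriv ω s) + G.bracket (h s) (deriv h s)) +
        (G.bracket (ω s) (deriv h s) + G.bracket (h s) (deriv ω s))) := by
    refine intervalIntegral.integral_congr_ae ?_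
    filter_upwards [aω.ae_differentiableAt_euclidean, ah.ae_differentiableAt_euclidean]
      with s h3 h4 hs
    have hs := uIoc_subset_uIcc hs
    rw [deriv_add (h3 hs) (h4 hs), Pi.add_apply, bracket_add_left, bracket_add_right,
      bracket_add_right]
    abel
  have j1 := G.intervalIntegrable_bracket aω.continuousOn iω
  have j2 := G.intervalIntegrable_bracket ah.continuousOn ih
  have j3 := G.intervalIntegrable_bracket aω.continuousOn ih
  have j4 := G.intervalIntegrable_bracket ah.continuousOn iω
  have hp := G.integral_bracket_deriv ah aω
  rw [hh.2, bracket_zero_left, sub_zero] at hp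
  simp only [lift]
  rw [key, intervalIntegral.integral_add (j1.add j2) (j3.add j4), intervalIntegral.integral_add j1 j2,
    intervalIntegral.integral_add j3 j4, hp]
  module

end StepTwoCarnotGroup

/-! ### Bounds for the Carnot–Carathéodory distance -/

theorem AbsolutelyContinuousOnInterval.norm_sub_le_integral_norm_deriv {d : ℕ}
    {f : ℝ → EuclideanSpace ℝ (Fin d)} {a b : ℝ} (hf : AbsolutelyContinuousOnInterval f a b)
    (hab : a ≤ b) : ‖f b - f a‖ ≤ ∫ t in a..b, ‖deriv f t‖ := by
  rw [← hf.integral_deriv_eq_sub_euclidean]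
  exact intervalIntegral.norm_integral_le_integral_norm hab

namespace StepTwoCarnotGroup

variable {d₁ d₂ : ℕ} (G : StepTwoCarnotGroup d₁ d₂)

/-- A horizontal curve of length `ℓ` moves by at most `ℓ` horizontally, and by at most a multiple of
`ℓ²` vertically: the vertical velocity relative to the starting point is `½[γ_t - γ_0, v_t]`. -/
theorem IsHorizontalCurve.norm_le {G : StepTwoCarnotGroup d₁ d₂} {γ : ℝ → CarnotPoint d₁ d₂}
    {v : ℝ → EuclideanSpace ℝ (Fin d₁)} (h : G.IsHorizontalCurve γ v) :
    ∃ ℓ : ℝ, 0 ≤ ℓ ∧ ∫⁻ t in Icc (0 : ℝ) 1, ‖v t‖ₑ = ENNReal.ofReal ℓ ∧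
      ‖(γ 1).1 - (γ 0).1‖ ≤ ℓ ∧
      ‖(G.incr (γ 0) (γ 1)).2‖ ≤ G.bracketBound / 2 * ℓ ^ 2 := by
  obtain ⟨hac, hd⟩ := h
  have a1 : AbsolutelyContinuousOnInterval (fun t => (γ t).1) 0 1 :=
    hac.of_dist_le 1 fun s _ t _ => by rw [one_mul, Prod.dist_eq]; exact le_max_left _ _
  have a2 : AbsolutelyContinuousOnInterval (fun t => (γ t).2) 0 1 :=
    hac.of_dist_le 1 fun s _ t _ => by rw [one_mul, Prod.dist_eq]; exact le_max_right _ _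
  set f : ℝ → EuclideanSpace ℝ (Fin d₁) := fun t => (γ t).1 with hf
  have hd1 : ∀ᵐ t ∂(volume.restrict (Icc (0 : ℝ) 1)), HasDerivAt f (v t) t := by
    filter_upwards [hd] with t ht using (hasFDerivAt_fst.comp_hasDerivAt t ht)
  have hd2 : ∀ᵐ t ∂(volume.restrict (Icc (0 : ℝ) 1)),
      HasDerivAt (fun t => (γ t).2) ((1 / 2 : ℝ) • G.bracket (f t) (v t)) t := by
    filter_upwards [hd] with t ht using (hasFDerivAt_snd.comp_hasDerivAt t ht)
  have hi := a1.intervalIntegrable_deriv_euclidean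
  set ℓ : ℝ := ∫ t in (0 : ℝ)..1, ‖deriv f t‖ with hℓ
  have hle : ∀ t ∈ Icc (0 : ℝ) 1, ‖f t - f 0‖ ≤ ℓ := by
    intro t ht
    refine ((a1.mono ?_).norm_sub_le_integral_norm_deriv ht.1).trans ?_
    · rw [uIcc_of_le ht.1, uIcc_of_le zero_le_one]; exact Icc_subset_Icc_right ht.2
    · exact intervalIntegral.integral_mono_interval le_rfl ht.1 ht.2
        (Eventually.of_forall fun _ => norm_nonneg _) hi.norm
  have h1mem : (1 : ℝ) ∈ Icc (0 : ℝ) 1 := ⟨zero_le_one, le_rfl⟩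
  have hℓ0 : 0 ≤ ℓ := (norm_nonneg _).trans (hle 1 h1mem)
  refine ⟨ℓ, hℓ0, ?_, hle 1 h1mem, ?_⟩
  · have hi' : Integrable (deriv f) (volume.restrict (Icc (0 : ℝ) 1)) := by
      rwa [intervalIntegrable_iff_integrableOn_Icc_of_le zero_le_one] at hi
    rw [hℓ, intervalIntegral.integral_of_le zero_le_one, ← integral_Icc_eq_integral_Ioc,
      ofReal_integral_norm_eq_lintegral_enorm hi']
    refine lintegral_congr_ae ?_
    filter_upwards [hd1] with t ht using by rw [ht.deriv]
  · set p : ℝ → EuclideanSpace ℝ (Fin d₂) := fun t =>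
      (γ t).2 - (1 / 2 : ℝ) • G.bracket (f 0) (f t) with hp
    have hconst : AbsolutelyContinuousOnInterval (fun _ : ℝ => f 0) 0 1 :=
      a1.of_dist_le 0 fun s _ t _ => by simp
    have pac : AbsolutelyContinuousOnInterval p 0 1 :=
      a2.sub ((G.absolutelyContinuousOnInterval_bracket hconst a1).const_smul (1 / 2 : ℝ))
    have hp' : ∀ᵐ t : ℝ, t ∈ Ioc (0 : ℝ) 1 → ‖deriv p t‖ ≤ G.bracketBound / 2 * ℓ * ‖deriv f t‖ := by
      rw [ae_restrict_iff' measurableSet_Icc] at hd1 hd2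
      filter_upwards [hd1, hd2] with t h1 h2 ht
      have ht := Ioc_subset_Icc_self ht
      have e : HasDerivAt p ((1 / 2 : ℝ) • G.bracket (f t - f 0) (v t)) t := by
        have := (h2 ht).sub ((G.hasDerivAt_bracket (hasDerivAt_const t (f 0)) (h1 ht)).const_smul
          (1 / 2 : ℝ))
        refine this.congr_deriv ?_
        rw [bracket_sub_left, bracket_zero_left, add_zero, smul_sub]
      rw [e.deriv, (h1 ht).deriv, norm_smul]
      have := G.norm_bracket_le (f t - f 0) (v t)
      have h3 : G.bracketBound * ‖f t - f 0‖ * ‖v t‖ ≤ G.bracketBound * ℓ * ‖v t‖ := by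
        have := hle t ht
        have := G.bracketBound_nonneg
        gcongr
      norm_num
      linarith
    have e : (G.incr (γ 0) (γ 1)).2 = p 1 - p 0 := by
      rw [incr_snd, hp]; simp only [hf]; rw [bracket_self]; module
    rw [e]
    rw [← pac.integral_deriv_eq_sub_euclidean]
    refine (intervalIntegral.norm_integral_le_of_norm_le zero_le_one hp'
      (hi.norm.const_mul _)).trans_eq ?_
    rw [intervalIntegral.integral_const_mul, ← hℓ]
    ring

theorem norm_fst_sub_le_dcc {x y : CarnotPoint d₁ d₂} (h : G.dcc x y ≠ ∞) :
    ‖y.1 - x.1‖ ≤ (G.dcc x y).toReal := by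
  refine le_of_forall_gt fun c hc => ?_
  have h1 : G.dcc x y < ENNReal.ofReal c := (ENNReal.lt_ofReal_iff_toReal_lt h).2 hc
  simp only [dcc, iInf_lt_iff] at h1
  obtain ⟨γ, v, ⟨hγ, rfl, rfl⟩, hlt⟩ := h1
  obtain ⟨ℓ, hℓ, e, h2, -⟩ := hγ.norm_le
  rw [e, ENNReal.ofReal_lt_ofReal_iff_of_nonneg hℓ] at hlt
  exact h2.trans_lt hlt

theorem norm_incr_snd_le_dcc {x y : CarnotPoint d₁ d₂} (h : G.dcc x y ≠ ∞) :
    ‖(G.incr x y).2‖ ≤ G.bracketBound / 2 * (G.dcc x y).toReal ^ 2 := by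
  have key : ∀ c : ℝ, (G.dcc x y).toReal < c → ‖(G.incr x y).2‖ ≤ G.bracketBound / 2 * c ^ 2 := by
    intro c hc
    have h1 : G.dcc x y < ENNReal.ofReal c := (ENNReal.lt_ofReal_iff_toReal_lt h).2 hc
    simp only [dcc, iInf_lt_iff] at h1
    obtain ⟨γ, v, ⟨hγ, rfl, rfl⟩, hlt⟩ := h1
    obtain ⟨ℓ, hℓ, e, -, h2⟩ := hγ.norm_le
    rw [e, ENNReal.ofReal_lt_ofReal_iff_of_nonneg hℓ] at hlt
    refine h2.trans ?_
    have := G.bracketBound_nonneg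
    gcongr
  have hcont : Tendsto (fun c : ℝ => G.bracketBound / 2 * c ^ 2) (𝓝[>] (G.dcc x y).toReal)
      (𝓝 (G.bracketBound / 2 * (G.dcc x y).toReal ^ 2)) :=
    ((continuous_const.mul (continuous_pow 2)).tendsto _).mono_left nhdsWithin_le_nhds
  exact ge_of_tendsto hcont (by filter_upwards [self_mem_nhdsWithin] with c hc using key c hc)

/-- The distance is bounded by the length of the horizontal curve that a control `v` drives. -/
theorem dcc_le_of_control (x : CarnotPoint d₁ d₂) {v : ℝ → EuclideanSpace ℝ (Fin d₁)}
    (hv : IntervalIntegrable v volume 0 1) :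
    G.dcc x (x.1 + ∫ s in (0 : ℝ)..1, v s,
      x.2 + (1 / 2 : ℝ) • ∫ t in (0 : ℝ)..1, G.bracket (x.1 + ∫ s in (0 : ℝ)..t, v s) (v t)) ≤
      ∫⁻ t in Icc (0 : ℝ) 1, ‖v t‖ₑ := by
  have a1 : AbsolutelyContinuousOnInterval (fun t : ℝ => x.1 + ∫ s in (0 : ℝ)..t, v s) 0 1 :=
    hv.absolutelyContinuousOnInterval_primitive.of_dist_le 1 fun s _ t _ => by
      rw [dist_add_left, one_mul]
  have hb := G.intervalIntegrable_bracket a1.continuousOn hv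
  have a2 : AbsolutelyContinuousOnInterval (fun t : ℝ => x.2 + (1 / 2 : ℝ) •
      ∫ r in (0 : ℝ)..t, G.bracket (x.1 + ∫ s in (0 : ℝ)..r, v s) (v r)) 0 1 :=
    (hb.absolutelyContinuousOnInterval_primitive.const_smul (1 / 2 : ℝ)).of_dist_le 1
      fun s _ t _ => by rw [dist_add_left, one_mul]
  refine iInf₂_le_of_le (fun t : ℝ => (x.1 + ∫ s in (0 : ℝ)..t, v s, x.2 + (1 / 2 : ℝ) •
    ∫ r in (0 : ℝ)..t, G.bracket (x.1 + ∫ s in (0 : ℝ)..r, v s) (v r))) v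
    (iInf_le_of_le ⟨⟨a1.prodMk a2, ?_⟩, by simp, rfl⟩ le_rfl)
  rw [ae_restrict_iff' measurableSet_Icc]
  filter_upwards [hv.ae_hasDerivAt_integral, hb.ae_hasDerivAt_integral] with t h1 h2 ht
  rw [← uIcc_of_le zero_le_one] at ht
  exact ((h1 ht 0 left_mem_uIcc).const_add _).prodMk
    (((h2 ht 0 left_mem_uIcc).fun_const_smul (1 / 2 : ℝ)).const_add x.2)

theorem incr_lift_snd {h : ℝ → EuclideanSpace ℝ (Fin d₁)} (hh : IsACZero h) {s t : ℝ}
    (hs : s ∈ Icc (0 : ℝ) 1) (ht : t ∈ Icc (0 : ℝ) 1) :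
    (G.incr (G.lift h s) (G.lift h t)).2 =
      (1 / 2 : ℝ) • ∫ r in s..t, G.bracket (h r - h s) (deriv h r) := by
  have h0 : (0 : ℝ) ∈ Icc (0 : ℝ) 1 := ⟨le_rfl, zero_le_one⟩
  have as := hh.mono h0 hs
  have at' := hh.mono h0 ht
  have ast := hh.mono hs ht
  have i1 := G.intervalIntegrable_bracket as.continuousOn as.intervalIntegrable_deriv_euclidean
  have i2 := G.intervalIntegrable_bracket at'.continuousOn at'.intervalIntegrable_deriv_euclidean
  have i3 := G.intervalIntegrable_bracket ast.continuousOn ast.intervalIntegrable_deriv_euclidean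
  have i4 := G.intervalIntegrable_bracket (x := fun _ => h s) continuousOn_const
    ast.intervalIntegrable_deriv_euclidean
  have e : ∫ r in s..t, G.bracket (h s) (deriv h r) = G.bracket (h s) (h t - h s) := by
    rw [← ast.integral_deriv_eq_sub_euclidean]
    exact (G.bracketL (h s)).intervalIntegral_comp_comm ast.intervalIntegrable_deriv_euclidean
  simp only [bracket_sub_left]
  rw [incr_snd, intervalIntegral.integral_sub i3 i4, e, bracket_sub_right, bracket_self]
  simp only [lift]
  rw [← intervalIntegral.integral_interval_sub_left i2 i1]
  module

/-- The lift of `h` is a horizontal curve of speed `|ḣ|`. -/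
theorem dcc_mul_incr_lift_le {h : ℝ → EuclideanSpace ℝ (Fin d₁)} (hh : IsACZero h) {s t : ℝ}
    (hs : s ∈ Icc (0 : ℝ) 1) (ht : t ∈ Icc (0 : ℝ) 1) (hst : s < t) (x : CarnotPoint d₁ d₂) :
    G.dcc x (G.mul x (G.incr (G.lift h s) (G.lift h t))) ≤
      ENNReal.ofReal (∫ r in s..t, ‖deriv h r‖) := by
  have ast := hh.mono hs ht
  have hc : 0 < t - s := sub_pos.2 hst
  set v : ℝ → EuclideanSpace ℝ (Fin d₁) := fun r => (t - s) • deriv h ((t - s) * r + s) with hv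
  have hvi : IntervalIntegrable v volume 0 1 := by
    have h1 := (ast.intervalIntegrable_deriv_euclidean.comp_add_right s).comp_mul_left (c := t - s)
    simp only [sub_self, zero_div, div_self hc.ne'] at h1
    exact h1.smul (t - s)
  have hint : ∀ r ∈ Icc (0 : ℝ) 1, ∫ u in (0 : ℝ)..r, v u = h ((t - s) * r + s) - h s := by
    intro r hr
    have hm : (t - s) * r + s ∈ Icc (0 : ℝ) 1 :=
      ⟨by nlinarith [hr.1, hs.1], by nlinarith [hr.2, ht.2]⟩
    rw [hv, intervalIntegral.integral_smul, intervalIntegral.smul_integral_comp_mul_add, mul_zero,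
      zero_add, (hh.mono hs hm).integral_deriv_eq_sub_euclidean]
  have i3 := G.intervalIntegrable_bracket (x := fun r => h r - h s)
    (ast.continuousOn.sub continuousOn_const) ast.intervalIntegrable_deriv_euclidean
  have i4 := G.intervalIntegrable_bracket (x := fun _ => x.1) continuousOn_const
    ast.intervalIntegrable_deriv_euclidean
  have key := G.dcc_le_of_control x hvi
  have e1 : (x.1 + ∫ s in (0 : ℝ)..1, v s,
      x.2 + (1 / 2 : ℝ) • ∫ t in (0 : ℝ)..1, G.bracket (x.1 + ∫ s in (0 : ℝ)..t, v s) (v t)) =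
      G.mul x (G.incr (G.lift h s) (G.lift h t)) := by
    have e2 : ∫ r in (0 : ℝ)..1, G.bracket (x.1 + ∫ s in (0 : ℝ)..r, v s) (v r) =
        G.bracket x.1 (h t - h s) + ∫ r in s..t, G.bracket (h r - h s) (deriv h r) := by
      have : EqOn (fun r => G.bracket (x.1 + ∫ s in (0 : ℝ)..r, v s) (v r))
          (fun r => (t - s) • (fun u => G.bracket x.1 (deriv h u) +
            G.bracket (h u - h s) (deriv h u)) ((t - s) * r + s)) (uIcc 0 1) := by
        intro r hr
        rw [uIcc_of_le zero_le_one] at hr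
        beta_reduce
        rw [hint r hr, hv, bracket_smul_right, bracket_add_left]
      rw [intervalIntegral.integral_congr this, intervalIntegral.integral_smul,
        intervalIntegral.smul_integral_comp_mul_add (fun u => G.bracket x.1 (deriv h u) +
          G.bracket (h u - h s) (deriv h u)), mul_zero, zero_add, mul_one, sub_add_cancel,
        intervalIntegral.integral_add i4 i3, ← ast.integral_deriv_eq_sub_euclidean]
      congr 1
      exact (G.bracketL x.1).intervalIntegral_comp_comm ast.intervalIntegrable_deriv_euclidean
    rw [e2, hint 1 ⟨zero_le_one, le_rfl⟩, mul, G.incr_lift_snd hh hs ht, incr_fst]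
    refine Prod.ext ?_ ?_
    · simp [lift]
    · simp only [lift]
      module
  rw [e1] at key
  refine key.trans_eq ?_
  have hvi' : Integrable v (volume.restrict (Icc (0 : ℝ) 1)) := by
    rwa [intervalIntegrable_iff_integrableOn_Icc_of_le zero_le_one] at hvi
  rw [← ofReal_integral_norm_eq_lintegral_enorm hvi', integral_Icc_eq_integral_Ioc,
    ← intervalIntegral.integral_of_le zero_le_one]
  have e3 : ∀ r, ‖v r‖ = (t - s) • (fun u => ‖deriv h u‖) ((t - s) * r + s) := fun r => by
    rw [hv, norm_smul, Real.norm_of_nonneg hc.le, smul_eq_mul]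
  rw [intervalIntegral.integral_congr fun r _ => e3 r, intervalIntegral.integral_smul,
    intervalIntegral.smul_integral_comp_mul_add (fun u => ‖deriv h u‖), mul_zero,
    zero_add, mul_one, sub_add_cancel]

end StepTwoCarnotGroup

/-! ### Points close in coordinates are close for the Carnot–Carathéodory distance -/

namespace StepTwoCarnotGroup

variable {d₁ d₂ : ℕ} (G : StepTwoCarnotGroup d₁ d₂)

theorem contDiff_mul :
    ContDiff ℝ 1 fun p : CarnotPoint d₁ d₂ × CarnotPoint d₁ d₂ => G.mul p.1 p.2 := by
  have h : ContDiff ℝ 1 fun p : CarnotPoint d₁ d₂ × CarnotPoint d₁ d₂ => G.bracket p.1.1 p.2.1 :=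
    G.bracketL.isBoundedBilinearMap.contDiff.comp
      (f := fun p : CarnotPoint d₁ d₂ × CarnotPoint d₁ d₂ => (p.1.1, p.2.1)) (by fun_prop)
  unfold mul
  fun_prop

theorem locallyLipschitz_mul {γ γ' : ℝ → CarnotPoint d₁ d₂} (h : LocallyLipschitz γ)
    (h' : LocallyLipschitz γ') : LocallyLipschitz fun t => G.mul (γ t) (γ' t) := by
  have h1 := LocallyLipschitz.comp (f := fun p : CarnotPoint d₁ d₂ × CarnotPoint d₁ d₂ =>
    G.mul p.1 p.2) (g := fun t => (γ t, γ' t)) G.contDiff_mul.locallyLipschitz (h.prodMk h')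
  exact h1

/-- Left translations preserve horizontality. -/
theorem hasDerivAt_mul_left {γ : ℝ → CarnotPoint d₁ d₂} {v : EuclideanSpace ℝ (Fin d₁)} {t : ℝ}
    (h : HasDerivAt γ (G.horizontalField v (γ t)) t) (x : CarnotPoint d₁ d₂) :
    HasDerivAt (fun s => G.mul x (γ s)) (G.horizontalField v (G.mul x (γ t))) t := by
  have h1 : HasDerivAt (fun s => (γ s).1) v t := by
    have := (hasFDerivAt_fst (𝕜 := ℝ) (p := γ t)).comp_hasDerivAt t h
    exact this
  have h2 : HasDerivAt (fun s => (γ s).2) ((1 / 2 : ℝ) • G.bracket (γ t).1 v) t := by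
    have := (hasFDerivAt_snd (𝕜 := ℝ) (p := γ t)).comp_hasDerivAt t h
    exact this
  have h3 := (h1.const_add x.1).prodMk ((h2.const_add x.2).add
    ((G.hasDerivAt_bracket (hasDerivAt_const t x.1) h1).fun_const_smul (1 / 2 : ℝ)))
  refine h3.congr_deriv ?_
  simp only [horizontalField, mul, bracket_add_left, bracket_zero_left]
  refine Prod.ext rfl ?_
  module

/-- `z` is the endpoint of a piecewise `C¹` horizontal curve from the identity whose speed on
`[0, 1]` is at most `L`. The curve is constant outside `[0, 1]`, so that two such curves are
concatenated by multiplying reparametrised copies of them. -/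
def Reaches (z : CarnotPoint d₁ d₂) (L : ℝ) : Prop :=
  ∃ (γ : ℝ → CarnotPoint d₁ d₂) (v : ℝ → EuclideanSpace ℝ (Fin d₁)),
    LocallyLipschitz γ ∧ (∀ t ≤ 0, γ t = 0) ∧ (∀ t ≥ 1, γ t = z) ∧
      ∃ S : Set ℝ, S.Finite ∧ ∀ t ∉ S, HasDerivAt γ (G.horizontalField (v t) (γ t)) t ∧ ‖v t‖ ≤ L

theorem Reaches.mono {G : StepTwoCarnotGroup d₁ d₂} {z : CarnotPoint d₁ d₂} {L L' : ℝ}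
    (h : G.Reaches z L) (hL : L ≤ L') : G.Reaches z L' := by
  obtain ⟨γ, v, h1, h2, h3, S, hS, h4⟩ := h
  exact ⟨γ, v, h1, h2, h3, S, hS, fun t ht => ⟨(h4 t ht).1, (h4 t ht).2.trans hL⟩⟩

theorem Reaches.dcc_le {G : StepTwoCarnotGroup d₁ d₂} {z : CarnotPoint d₁ d₂} {L : ℝ}
    (h : G.Reaches z L) (x : CarnotPoint d₁ d₂) : G.dcc x (G.mul x z) ≤ ENNReal.ofReal L := by
  obtain ⟨γ, v, h1, h2, h3, S, hS, h4⟩ := h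
  have hae : ∀ᵐ t : ℝ, t ∉ S := hS.countable.ae_notMem _
  have hl : LocallyLipschitz fun t => G.mul x (γ t) :=
    G.locallyLipschitz_mul (LocallyLipschitz.const x) h1
  obtain ⟨K, hK⟩ := (hl.locallyLipschitzOn).exists_lipschitzOnWith_of_compact
    (isCompact_uIcc (a := (0 : ℝ)) (b := 1))
  refine iInf₂_le_of_le (fun t => G.mul x (γ t)) v (iInf_le_of_le ⟨⟨?_, ?_⟩, ?_, ?_⟩ ?_)
  · exact hK.absolutelyContinuousOnInterval
  · exact ae_restrict_of_ae (hae.mono fun t ht => G.hasDerivAt_mul_left (h4 t ht).1 x)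
  · beta_reduce
    rw [h2 0 le_rfl, mul_zero']
  · beta_reduce
    rw [h3 1 le_rfl]
  · calc ∫⁻ t in Icc (0 : ℝ) 1, ‖v t‖ₑ ≤ ∫⁻ t in Icc (0 : ℝ) 1, ENNReal.ofReal L := by
          refine lintegral_mono_ae (ae_restrict_of_ae (hae.mono fun t ht => ?_))
          rw [← ofReal_norm]
          exact ENNReal.ofReal_le_ofReal (h4 t ht).2
      _ = ENNReal.ofReal L := by simp

theorem reaches_horizontal (a : EuclideanSpace ℝ (Fin d₁)) : G.Reaches (a, 0) ‖a‖ := by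
  have hcl : LocallyLipschitz fun t : ℝ => max 0 (min 1 t) :=
    (LocallyLipschitz.id.const_min 1).const_max 0
  have hs : ContDiff ℝ 1 fun t : ℝ => ((t • a, 0) : CarnotPoint d₁ d₂) := by fun_prop
  have hm : ∀ c c' : ℝ, ((c • a, 0) : CarnotPoint d₁ d₂) = G.horizontalField (c • a) (c' • a, 0) := by
    intro c c'
    simp [horizontalField, bracket_smul_left, bracket_smul_right, bracket_self]
  refine ⟨fun t => (max 0 (min 1 t) • a, 0), fun t => (if 0 < t ∧ t < 1 then (1 : ℝ) else 0) • a,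
    hs.locallyLipschitz.comp hcl, ?_, ?_, {0, 1}, by simp, ?_⟩
  · intro t ht
    simp [ht]
  · intro t ht
    simp [ht]
  · intro t ht
    simp only [mem_insert_iff, mem_singleton_iff, not_or] at ht
    constructor
    · rw [← hm]
      have hc : HasDerivAt (fun t : ℝ => max 0 (min 1 t)) (if 0 < t ∧ t < 1 then (1 : ℝ) else 0) t := by
        rcases lt_or_gt_of_ne ht.1 with h0 | h0
        · rw [if_neg (by intro h; linarith [h.1])]
          refine (hasDerivAt_const t (0 : ℝ)).congr_of_eventuallyEq ?_
          filter_upwards [Iio_mem_nhds h0] with s hs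
          exact max_eq_left ((min_le_right _ _).trans (le_of_lt hs))
        · rcases lt_or_gt_of_ne ht.2 with h1 | h1
          · rw [if_pos ⟨h0, h1⟩]
            refine (hasDerivAt_id t).congr_of_eventuallyEq ?_
            filter_upwards [Ioo_mem_nhds h0 h1] with s hs
            rw [min_eq_right hs.2.le, max_eq_right hs.1.le, id]
          · rw [if_neg (by intro h; linarith [h.2])]
            refine (hasDerivAt_const t (1 : ℝ)).congr_of_eventuallyEq ?_
            filter_upwards [Ioi_mem_nhds h1] with s hs
            rw [min_eq_left (le_of_lt hs), max_eq_right zero_le_one]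
      exact (hc.smul_const a).prodMk (hasDerivAt_const t _)
    · beta_reduce
      split_ifs <;> simp

theorem Reaches.mul {G : StepTwoCarnotGroup d₁ d₂} {z z' : CarnotPoint d₁ d₂} {L : ℝ}
    (h : G.Reaches z L) (h' : G.Reaches z' L) : G.Reaches (G.mul z z') (2 * L) := by
  obtain ⟨γ, v, h1, h2, h3, S, hS, h4⟩ := h
  obtain ⟨γ', v', h1', h2', h3', S', hS', h4'⟩ := h'
  have l1 : LocallyLipschitz fun t : ℝ => 2 * t :=
    (by fun_prop : ContDiff ℝ 1 fun t : ℝ => 2 * t).locallyLipschitz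
  have l2 : LocallyLipschitz fun t : ℝ => 2 * t - 1 :=
    (by fun_prop : ContDiff ℝ 1 fun t : ℝ => 2 * t - 1).locallyLipschitz
  have hlin : ∀ (w : EuclideanSpace ℝ (Fin d₁)) (x : CarnotPoint d₁ d₂),
      (2 : ℝ) • G.horizontalField w x = G.horizontalField ((2 : ℝ) • w) x := by
    intro w x
    simp only [horizontalField, bracket_smul_right, Prod.smul_mk]
    refine Prod.ext rfl ?_
    module
  refine ⟨fun t => G.mul (γ (2 * t)) (γ' (2 * t - 1)),
    fun t => (2 : ℝ) • if t < 1 / 2 then v (2 * t) else v' (2 * t - 1), ?_, ?_, ?_,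
    ((fun t : ℝ => 2 * t) ⁻¹' S ∪ (fun t : ℝ => 2 * t - 1) ⁻¹' S') ∪ {1 / 2}, ?_, ?_⟩
  · exact G.locallyLipschitz_mul (h1.comp l1) (h1'.comp l2)
  · intro t ht
    simp only
    rw [h2 _ (by linarith), h2' _ (by linarith), zero_mul']
  · intro t ht
    simp only
    rw [h3 _ (by linarith), h3' _ (by linarith)]
  · refine ((hS.preimage ?_).union (hS'.preimage ?_)).union (finite_singleton _)
    · intro a _ b _ hab; simpa using hab
    · intro a _ b _ hab; simpa using hab
  · intro t ht
    simp only [mem_union, mem_preimage, mem_singleton_iff, not_or] at ht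
    obtain ⟨⟨hS1, hS2⟩, hne⟩ := ht
    have d1 : HasDerivAt (fun t : ℝ => 2 * t) 2 t := by simpa using (hasDerivAt_id t).const_mul 2
    rcases lt_or_gt_of_ne hne with hlt | hgt
    · have e := (h4 _ hS1).1.scomp t d1
      simp only [if_pos hlt]
      refine ⟨?_, ?_⟩
      · rw [← hlin, h2' (2 * t - 1) (by linarith), mul_zero']
        refine e.congr_of_eventuallyEq ?_
        filter_upwards [Iio_mem_nhds hlt] with s hs
        rw [h2' (2 * s - 1) (by have : s < 1 / 2 := hs; linarith), mul_zero', Function.comp]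
      · rw [norm_smul]
        have := (h4 _ hS1).2
        norm_num; exact this
    · have e := (h4' _ hS2).1.scomp t (d1.sub_const 1)
      rw [hlin] at e
      have e' := G.hasDerivAt_mul_left (γ := γ' ∘ fun t => 2 * t - 1) e z
      simp only [if_neg (not_lt.2 hgt.le)]
      refine ⟨?_, ?_⟩
      · rw [h3 (2 * t) (by linarith)]
        refine e'.congr_of_eventuallyEq ?_
        filter_upwards [Ioi_mem_nhds hgt] with s hs
        rw [h3 (2 * s) (by have : 1 / 2 < s := hs; linarith), Function.comp]
      · rw [norm_smul]
        have := (h4' _ hS2).2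
        norm_num; exact this

/-- A vertical direction `w i j` is reached by the commutator of two horizontal moves. -/
theorem reaches_vertical (i j : Fin d₁) (c : ℝ) :
    G.Reaches (0, c • G.w i j) (4 * √|c|) := by
  set a : EuclideanSpace ℝ (Fin d₁) := EuclideanSpace.single i √|c| with ha
  set b : EuclideanSpace ℝ (Fin d₁) := EuclideanSpace.single j (SignType.sign c * √|c|) with hb
  have hna : ‖a‖ ≤ √|c| := by simp [ha, abs_of_nonneg (Real.sqrt_nonneg _)]
  have hnb : ‖b‖ ≤ √|c| := by
    rw [hb, PiLp.norm_single, norm_mul, Real.norm_of_nonneg (Real.sqrt_nonneg _)]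
    refine mul_le_of_le_one_left (Real.sqrt_nonneg _) ?_
    rcases lt_trichotomy c 0 with h | h | h <;> simp [h]
  have hab : G.bracket a b = c • G.w i j := by
    rw [ha, hb, bracket_single, mul_left_comm, Real.mul_self_sqrt (abs_nonneg c), sign_mul_abs]
  have h1 := ((G.reaches_horizontal a).mono hna).mul ((G.reaches_horizontal b).mono hnb)
  have h2 := ((G.reaches_horizontal (-a)).mono ((norm_neg a).trans_le hna)).mul
    ((G.reaches_horizontal (-b)).mono ((norm_neg b).trans_le hnb))
  have h3 := h1.mul h2
  have e : G.mul (G.mul (a, 0) (b, 0)) (G.mul (-a, 0) (-b, 0)) = (0, c • G.w i j) := by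
    simp only [mul, bracket_neg_left, bracket_neg_right, bracket_add_left, bracket_add_right,
      bracket_self, neg_neg]
    rw [G.bracket_swap a b, hab]
    refine Prod.ext ?_ ?_
    · simp only; abel
    · simp only; module
  rw [e, ← mul_assoc] at h3
  exact h3.mono (by norm_num)

theorem reaches_vertical_sum (s : Finset (Fin d₁ × Fin d₁)) :
    ∀ ε > 0, ∃ δ > 0, ∀ c : Fin d₁ × Fin d₁ → ℝ, (∀ p, |c p| < δ) →
      G.Reaches (0, ∑ p ∈ s, c p • G.w p.1 p.2) ε := by
  induction s using Finset.induction_on with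
  | empty =>
    intro ε hε
    refine ⟨1, one_pos, fun c _ => ?_⟩
    have h := G.reaches_horizontal 0
    rw [norm_zero] at h
    exact h.mono hε.le
  | insert p s hp ih =>
    intro ε hε
    obtain ⟨δ, hδ, h⟩ := ih (ε / 2) (by positivity)
    refine ⟨min δ ((ε / 8) ^ 2), by positivity, fun c hc => ?_⟩
    have h1 := h c fun p => (hc p).trans_le (min_le_left _ _)
    have h2 : G.Reaches (0, c p • G.w p.1 p.2) (ε / 2) := by
      refine (G.reaches_vertical p.1 p.2 (c p)).mono ?_
      have : √|c p| ≤ ε / 8 :=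
        Real.sqrt_le_iff.2 ⟨by positivity, ((hc p).trans_le (min_le_right _ _)).le⟩
      linarith
    have h3 := h2.mul h1
    rw [mul_div_cancel₀ _ (two_ne_zero)] at h3
    rw [Finset.sum_insert hp]
    simpa [StepTwoCarnotGroup.mul, bracket_zero_left] using h3

/-- A linear choice of coordinates with respect to the spanning family of structure constants. -/
theorem exists_coefficients : ∃ A : EuclideanSpace ℝ (Fin d₂) →L[ℝ] (Fin d₁ × Fin d₁ → ℝ),
    ∀ z, ∑ p, A z p • G.w p.1 p.2 = z := by
  have hr := Fintype.range_linearCombination ℝ (fun p : Fin d₁ × Fin d₁ => G.w p.1 p.2)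
  rw [G.span_eq_top] at hr
  obtain ⟨A, hA⟩ := LinearMap.exists_rightInverse_of_surjective _ hr
  refine ⟨LinearMap.toContinuousLinearMap A, fun z => ?_⟩
  have := congrArg (fun f => f z) hA
  simpa [Fintype.linearCombination_apply] using this

theorem reaches_small : ∀ ε > 0, ∃ δ > 0, ∀ z : CarnotPoint d₁ d₂, ‖z‖ < δ → G.Reaches z ε := by
  intro ε hε
  obtain ⟨A, hA⟩ := G.exists_coefficients
  obtain ⟨δ, hδ, h⟩ := G.reaches_vertical_sum Finset.univ (ε / 2) (by positivity)
  refine ⟨min (ε / 2) (δ / (‖A‖ + 1)), by positivity, fun z hz => ?_⟩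
  have h1 : G.Reaches (z.1, 0) (ε / 2) := (G.reaches_horizontal z.1).mono
    ((norm_fst_le z).trans (hz.trans_le (min_le_left _ _)).le)
  have h2 : G.Reaches (0, z.2) (ε / 2) := by
    rw [← hA z.2]
    refine h _ fun p => ?_
    have h3 : ‖z.2‖ < δ / (‖A‖ + 1) := (norm_snd_le z).trans_lt (hz.trans_le (min_le_right _ _))
    rw [lt_div_iff₀ (by positivity)] at h3
    calc |A z.2 p| ≤ ‖A z.2‖ := norm_le_pi_norm (A z.2) p
      _ ≤ ‖A‖ * ‖z.2‖ := A.le_opNorm _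
      _ < δ := by nlinarith [norm_nonneg z.2]
  have h3 := h1.mul h2
  rw [mul_div_cancel₀ _ (two_ne_zero)] at h3
  simpa [StepTwoCarnotGroup.mul, bracket_zero_right] using h3

theorem norm_incr_le (x y : CarnotPoint d₁ d₂) :
    ‖G.incr x y‖ ≤ (1 + G.bracketBound * ‖x‖) * ‖y - x‖ := by
  have hK := G.bracketBound_nonneg
  have h1 : ‖y.1 - x.1‖ ≤ ‖y - x‖ := norm_fst_le (y - x)
  have h2 : ‖y.2 - x.2‖ ≤ ‖y - x‖ := norm_snd_le (y - x)
  have h3 : 0 ≤ G.bracketBound * ‖x‖ * ‖y - x‖ := by positivity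
  rw [Prod.norm_def, max_le_iff, incr_fst, incr_snd]
  constructor
  · linarith
  · have e : G.bracket x.1 y.1 = G.bracket x.1 (y.1 - x.1) := by
      rw [bracket_sub_right, bracket_self, sub_zero]
    have h4 : ‖G.bracket x.1 y.1‖ ≤ G.bracketBound * ‖x‖ * ‖y - x‖ := by
      rw [e]
      refine (G.norm_bracket_le _ _).trans ?_
      gcongr
      exact norm_fst_le x
    have h5 := norm_sub_le (y.2 - x.2) ((1 / 2 : ℝ) • G.bracket x.1 y.1)
    rw [norm_smul] at h5
    norm_num at h5
    linarith

/-- On bounded sets, points that are close in coordinates are close for `dcc`, uniformly. -/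
theorem exists_dcc_le (R ε : ℝ) (hε : 0 < ε) : ∃ δ > 0, ∀ x y : CarnotPoint d₁ d₂,
    ‖x‖ ≤ R → ‖y - x‖ < δ → G.dcc x y ≤ ENNReal.ofReal ε := by
  obtain ⟨δ, hδ, h⟩ := G.reaches_small ε hε
  have hK := G.bracketBound_nonneg
  refine ⟨δ / (1 + G.bracketBound * |R|), by positivity, fun x y hx hxy => ?_⟩
  rw [lt_div_iff₀ (by positivity)] at hxy
  have h1 := (h (G.incr x y) ?_).dcc_le x
  · rwa [mul_incr] at h1
  · refine (G.norm_incr_le x y).trans_lt (lt_of_le_of_lt ?_ hxy)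
    rw [mul_comm]
    have := hx.trans (le_abs_self R)
    gcongr

/-- On bounded sets, points that are close for `dcc` are close in coordinates. -/
theorem norm_sub_le_of_dcc_le {x y : CarnotPoint d₁ d₂} {R ε : ℝ} (hR : ‖x‖ ≤ R ∨ ‖y‖ ≤ R)
    (hε : 0 ≤ ε)
    (h : G.dcc x y ≤ ENNReal.ofReal ε) :
    ‖y - x‖ ≤ ε + G.bracketBound * R * ε + G.bracketBound * ε ^ 2 := by
  have hK := G.bracketBound_nonneg
  have hR0 : 0 ≤ R := hR.elim (norm_nonneg x).trans (norm_nonneg y).trans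
  have hfin : G.dcc x y ≠ ∞ := ne_top_of_le_ne_top ENNReal.ofReal_ne_top h
  have hle : (G.dcc x y).toReal ≤ ε := ENNReal.toReal_le_of_le_ofReal hε h
  have h1 := (G.norm_fst_sub_le_dcc hfin).trans hle
  have h2 : ‖(G.incr x y).2‖ ≤ G.bracketBound / 2 * ε ^ 2 := by
    refine (G.norm_incr_snd_le_dcc hfin).trans ?_
    have := ENNReal.toReal_nonneg (a := G.dcc x y)
    gcongr
  have e : y.2 - x.2 = (G.incr x y).2 + (1 / 2 : ℝ) • G.bracket x.1 y.1 := by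
    rw [incr_snd]; module
  have h3 : ‖G.bracket x.1 y.1‖ ≤ G.bracketBound * R * ε := by
    rcases hR with hx | hy
    · have e1 : G.bracket x.1 y.1 = G.bracket x.1 (y.1 - x.1) := by
        rw [bracket_sub_right, bracket_self, sub_zero]
      rw [e1]
      refine (G.norm_bracket_le _ _).trans ?_
      have := (norm_fst_le x).trans hx
      gcongr
    · have e1 : G.bracket x.1 y.1 = -G.bracket y.1 (x.1 - y.1) := by
        rw [bracket_sub_right, bracket_self, sub_zero, bracket_swap]
      rw [e1, norm_neg]
      refine (G.norm_bracket_le _ _).trans ?_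
      rw [norm_sub_rev] at h1
      have := (norm_fst_le y).trans hy
      gcongr
  have h4 : 0 ≤ G.bracketBound * R * ε := by positivity
  have h5 : 0 ≤ G.bracketBound * ε ^ 2 := by positivity
  rw [Prod.norm_def, max_le_iff, Prod.fst_sub, Prod.snd_sub]
  constructor
  · linarith
  · rw [e]
    refine (norm_add_le _ _).trans ?_
    rw [norm_smul]
    norm_num
    linarith

end StepTwoCarnotGroup

/-! ### The path space is Polish -/

namespace StepTwoCarnotGroup

variable {d₁ d₂ : ℕ} (G : StepTwoCarnotGroup d₁ d₂)

theorem exists_dInf_le (R ε : ℝ) (hε : 0 < ε) : ∃ δ > 0, ∀ f g : ℝ → CarnotPoint d₁ d₂,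
    (∀ t ∈ Icc (0 : ℝ) 1, ‖f t‖ ≤ R) → (∀ t ∈ Icc (0 : ℝ) 1, ‖g t - f t‖ < δ) →
      G.dInf f g ≤ ENNReal.ofReal ε := by
  obtain ⟨δ, hδ, h⟩ := G.exists_dcc_le R ε hε
  exact ⟨δ, hδ, fun f g hf hg => iSup₂_le fun t ht => h _ _ (hf t ht) (hg t ht)⟩

theorem exists_norm_sub_lt (R ε : ℝ) (hε : 0 < ε) : ∃ δ > 0, ∀ f g : ℝ → CarnotPoint d₁ d₂,
    (∀ t ∈ Icc (0 : ℝ) 1, ‖f t‖ ≤ R ∨ ‖g t‖ ≤ R) → G.dInf f g ≤ ENNReal.ofReal δ →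
      ∀ t ∈ Icc (0 : ℝ) 1, ‖g t - f t‖ < ε := by
  have hK := G.bracketBound_nonneg
  have hc : Tendsto (fun e : ℝ => e + G.bracketBound * R * e + G.bracketBound * e ^ 2) (𝓝[>] 0)
      (𝓝 0) := by
    have h : Continuous fun e : ℝ => e + G.bracketBound * R * e + G.bracketBound * e ^ 2 := by
      fun_prop
    simpa using (h.tendsto 0).mono_left (nhdsWithin_le_nhds (s := Ioi 0))
  obtain ⟨δ, hδ, hδ0⟩ := ((hc.eventually (gt_mem_nhds hε)).and self_mem_nhdsWithin).exists
  have hδ0 : 0 < δ := hδ0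
  refine ⟨δ, hδ0, fun f g hf hfg t ht => lt_of_le_of_lt ?_ hδ⟩
  exact G.norm_sub_le_of_dcc_le (hf t ht) hδ0.le
    ((le_iSup₂ (f := fun t (_ : t ∈ Icc (0 : ℝ) 1) => G.dcc (f t) (g t)) t ht).trans hfg)

theorem tendsto_dInf_iff {f : ℕ → ℝ → CarnotPoint d₁ d₂} {g : ℝ → CarnotPoint d₁ d₂} {R : ℝ}
    (hg : ∀ t ∈ Icc (0 : ℝ) 1, ‖g t‖ ≤ R) :
    Tendsto (fun n => G.dInf (f n) g) atTop (𝓝 0) ↔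
      TendstoUniformlyOn f g atTop (Icc (0 : ℝ) 1) := by
  rw [Metric.tendstoUniformlyOn_iff]
  constructor
  · intro h ε hε
    obtain ⟨δ, hδ, h'⟩ := G.exists_norm_sub_lt R ε hε
    filter_upwards [h.eventually (gt_mem_nhds (ENNReal.ofReal_pos.2 hδ))] with n hn t ht
    rw [dist_eq_norm]
    exact h' (f n) g (fun t ht => Or.inr (hg t ht)) hn.le t ht
  · intro h
    rw [ENNReal.tendsto_nhds_zero]
    intro e he
    obtain ⟨q, -, hq0, hqe⟩ := ENNReal.lt_iff_exists_real_btwn.1 he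
    obtain ⟨δ, hδ, h'⟩ := G.exists_dInf_le (R + 1) q (ENNReal.ofReal_pos.1 hq0)
    filter_upwards [h (min δ 1) (by positivity)] with n hn
    have hn : ∀ t ∈ Icc (0 : ℝ) 1, ‖g t - f n t‖ < min δ 1 := fun t ht => by
      rw [← dist_eq_norm]; exact hn t ht
    refine (h' (f n) g (fun t ht => ?_) fun t ht => (hn t ht).trans_le (min_le_left _ _)).trans
      hqe.le
    have h1 := (hn t ht).trans_le (min_le_right _ _)
    have h2 := norm_sub_le (g t) (g t - f n t)
    rw [sub_sub_cancel] at h2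
    linarith [hg t ht]

end StepTwoCarnotGroup

namespace CarnotPath

variable {d₁ d₂ : ℕ} {G : StepTwoCarnotGroup d₁ d₂}

theorem coe_of_mem (X : CarnotPath G) {t : ℝ} (ht : t ∈ Icc (0 : ℝ) 1) :
    X t = X.toContinuousMap ⟨t, ht⟩ := IccExtend_of_mem _ _ ht

theorem coe_projIcc (X : CarnotPath G) (t : ℝ) : X t = X (projIcc 0 1 zero_le_one t : ℝ) := by
  rw [coe_of_mem X (projIcc 0 1 zero_le_one t).2]; rfl

theorem toContinuousMap_injective :
    Function.Injective (toContinuousMap : CarnotPath G → C(I, CarnotPoint d₁ d₂)) := by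
  rintro ⟨f, hf⟩ ⟨g, hg⟩ h
  cases h
  rfl

theorem norm_coe_le (X : CarnotPath G) (t : ℝ) : ‖X t‖ ≤ ‖X.toContinuousMap‖ :=
  X.toContinuousMap.norm_coe_le_norm _

theorem dist_toContinuousMap_le {X Y : CarnotPath G} {r : ℝ} (hr : 0 ≤ r)
    (h : ∀ t ∈ Icc (0 : ℝ) 1, ‖X t - Y t‖ ≤ r) :
    dist X.toContinuousMap Y.toContinuousMap ≤ r :=
  (ContinuousMap.dist_le hr).2 fun t => by
    rw [dist_eq_norm, ← coe_of_mem, ← coe_of_mem]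
    exact h t t.2

/-- The topology of `d_∞` is that of uniform convergence of the coordinates. -/
theorem isInducing_toContinuousMap :
    IsInducing (toContinuousMap : CarnotPath G → C(I, CarnotPoint d₁ d₂)) := by
  refine ⟨TopologicalSpace.ext_iff.2 fun U => ⟨fun hU => ?_, fun hU => ?_⟩⟩
  · have hU : ∀ X ∈ U, ∃ r : ℝ≥0∞, 0 < r ∧ ∀ Y : CarnotPath G, G.dInf X Y < r → Y ∈ U := hU
    have key : ∀ X : U, ∃ δ > 0, ∀ Y : CarnotPath G,
        dist Y.toContinuousMap X.1.toContinuousMap < δ → Y ∈ U := by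
      rintro ⟨X, hX⟩
      obtain ⟨r, hr, hrU⟩ := hU X hX
      obtain ⟨q, hq0, hqr⟩ := ENNReal.lt_iff_exists_real_btwn.1 hr
      obtain ⟨δ, hδ, h⟩ := G.exists_dInf_le ‖X.toContinuousMap‖ q (ENNReal.ofReal_pos.1 hqr.1)
      refine ⟨δ, hδ, fun Y hY => hrU Y (lt_of_le_of_lt (h X Y (fun t _ => X.norm_coe_le t) ?_)
        hqr.2)⟩
      intro t ht
      rw [coe_of_mem _ ht, coe_of_mem _ ht, ← dist_eq_norm]
      exact (ContinuousMap.dist_apply_le_dist _).trans_lt hY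
    choose δ hδ h using key
    rw [isOpen_induced_iff]
    refine ⟨⋃ X : U, Metric.ball X.1.toContinuousMap (δ X),
      isOpen_iUnion fun _ => Metric.isOpen_ball, ?_⟩
    ext Y
    simp only [mem_preimage, mem_iUnion, Metric.mem_ball]
    exact ⟨fun ⟨X, hX⟩ => h X Y hX, fun hY => ⟨⟨Y, hY⟩, by simpa using hδ ⟨Y, hY⟩⟩⟩
  · obtain ⟨V, hV, rfl⟩ := isOpen_induced_iff.1 hU
    intro X hX
    obtain ⟨ε, hε, hεV⟩ := Metric.isOpen_iff.1 hV _ hX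
    obtain ⟨δ, hδ, h⟩ := G.exists_norm_sub_lt ‖X.toContinuousMap‖ (ε / 2) (by positivity)
    refine ⟨ENNReal.ofReal δ, ENNReal.ofReal_pos.2 hδ, fun Y hY => hεV ?_⟩
    refine lt_of_le_of_lt (dist_toContinuousMap_le (by positivity) fun t ht => ?_) (half_lt_self hε)
    exact (h X Y (fun t _ => Or.inl (X.norm_coe_le t)) hY.le t ht).le

theorem isClosedEmbedding_toContinuousMap :
    IsClosedEmbedding (toContinuousMap : CarnotPath G → C(I, CarnotPoint d₁ d₂)) := by
  refine ⟨⟨isInducing_toContinuousMap, toContinuousMap_injective⟩, ?_⟩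
  have : range (toContinuousMap : CarnotPath G → C(I, CarnotPoint d₁ d₂)) = {f | f 0 = 0} := by
    ext f
    exact ⟨fun ⟨X, hX⟩ => hX ▸ X.map_zero, fun hf => ⟨⟨f, hf⟩, rfl⟩⟩
  rw [this]
  exact isClosed_eq (continuous_eval_const (0 : I)) continuous_const

instance : PolishSpace (CarnotPath G) := isClosedEmbedding_toContinuousMap.polishSpace

theorem continuous_eval_prod : Continuous fun p : CarnotPath G × ℝ => p.1 p.2 := by
  have h1 : Continuous fun p : CarnotPath G × ℝ => p.1.toContinuousMap :=
    isInducing_toContinuousMap.continuous.comp continuous_fst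
  have h2 : Continuous fun p : CarnotPath G × ℝ => projIcc (0 : ℝ) 1 zero_le_one p.2 :=
    continuous_projIcc.comp continuous_snd
  exact h1.eval h2

theorem tendsto_of_norm_sub_le {Z : ℕ → CarnotPath G} {X : CarnotPath G} {a : ℕ → ℝ}
    (ha : Tendsto a atTop (𝓝 0)) (h : ∀ n, ∀ t ∈ Icc (0 : ℝ) 1, ‖Z n t - X t‖ ≤ a n) :
    Tendsto Z atTop (𝓝 X) := by
  rw [isInducing_toContinuousMap.tendsto_nhds_iff, tendsto_iff_dist_tendsto_zero]
  refine squeeze_zero (fun _ => dist_nonneg) (fun n => dist_toContinuousMap_le ?_ (h n)) ha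
  exact (norm_nonneg _).trans (h n 0 ⟨le_rfl, zero_le_one⟩)

/-- The Borel `σ`-algebra of the path space is generated by the evaluations (Lusin–Souslin). -/
theorem measurable_of_eval {α : Type*} [MeasurableSpace α] {f : α → CarnotPath G}
    (h : ∀ t ∈ Icc (0 : ℝ) 1, Measurable fun a => f a t) : Measurable f := by
  have hc : Continuous fun (X : CarnotPath G) (q : ℚ) => X (q : ℝ) :=
    continuous_pi fun q => continuous_eval_prod.comp (continuous_id.prodMk continuous_const)
  have hi : Function.Injective fun (X : CarnotPath G) (q : ℚ) => X (q : ℝ) := by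
    intro X Y hXY
    have he : (X : ℝ → CarnotPoint d₁ d₂) = Y := by
      refine Continuous.ext_on Rat.denseRange_cast X.continuous_coe Y.continuous_coe ?_
      rintro _ ⟨q, rfl⟩
      exact congrFun hXY q
    refine toContinuousMap_injective (ContinuousMap.ext fun t => ?_)
    have := congrFun he (t : ℝ)
    rwa [coe_of_mem X t.2, coe_of_mem Y t.2] at this
  rw [← (hc.measurableEmbedding hi).measurable_comp_iff]
  refine measurable_pi_lambda _ fun q => ?_
  simp only [Function.comp]
  have := h _ (projIcc (0 : ℝ) 1 zero_le_one q).2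
  simpa only [← coe_projIcc] using this

end CarnotPath

/-! ### The shift by an absolutely continuous path -/

namespace StepTwoCarnotGroup

variable {d₁ d₂ : ℕ} (G : StepTwoCarnotGroup d₁ d₂)

theorem norm_integral_bracket_le {x v : ℝ → EuclideanSpace ℝ (Fin d₁)} {s t c : ℝ} (hst : s ≤ t)
    (hx : ∀ r ∈ Icc s t, ‖x r‖ ≤ c) (hv : IntervalIntegrable v volume s t) :
    ‖∫ r in s..t, G.bracket (x r) (v r)‖ ≤ G.bracketBound * c * ∫ r in s..t, ‖v r‖ := by
  rw [← intervalIntegral.integral_const_mul]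
  refine intervalIntegral.norm_integral_le_of_norm_le hst (Eventually.of_forall fun r hr => ?_)
    (hv.norm.const_mul _)
  refine (G.norm_bracket_le _ _).trans ?_
  have := hx r (Ioc_subset_Icc_self hr)
  have := G.bracketBound_nonneg
  gcongr

/-- The path `T_h x` given by integrating by parts, so that only `h` has to be differentiated. -/
noncomputable def shift (h : ℝ → EuclideanSpace ℝ (Fin d₁)) (x : ℝ → CarnotPoint d₁ d₂) (t : ℝ) :
    CarnotPoint d₁ d₂ :=
  ((x t).1 + h t, (x t).2 + (G.lift h t).2 +
    (∫ s in (0 : ℝ)..t, G.bracket (x s).1 (deriv h s)) + (1 / 2 : ℝ) • G.bracket (h t) (x t).1)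

/-- The shift is Lipschitz for uniform convergence. -/
theorem exists_norm_lift_add_sub_shift_le {h : ℝ → EuclideanSpace ℝ (Fin d₁)} (hh : IsACZero h) :
    ∃ C : ℝ, 0 ≤ C ∧ ∀ ω : ℝ → EuclideanSpace ℝ (Fin d₁), IsACZero ω →
      ∀ x : ℝ → CarnotPoint d₁ d₂, Continuous x → ∀ r : ℝ,
        (∀ t ∈ Icc (0 : ℝ) 1, ‖G.lift ω t - x t‖ ≤ r) →
          ∀ t ∈ Icc (0 : ℝ) 1, ‖G.lift (ω + h) t - G.shift h x t‖ ≤ C * r := by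
  have hK := G.bracketBound_nonneg
  have h0 : (0 : ℝ) ∈ Icc (0 : ℝ) 1 := ⟨le_rfl, zero_le_one⟩
  obtain ⟨W, hW⟩ := hh.1.exists_bound
  rw [uIcc_of_le zero_le_one] at hW
  have hi := hh.1.intervalIntegrable_deriv_euclidean
  set V : ℝ := ∫ s in (0 : ℝ)..1, ‖deriv h s‖ with hV
  have hV0 : 0 ≤ V := intervalIntegral.integral_nonneg zero_le_one fun _ _ => norm_nonneg _
  have hW0 : 0 ≤ W := (norm_nonneg _).trans (hW 0 h0)
  refine ⟨1 + G.bracketBound * V + G.bracketBound * W, by positivity, ?_⟩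
  intro ω hω x hx r hr t ht
  have hr0 : 0 ≤ r := (norm_nonneg _).trans (hr 0 h0)
  have a1 : ∀ s ∈ Icc (0 : ℝ) 1, ‖ω s - (x s).1‖ ≤ r := fun s hs =>
    (norm_fst_le (G.lift ω s - x s)).trans (hr s hs)
  have a2 : ‖(G.lift ω t).2 - (x t).2‖ ≤ r := (norm_snd_le (G.lift ω t - x t)).trans (hr t ht)
  have at' := hh.mono h0 ht
  have it := at'.intervalIntegrable_deriv_euclidean
  have j1 := G.intervalIntegrable_bracket (hω.mono h0 ht).continuousOn it
  have j2 := G.intervalIntegrable_bracket (x := fun s => (x s).1) hx.fst.continuousOn it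
  have b1 : ‖∫ s in (0 : ℝ)..t, G.bracket (ω s - (x s).1) (deriv h s)‖ ≤
      G.bracketBound * r * V := by
    refine (G.norm_integral_bracket_le ht.1
      (fun s hs => a1 s ⟨hs.1, hs.2.trans ht.2⟩) it).trans ?_
    refine mul_le_mul_of_nonneg_left ?_ (by positivity)
    exact intervalIntegral.integral_mono_interval le_rfl ht.1 ht.2
      (Eventually.of_forall fun _ => norm_nonneg _) hi.norm
  have b2 : ‖G.bracket (h t) (ω t - (x t).1)‖ ≤ G.bracketBound * W * r := by
    refine (G.norm_bracket_le _ _).trans ?_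
    have := hW t ht
    have := a1 t ht
    gcongr
  have p1 : 0 ≤ G.bracketBound * V * r := by positivity
  have p2 : 0 ≤ G.bracketBound * W * r := by positivity
  have e1 : (G.lift (ω + h) t - G.shift h x t).1 = ω t - (x t).1 := by
    simp [lift, shift]
  have e2 : (G.lift (ω + h) t - G.shift h x t).2 = ((G.lift ω t).2 - (x t).2) +
      ((∫ s in (0 : ℝ)..t, G.bracket (ω s - (x s).1) (deriv h s)) +
        (1 / 2 : ℝ) • G.bracket (h t) (ω t - (x t).1)) := by
    simp only [bracket_sub_left]
    rw [Prod.snd_sub, G.lift_add_snd hω hh ht, intervalIntegral.integral_sub j1 j2,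
      bracket_sub_right, shift]
    module
  rw [Prod.norm_def, max_le_iff, e1, e2]
  constructor
  · linarith [a1 t ht]
  · have n1 := norm_add_le ((G.lift ω t).2 - (x t).2)
      ((∫ s in (0 : ℝ)..t, G.bracket (ω s - (x s).1) (deriv h s)) +
        (1 / 2 : ℝ) • G.bracket (h t) (ω t - (x t).1))
    have n2 := norm_add_le (∫ s in (0 : ℝ)..t, G.bracket (ω s - (x s).1) (deriv h s))
      ((1 / 2 : ℝ) • G.bracket (h t) (ω t - (x t).1))
    rw [norm_smul, Real.norm_of_nonneg (by norm_num)] at n2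
    linarith

theorem isACZero_of_contDiff {u : ℝ → EuclideanSpace ℝ (Fin d₁)} (hu : ContDiff ℝ 1 u)
    (h0 : u 0 = 0) : IsACZero u :=
  ⟨hu.contDiffOn.absolutelyContinuousOnInterval, h0⟩

/-! ### Density of the lifts -/

/-- The curve `P` is a uniform limit on `[0, 1]` of lifts. -/
def IsLimitOfLifts (P : ℝ → CarnotPoint d₁ d₂) : Prop :=
  ∀ ε > 0, ∃ ω, IsACZero ω ∧ ∀ t ∈ Icc (0 : ℝ) 1, ‖G.lift ω t - P t‖ ≤ ε

/-- A small loop of large frequency: its position tends to zero with `ρ`, while the area it sweeps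
in the `i`-`j` plane, and so the vertical displacement of its lift, tends to `½ ∫ f`. -/
noncomputable def oscillation (i j : Fin d₁) (f : ℝ → ℝ) (ρ : ℝ) (t : ℝ) :
    EuclideanSpace ℝ (Fin d₁) :=
  (ρ * (f t * Real.cos ((ρ ^ 2)⁻¹ * t) - f 0)) • EuclideanSpace.single i 1 +
    (ρ * Real.sin ((ρ ^ 2)⁻¹ * t)) • EuclideanSpace.single j 1

theorem isACZero_oscillation (i j : Fin d₁) {f : ℝ → ℝ} (hf : ContDiff ℝ 1 f) (ρ : ℝ) :
    IsACZero (oscillation i j f ρ) := by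
  refine isACZero_of_contDiff ?_ (by simp [oscillation])
  unfold oscillation
  fun_prop

theorem norm_oscillation_le (i j : Fin d₁) {f : ℝ → ℝ} {ρ F : ℝ} (hρ : 0 < ρ)
    (hF : ∀ t ∈ Icc (0 : ℝ) 1, |f t| ≤ F) {t : ℝ} (ht : t ∈ Icc (0 : ℝ) 1) :
    ‖oscillation i j f ρ t‖ ≤ ρ * (2 * F + 1) := by
  have h0 := hF 0 ⟨le_rfl, zero_le_one⟩
  have h1 : |f t * Real.cos ((ρ ^ 2)⁻¹ * t)| ≤ F := by
    rw [abs_mul]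
    exact (mul_le_of_le_one_right (abs_nonneg _) (Real.abs_cos_le_one _)).trans (hF t ht)
  have h2 : |f t * Real.cos ((ρ ^ 2)⁻¹ * t) - f 0| ≤ F + F := (abs_sub _ _).trans (add_le_add h1 h0)
  refine (norm_add_le _ _).trans ?_
  rw [norm_smul, norm_smul, PiLp.norm_single, PiLp.norm_single, norm_one, mul_one, mul_one,
    norm_mul, norm_mul, Real.norm_of_nonneg hρ.le, Real.norm_eq_abs, Real.norm_eq_abs]
  have h3 := Real.abs_sin_le_one ((ρ ^ 2)⁻¹ * t)
  nlinarith

theorem norm_lift_oscillation_snd_sub_le (i j : Fin d₁) {f : ℝ → ℝ} (hf : ContDiff ℝ 1 f)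
    {ρ F F' : ℝ} (hρ : 0 < ρ) (hF : |f 0| ≤ F) (hF' : ∀ t ∈ Icc (0 : ℝ) 1, |deriv f t| ≤ F')
    {t : ℝ} (ht : t ∈ Icc (0 : ℝ) 1) :
    ‖(G.lift (oscillation i j f ρ) t).2 - ((1 / 2 : ℝ) * ∫ s in (0 : ℝ)..t, f s) • G.w i j‖ ≤
      ρ ^ 2 * (F + F') * ‖G.w i j‖ := by
  set N : ℝ := (ρ ^ 2)⁻¹ with hN
  have hρN : ρ ^ 2 * N = 1 := mul_inv_cancel₀ (by positivity)
  have hfd : ∀ s, HasDerivAt f (deriv f s) s := fun s =>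
    (hf.differentiable (by norm_num)).differentiableAt.hasDerivAt
  have hlin : ∀ s, HasDerivAt (fun s : ℝ => N * s) N s := fun s => by
    simpa using (hasDerivAt_id s).const_mul N
  have hbr : ∀ s, G.bracket (oscillation i j f ρ s) (deriv (oscillation i j f ρ) s) =
      (f s - f 0 * Real.cos (N * s) - ρ ^ 2 * (deriv f s * Real.sin (N * s) * Real.cos (N * s))) •
        G.w i j := by
    intro s
    have hd := ((((hfd s).mul (hlin s).cos).sub_const (f 0)).const_mul ρ).smul_const
      (EuclideanSpace.single i (1 : ℝ)) |>.add
        (((hlin s).sin.const_mul ρ).smul_const (EuclideanSpace.single j (1 : ℝ)))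
    have e : deriv (oscillation i j f ρ) s = _ := hd.deriv
    rw [e, oscillation]
    simp only [bracket_add_left, bracket_add_right, bracket_smul_left, bracket_smul_right,
      bracket_single, mul_one, one_smul]
    have w0 : ∀ k, G.w k k = 0 := fun k => by
      have := G.bracket_self (EuclideanSpace.single k 1)
      rwa [bracket_single, one_mul, one_smul] at this
    simp only [w0, G.antisymm j i, smul_zero, smul_neg, zero_add, add_zero, smul_smul, ← hN]
    rw [neg_add_eq_sub, ← sub_smul]
    congr 1
    have hcs := Real.sin_sq_add_cos_sq (N * s)
    linear_combination (f s * Real.cos (N * s) ^ 2 - f 0 * Real.cos (N * s) +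
      f s * Real.sin (N * s) ^ 2) * hρN + f s * hcs
  have hfc := hf.continuous
  have hf'c : Continuous (deriv f) := hf.continuous_deriv (by norm_num)
  have hint : (G.lift (oscillation i j f ρ) t).2 - ((1 / 2 : ℝ) * ∫ s in (0 : ℝ)..t, f s) • G.w i j =
      (-(1 / 2 : ℝ) * (∫ s in (0 : ℝ)..t, (f 0 * Real.cos (N * s) +
        ρ ^ 2 * (deriv f s * Real.sin (N * s) * Real.cos (N * s))))) • G.w i j := by
    simp only [lift]
    rw [intervalIntegral.integral_congr fun s _ => hbr s, intervalIntegral.integral_smul_const,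
      smul_smul, ← sub_smul, ← mul_sub, ← intervalIntegral.integral_sub]
    · congr 1
      rw [neg_mul, ← mul_neg, ← intervalIntegral.integral_neg]
      congr 2
      ext s
      ring
    · apply Continuous.intervalIntegrable; fun_prop
    · exact hfc.intervalIntegrable _ _
  have hcos : ∫ s in (0 : ℝ)..t, Real.cos (N * s) = ρ ^ 2 * Real.sin (N * t) := by
    rw [intervalIntegral.integral_comp_mul_left _ (by positivity), integral_cos]
    simp [hN]
  have hJ : |∫ s in (0 : ℝ)..t, deriv f s * Real.sin (N * s) * Real.cos (N * s)| ≤ F' := by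
    rw [← Real.norm_eq_abs]
    refine (intervalIntegral.norm_integral_le_of_norm_le_const (C := F') fun s hs => ?_).trans ?_
    · rw [uIoc_of_le ht.1] at hs
      rw [norm_mul, norm_mul, Real.norm_eq_abs, Real.norm_eq_abs, Real.norm_eq_abs]
      have h1 := hF' s ⟨hs.1.le, hs.2.trans ht.2⟩
      have h2 := Real.abs_sin_le_one (N * s)
      have h3 := Real.abs_cos_le_one (N * s)
      have h4 := (abs_nonneg _).trans h1
      refine (mul_le_mul (mul_le_mul h1 h2 (abs_nonneg _) h4) h3 (abs_nonneg _)
        (by linarith)).trans_eq (by ring)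
    · have h1 := (abs_nonneg _).trans (hF' t ht)
      rw [sub_zero, abs_of_nonneg ht.1]
      exact mul_le_of_le_one_right h1 ht.2
  rw [hint, norm_smul, intervalIntegral.integral_add, intervalIntegral.integral_const_mul,
    intervalIntegral.integral_const_mul, hcos]
  · refine mul_le_mul_of_nonneg_right ?_ (norm_nonneg _)
    have h1 : |f 0 * (ρ ^ 2 * Real.sin (N * t))| ≤ F * ρ ^ 2 := by
      rw [abs_mul, abs_mul, abs_of_pos (by positivity : 0 < ρ ^ 2)]
      have h3 := Real.abs_sin_le_one (N * t)
      have : ρ ^ 2 * |Real.sin (N * t)| ≤ ρ ^ 2 := mul_le_of_le_one_right (by positivity) h3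
      gcongr
      exact (abs_nonneg _).trans hF
    have h2 : |ρ ^ 2 * ∫ s in (0 : ℝ)..t, deriv f s * Real.sin (N * s) * Real.cos (N * s)| ≤
        ρ ^ 2 * F' := by
      rw [abs_mul, abs_of_pos (by positivity : 0 < ρ ^ 2)]
      gcongr
    rw [Real.norm_eq_abs, abs_mul]
    have h3 := abs_add_le (f 0 * (ρ ^ 2 * Real.sin (N * t)))
      (ρ ^ 2 * ∫ s in (0 : ℝ)..t, deriv f s * Real.sin (N * s) * Real.cos (N * s))
    have h4 : |-(1 / 2 : ℝ)| = 1 / 2 := by norm_num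
    rw [h4]
    linarith [abs_nonneg (f 0 * (ρ ^ 2 * Real.sin (N * t)) +
      ρ ^ 2 * ∫ s in (0 : ℝ)..t, deriv f s * Real.sin (N * s) * Real.cos (N * s))]
  · apply Continuous.intervalIntegrable; fun_prop
  · apply Continuous.intervalIntegrable; fun_prop

variable {G}

/-- Superposing an oscillation adds a vertical drift in the direction `w i j`. -/
theorem IsLimitOfLifts.add_vertical {P : ℝ → CarnotPoint d₁ d₂} (hP : G.IsLimitOfLifts P)
    (i j : Fin d₁) {f : ℝ → ℝ} (hf : ContDiff ℝ 1 f) :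
    G.IsLimitOfLifts fun t => P t + (0, ((1 / 2 : ℝ) * ∫ s in (0 : ℝ)..t, f s) • G.w i j) := by
  intro ε hε
  obtain ⟨ω, hω, hωP⟩ := hP (ε / 2) (by positivity)
  have hK := G.bracketBound_nonneg
  have h0 : (0 : ℝ) ∈ Icc (0 : ℝ) 1 := ⟨le_rfl, zero_le_one⟩
  obtain ⟨W, hW⟩ := hω.1.exists_bound
  obtain ⟨F, hF⟩ := isCompact_Icc.exists_bound_of_continuousOn (s := Icc (0 : ℝ) 1)
    hf.continuous.continuousOn
  obtain ⟨F', hF'⟩ := isCompact_Icc.exists_bound_of_continuousOn (s := Icc (0 : ℝ) 1)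
    (hf.continuous_deriv (by norm_num)).continuousOn
  rw [uIcc_of_le zero_le_one] at hW
  have hi := hω.1.intervalIntegrable_deriv_euclidean
  set V : ℝ := ∫ s in (0 : ℝ)..1, ‖deriv ω s‖ with hV
  have hV0 : 0 ≤ V := intervalIntegral.integral_nonneg zero_le_one fun _ _ => norm_nonneg _
  have hW0 : 0 ≤ W := (norm_nonneg _).trans (hW 0 h0)
  have hF0 : 0 ≤ F := (norm_nonneg _).trans (hF 0 h0)
  have hF0' : 0 ≤ F' := (norm_nonneg _).trans (hF' 0 h0)
  have hc : Tendsto (fun ρ : ℝ => ρ * (2 * F + 1) + ρ ^ 2 * (F + F') * ‖G.w i j‖ +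
      G.bracketBound * (ρ * (2 * F + 1)) * V + G.bracketBound * W * (ρ * (2 * F + 1)))
      (𝓝[>] 0) (𝓝 0) := by
    have h : Continuous fun ρ : ℝ => ρ * (2 * F + 1) + ρ ^ 2 * (F + F') * ‖G.w i j‖ +
      G.bracketBound * (ρ * (2 * F + 1)) * V + G.bracketBound * W * (ρ * (2 * F + 1)) := by
      fun_prop
    simpa using (h.tendsto 0).mono_left (nhdsWithin_le_nhds (s := Ioi 0))
  obtain ⟨ρ, hρε, hρ⟩ := ((hc.eventually (gt_mem_nhds (half_pos hε))).and self_mem_nhdsWithin).exists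
  have hρ : 0 < ρ := hρ
  set u := oscillation i j f ρ with hu
  have hu0 := isACZero_oscillation i j hf ρ
  have hub : ∀ t ∈ Icc (0 : ℝ) 1, ‖u t‖ ≤ ρ * (2 * F + 1) := fun t ht =>
    norm_oscillation_le i j hρ hF ht
  refine ⟨u + ω, hu0.add hω, fun t ht => ?_⟩
  have at' := hω.mono h0 ht
  have it := at'.intervalIntegrable_deriv_euclidean
  have b0 := G.norm_lift_oscillation_snd_sub_le i j hf hρ (hF 0 h0) hF' ht
  have b1 : ‖∫ s in (0 : ℝ)..t, G.bracket (u s) (deriv ω s)‖ ≤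
      G.bracketBound * (ρ * (2 * F + 1)) * V := by
    refine (G.norm_integral_bracket_le ht.1
      (fun s hs => hub s ⟨hs.1, hs.2.trans ht.2⟩) it).trans ?_
    refine mul_le_mul_of_nonneg_left ?_ (by positivity)
    exact intervalIntegral.integral_mono_interval le_rfl ht.1 ht.2
      (Eventually.of_forall fun _ => norm_nonneg _) hi.norm
  have b2 : ‖G.bracket (ω t) (u t)‖ ≤ G.bracketBound * W * (ρ * (2 * F + 1)) := by
    refine (G.norm_bracket_le _ _).trans ?_
    have := hW t ht
    have := hub t ht
    gcongr
  have p0 : 0 ≤ ρ * (2 * F + 1) := by positivity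
  have p1 : 0 ≤ G.bracketBound * (ρ * (2 * F + 1)) * V := by positivity
  have p2 : 0 ≤ G.bracketBound * W * (ρ * (2 * F + 1)) := by positivity
  have p3 : 0 ≤ ρ ^ 2 * (F + F') * ‖G.w i j‖ := by positivity
  have a1 : ‖ω t - (P t).1‖ ≤ ε / 2 := (norm_fst_le (G.lift ω t - P t)).trans (hωP t ht)
  have a2 : ‖(G.lift ω t).2 - (P t).2‖ ≤ ε / 2 :=
    (norm_snd_le (G.lift ω t - P t)).trans (hωP t ht)
  rw [Prod.norm_def, max_le_iff, Prod.fst_sub, Prod.snd_sub, Prod.fst_add, Prod.snd_add]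
  constructor
  · have e : (G.lift (u + ω) t).1 - ((P t).1 + 0) = (ω t - (P t).1) + u t := by
      simp [lift]; abel
    rw [e]
    refine (norm_add_le _ _).trans ?_
    linarith [hub t ht]
  · rw [G.lift_add_snd hu0 hω ht]
    set A := ((1 / 2 : ℝ) * ∫ s in (0 : ℝ)..t, f s) • G.w i j
    have e : (G.lift u t).2 + (G.lift ω t).2 + (∫ s in (0 : ℝ)..t, G.bracket (u s) (deriv ω s)) +
        (1 / 2 : ℝ) • G.bracket (ω t) (u t) - ((P t).2 + A) =
        (((G.lift ω t).2 - (P t).2) + ((G.lift u t).2 - A)) +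
        ((∫ s in (0 : ℝ)..t, G.bracket (u s) (deriv ω s)) +
        (1 / 2 : ℝ) • G.bracket (ω t) (u t)) := by abel
    rw [e]
    have n1 := norm_add_le (((G.lift ω t).2 - (P t).2) + ((G.lift u t).2 - A))
      ((∫ s in (0 : ℝ)..t, G.bracket (u s) (deriv ω s)) + (1 / 2 : ℝ) • G.bracket (ω t) (u t))
    have n2 := norm_add_le ((G.lift ω t).2 - (P t).2) ((G.lift u t).2 - A)
    have n3 := norm_add_le (∫ s in (0 : ℝ)..t, G.bracket (u s) (deriv ω s))
      ((1 / 2 : ℝ) • G.bracket (ω t) (u t))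
    rw [norm_smul, Real.norm_of_nonneg (by norm_num : (0 : ℝ) ≤ 1 / 2)] at n3
    linarith

theorem IsLimitOfLifts.add_vertical_sum {P : ℝ → CarnotPoint d₁ d₂} (hP : G.IsLimitOfLifts P)
    {f : Fin d₁ × Fin d₁ → ℝ → ℝ} (hf : ∀ p, ContDiff ℝ 1 (f p))
    (s : Finset (Fin d₁ × Fin d₁)) :
    G.IsLimitOfLifts fun t =>
      P t + (0, ∑ p ∈ s, ((1 / 2 : ℝ) * ∫ r in (0 : ℝ)..t, f p r) • G.w p.1 p.2) := by
  induction s using Finset.induction_on with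
  | empty =>
    have e : (fun t => P t + ((0, ∑ p ∈ ∅, ((1 / 2 : ℝ) * ∫ r in (0 : ℝ)..t, f p r) •
        G.w p.1 p.2) : CarnotPoint d₁ d₂)) = P := by
      funext t
      exact Prod.ext (by simp) (by simp)
    rw [e]
    exact hP
  | insert p s hp ih =>
    have h := ih.add_vertical p.1 p.2 (hf p)
    have e : (fun t => P t + ((0, ∑ p ∈ insert p s, ((1 / 2 : ℝ) * ∫ r in (0 : ℝ)..t, f p r) •
        G.w p.1 p.2) : CarnotPoint d₁ d₂)) = fun t =>
        (P t + (0, ∑ p ∈ s, ((1 / 2 : ℝ) * ∫ r in (0 : ℝ)..t, f p r) • G.w p.1 p.2)) +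
          (0, ((1 / 2 : ℝ) * ∫ r in (0 : ℝ)..t, f p r) • G.w p.1 p.2) := by
      funext t
      refine Prod.ext (by simp) ?_
      simp only [Prod.snd_add]
      rw [Finset.sum_insert hp]
      abel
    rw [e]
    exact h

variable (G)

theorem isLimitOfLifts_of_contDiff {p : ℝ → EuclideanSpace ℝ (Fin d₁)}
    {q : ℝ → EuclideanSpace ℝ (Fin d₂)} (hp : ContDiff ℝ 2 p) (hq : ContDiff ℝ 2 q) (hp0 : p 0 = 0)
    (hq0 : q 0 = 0) : G.IsLimitOfLifts fun t => (p t, q t) := by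
  obtain ⟨A, hA⟩ := G.exists_coefficients
  have hp' : ContDiff ℝ 1 (deriv p) :=
    ContDiff.deriv' (by rwa [one_add_one_eq_two])
  have hq' : ContDiff ℝ 1 (deriv q) :=
    ContDiff.deriv' (by rwa [one_add_one_eq_two])
  have hp1 : ContDiff ℝ 1 p := hp.of_le (by norm_num)
  have hq1 : ContDiff ℝ 1 q := hq.of_le (by norm_num)
  have hb : ContDiff ℝ 1 fun t => G.bracket (p t) (deriv p t) :=
    G.bracketL.isBoundedBilinearMap.contDiff.comp (f := fun t => (p t, deriv p t))
      (hp1.prodMk hp')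
  set r : ℝ → EuclideanSpace ℝ (Fin d₂) := fun t =>
    deriv q t - (1 / 2 : ℝ) • G.bracket (p t) (deriv p t) with hr
  have hr1 : ContDiff ℝ 1 r := hq'.sub (hb.const_smul (1 / 2 : ℝ))
  have hAr : ContDiff ℝ 1 fun t => A (r t) := A.contDiff.comp hr1
  have hc : ∀ k : Fin d₁ × Fin d₁, ContDiff ℝ 1 fun t => 2 * A (r t) k := fun k =>
    contDiff_const.mul (contDiff_pi.1 hAr k)
  have hlift : G.IsLimitOfLifts (G.lift p) := fun ε hε =>
    ⟨p, isACZero_of_contDiff hp1 hp0, fun t _ => by simpa using hε.le⟩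
  have h := hlift.add_vertical_sum hc Finset.univ
  convert h using 2 with t
  have hsum : ∑ k, ((1 / 2 : ℝ) * ∫ s in (0 : ℝ)..t, 2 * A (r s) k) • G.w k.1 k.2 =
      ∫ s in (0 : ℝ)..t, r s := by
    have hk : ∀ k : Fin d₁ × Fin d₁, ((1 / 2 : ℝ) * ∫ s in (0 : ℝ)..t, 2 * A (r s) k) • G.w k.1 k.2 =
        ∫ s in (0 : ℝ)..t, A (r s) k • G.w k.1 k.2 := by
      intro k
      rw [intervalIntegral.integral_const_mul, ← mul_assoc, intervalIntegral.integral_smul_const]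
      norm_num
    rw [Finset.sum_congr rfl fun k _ => hk k, ← intervalIntegral.integral_finsetSum]
    · simp only [hA]
    · intro k _
      exact ((contDiff_pi.1 hAr k).continuous.smul continuous_const).intervalIntegrable _ _
  have hqi : ∫ s in (0 : ℝ)..t, deriv q s = q t := by
    rw [intervalIntegral.integral_deriv_eq_sub (fun s _ => (hq1.differentiable (by norm_num)) s)
      (hq'.continuous.intervalIntegrable _ _), hq0, sub_zero]
  rw [hsum, hr, intervalIntegral.integral_sub (hq'.continuous.intervalIntegrable _ _)
    ((hb.continuous.fun_const_smul _).intervalIntegrable _ _), hqi, intervalIntegral.integral_smul]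
  simp [lift]

theorem exists_contDiff_near {d : ℕ} {g : ℝ → EuclideanSpace ℝ (Fin d)} (hg : Continuous g)
    (hg0 : g 0 = 0) {ε : ℝ} (hε : 0 < ε) : ∃ p : ℝ → EuclideanSpace ℝ (Fin d),
      ContDiff ℝ 2 p ∧ p 0 = 0 ∧ ∀ t ∈ Icc (0 : ℝ) 1, ‖p t - g t‖ ≤ ε := by
  have hδ : 0 < ε / (2 * (d + 1)) := by positivity
  have hP : ∀ i : Fin d, ∃ P : Polynomial ℝ, ∀ t ∈ Icc (0 : ℝ) 1,
      |P.eval t - g t i| < ε / (2 * (d + 1)) := fun i =>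
    exists_polynomial_near_of_continuousOn 0 1 (fun t => g t i) (by fun_prop) _ hδ
  choose P hP using hP
  refine ⟨fun t => WithLp.toLp 2 fun i => (P i).eval t - (P i).eval 0, ?_, ?_, ?_⟩
  · rw [contDiff_euclidean]
    intro i
    simp only
    exact (by simpa using (P i).contDiff_aeval (𝕜 := ℝ) 2 : ContDiff ℝ 2 fun t => (P i).eval t).sub contDiff_const
  · ext i; simp
  · intro t ht
    have hi : ∀ i, |(P i).eval t - (P i).eval 0 - g t i| ≤ ε / (d + 1) := by
      intro i
      have h1 := hP i t ht
      have h2 := hP i 0 ⟨le_rfl, zero_le_one⟩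
      rw [hg0, PiLp.zero_apply, sub_zero] at h2
      have e : (P i).eval t - (P i).eval 0 - g t i = ((P i).eval t - g t i) - (P i).eval 0 := by ring
      rw [e]
      refine (abs_sub _ _).trans ((add_le_add h1.le h2.le).trans_eq ?_)
      field_simp
      norm_num
    refine le_of_sq_le_sq ?_ hε.le
    rw [EuclideanSpace.real_norm_sq_eq]
    calc _ ≤ ∑ _i : Fin d, (ε / (d + 1)) ^ 2 := by
          refine Finset.sum_le_sum fun i _ => ?_
          rw [← sq_abs]
          exact pow_le_pow_left₀ (abs_nonneg _) (hi i) 2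
      _ = d * (ε / (d + 1)) ^ 2 := by simp
      _ ≤ ε ^ 2 := by
          rw [div_pow, mul_div_assoc', div_le_iff₀ (by positivity)]
          have : (0 : ℝ) ≤ d := Nat.cast_nonneg d
          nlinarith [sq_nonneg ε, mul_nonneg this (sq_nonneg ε), mul_nonneg (mul_nonneg this this) (sq_nonneg ε)]

/-- Every continuous path is a uniform limit of lifts. -/
theorem isLimitOfLifts_of_continuous {x : ℝ → CarnotPoint d₁ d₂} (hx : Continuous x)
    (hx0 : x 0 = 0) : G.IsLimitOfLifts x := by
  intro ε hε
  obtain ⟨p, hp, hp0, hpx⟩ := exists_contDiff_near (g := fun t => (x t).1) hx.fst (by simp [hx0])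
    (half_pos hε)
  obtain ⟨q, hq, hq0, hqx⟩ := exists_contDiff_near (g := fun t => (x t).2) hx.snd (by simp [hx0])
    (half_pos hε)
  obtain ⟨ω, hω, h⟩ := G.isLimitOfLifts_of_contDiff hp hq hp0 hq0 (ε / 2) (half_pos hε)
  refine ⟨ω, hω, fun t ht => ?_⟩
  have h1 : ‖((p t, q t) : CarnotPoint d₁ d₂) - x t‖ ≤ ε / 2 := by
    rw [Prod.norm_def, max_le_iff]
    exact ⟨hpx t ht, hqx t ht⟩
  have h2 := norm_add_le (G.lift ω t - (p t, q t)) ((p t, q t) - x t)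
  rw [sub_add_sub_cancel] at h2
  linarith [h t ht]

end StepTwoCarnotGroup

namespace CarnotPath

variable {d₁ d₂ : ℕ} {G : StepTwoCarnotGroup d₁ d₂}

/-- The shift is given by the integrated-by-parts formula. -/
theorem isShift_iff {h : ℝ → EuclideanSpace ℝ (Fin d₁)} (hh : IsACZero h) (X Y : CarnotPath G) :
    IsShift h X Y ↔ ∀ t ∈ Icc (0 : ℝ) 1, Y t = G.shift h X t := by
  obtain ⟨C, hC, hbound⟩ := G.exists_norm_lift_add_sub_shift_le hh
  have hbX : ∀ t ∈ Icc (0 : ℝ) 1, ‖X t‖ ≤ ‖X.toContinuousMap‖ := fun t _ => X.norm_coe_le t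
  have hbY : ∀ t ∈ Icc (0 : ℝ) 1, ‖Y t‖ ≤ ‖Y.toContinuousMap‖ := fun t _ => Y.norm_coe_le t
  have key : ∀ ω : ℕ → ℝ → EuclideanSpace ℝ (Fin d₁), (∀ n, IsACZero (ω n)) →
      TendstoUniformlyOn (fun n => G.lift (ω n)) X atTop (Icc (0 : ℝ) 1) →
      TendstoUniformlyOn (fun n => G.lift (ω n + h)) (G.shift h X) atTop (Icc (0 : ℝ) 1) := by
    intro ω hω hX
    rw [Metric.tendstoUniformlyOn_iff] at hX ⊢
    intro ε hε
    filter_upwards [hX (ε / (C + 1)) (by positivity)] with n hn t ht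
    rw [dist_comm, dist_eq_norm]
    refine (hbound (ω n) (hω n) X X.continuous_coe (ε / (C + 1)) (fun s hs => ?_) t ht).trans_lt ?_
    · rw [← dist_eq_norm, dist_comm]
      exact (hn s hs).le
    · rw [mul_div_assoc', div_lt_iff₀ (by positivity)]
      linarith
  constructor
  · rintro ⟨ω, hω, h1, h2⟩ t ht
    rw [G.tendsto_dInf_iff hbX] at h1
    rw [G.tendsto_dInf_iff hbY] at h2
    exact tendsto_nhds_unique (h2.tendsto_at ht) ((key ω hω h1).tendsto_at ht)
  · intro hY
    choose ω hω happ using fun n : ℕ => G.isLimitOfLifts_of_continuous X.continuous_coe X.coe_zero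
      (1 / ((n : ℝ) + 1)) (by positivity)
    have h1 : TendstoUniformlyOn (fun n => G.lift (ω n)) X atTop (Icc (0 : ℝ) 1) := by
      rw [Metric.tendstoUniformlyOn_iff]
      intro ε hε
      filter_upwards [tendsto_one_div_add_atTop_nhds_zero_nat.eventually (gt_mem_nhds hε)]
        with n hn t ht
      rw [dist_comm, dist_eq_norm]
      exact (happ n t ht).trans_lt hn
    refine ⟨ω, hω, (G.tendsto_dInf_iff hbX).2 h1, (G.tendsto_dInf_iff hbY).2 ?_⟩
    exact (key ω hω h1).congr_right fun t ht => (hY t ht).symm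

end CarnotPath

/-! ### Bounded dyadic energies characterise the Cameron–Martin space -/

theorem dyadic_mem_Icc {m k : ℕ} (hk : k ≤ 2 ^ m) : (k : ℝ) / 2 ^ m ∈ Icc (0 : ℝ) 1 := by
  refine ⟨by positivity, (div_le_one (by positivity)).2 ?_⟩
  exact_mod_cast hk

theorem dyadic_succ_mem_Icc {m k : ℕ} (hk : k < 2 ^ m) : ((k : ℝ) + 1) / 2 ^ m ∈ Icc (0 : ℝ) 1 := by
  exact_mod_cast dyadic_mem_Icc (Nat.succ_le_of_lt hk)

theorem eqOn_of_dyadic {E : Type*} [TopologicalSpace E] [T2Space E] {f g : ℝ → E}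
    (hf : ContinuousOn f (Icc 0 1)) (hg : ContinuousOn g (Icc 0 1))
    (h : ∀ m k : ℕ, k ≤ 2 ^ m → f ((k : ℝ) / 2 ^ m) = g ((k : ℝ) / 2 ^ m)) :
    EqOn f g (Icc 0 1) := by
  intro t ht
  set u : ℕ → ℝ := fun m => (⌊t * 2 ^ m⌋₊ : ℝ) / 2 ^ m with hu
  have hk : ∀ m, ⌊t * 2 ^ m⌋₊ ≤ 2 ^ m := fun m => by
    refine Nat.floor_le_of_le ?_
    push_cast
    exact mul_le_of_le_one_left (by positivity) ht.2
  have hlim : Tendsto u atTop (𝓝[Icc 0 1] t) := by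
    refine tendsto_nhdsWithin_iff.2 ⟨?_, Eventually.of_forall fun m => dyadic_mem_Icc (hk m)⟩
    exact (tendsto_nat_floor_mul_div_atTop ht.1).comp
      (tendsto_pow_atTop_atTop_of_one_lt (one_lt_two : (1 : ℝ) < 2))
  have h1 := (hf t ht).tendsto.comp hlim
  have h2 := (hg t ht).tendsto.comp hlim
  refine tendsto_nhds_unique (h1.congr fun m => ?_) h2
  exact h m _ (hk m)

/-- The energy of the piecewise linear interpolation of `f` at the dyadic points of level `m`. -/
noncomputable def dyadicEnergy {d : ℕ} (m : ℕ) (f : ℝ → EuclideanSpace ℝ (Fin d)) : ℝ :=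
  2 ^ m * ∑ k ∈ Finset.range (2 ^ m), ‖f (((k : ℝ) + 1) / 2 ^ m) - f ((k : ℝ) / 2 ^ m)‖ ^ 2

theorem dyadicEnergy_nonneg {d : ℕ} (m : ℕ) (f : ℝ → EuclideanSpace ℝ (Fin d)) :
    0 ≤ dyadicEnergy m f := by
  unfold dyadicEnergy; positivity

theorem volume_real_dyadic_inter (m k l : ℕ) :
    volume.real (Ioc ((k : ℝ) / 2 ^ m) (((k : ℝ) + 1) / 2 ^ m) ∩
      Ioc ((l : ℝ) / 2 ^ m) (((l : ℝ) + 1) / 2 ^ m)) = if k = l then (2 ^ m)⁻¹ else 0 := by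
  rw [Ioc_inter_Ioc]
  split_ifs with h
  · subst h
    rw [sup_idem, inf_idem, Real.volume_real_Ioc_of_le (by gcongr; linarith)]
    ring
  · rw [Ioc_eq_empty, measureReal_empty]
    rw [not_lt]
    rcases lt_or_gt_of_ne h with h | h
    · refine inf_le_left.trans (le_trans ?_ le_sup_right)
      gcongr
      exact_mod_cast h
    · refine inf_le_right.trans (le_trans ?_ le_sup_left)
      gcongr
      exact_mod_cast h

theorem volume_real_dyadic_inter_initial (m k j : ℕ) :
    volume.real (Ioc ((k : ℝ) / 2 ^ m) (((k : ℝ) + 1) / 2 ^ m) ∩ Ioc 0 ((j : ℝ) / 2 ^ m)) =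
      if k < j then (2 ^ m)⁻¹ else 0 := by
  rw [Ioc_inter_Ioc, sup_of_le_left (by positivity)]
  split_ifs with h
  · have h' : ((k : ℝ) + 1) / 2 ^ m ≤ (j : ℝ) / 2 ^ m := by
      gcongr
      exact_mod_cast h
    rw [inf_of_le_left h', Real.volume_real_Ioc_of_le (by gcongr; linarith)]
    ring
  · rw [Ioc_eq_empty, measureReal_empty]
    rw [not_lt]
    refine inf_le_right.trans ?_
    gcongr
    exact_mod_cast not_lt.1 h

/-- The derivative of the dyadic interpolation of `f`, as an element of `L²`. -/
noncomputable def dyadicSlope {d : ℕ} (m : ℕ) (f : ℝ → EuclideanSpace ℝ (Fin d)) :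
    Lp (EuclideanSpace ℝ (Fin d)) 2 (volume : Measure ℝ) :=
  ∑ k ∈ Finset.range (2 ^ m), indicatorConstLp 2 (s := Ioc ((k : ℝ) / 2 ^ m) (((k : ℝ) + 1) / 2 ^ m))
    measurableSet_Ioc (measure_Ioc_lt_top.ne)
    ((2 : ℝ) ^ m • (f (((k : ℝ) + 1) / 2 ^ m) - f ((k : ℝ) / 2 ^ m)))

theorem norm_dyadicSlope_sq {d : ℕ} (m : ℕ) (f : ℝ → EuclideanSpace ℝ (Fin d)) :
    ‖dyadicSlope m f‖ ^ 2 = dyadicEnergy m f := by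
  rw [← real_inner_self_eq_norm_sq, dyadicSlope, sum_inner, dyadicEnergy, Finset.mul_sum]
  refine Finset.sum_congr rfl fun k hk => ?_
  rw [inner_sum, Finset.sum_eq_single k]
  · rw [L2.inner_indicatorConstLp_indicatorConstLp measurableSet_Ioc measurableSet_Ioc
      measure_Ioc_lt_top.ne measure_Ioc_lt_top.ne, volume_real_dyadic_inter, if_pos rfl,
      inner_smul_left, inner_smul_right, real_inner_self_eq_norm_sq]
    simp only [RCLike.conj_to_real, smul_eq_mul]
    field_simp
  · intro l _ hl
    rw [L2.inner_indicatorConstLp_indicatorConstLp measurableSet_Ioc measurableSet_Ioc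
      measure_Ioc_lt_top.ne measure_Ioc_lt_top.ne, volume_real_dyadic_inter, if_neg hl.symm,
      zero_smul]
  · exact fun h => absurd hk h

/-- Tested against indicators of initial dyadic intervals, the slopes recover the dyadic values of
`f`. -/
theorem inner_dyadicSlope {d : ℕ} {m j : ℕ} (hj : j ≤ 2 ^ m) {f : ℝ → EuclideanSpace ℝ (Fin d)}
    (h0 : f 0 = 0) (c : EuclideanSpace ℝ (Fin d)) :
    inner ℝ (dyadicSlope m f) (indicatorConstLp 2 (s := Ioc 0 ((j : ℝ) / 2 ^ m)) measurableSet_Ioc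
      (measure_Ioc_lt_top (μ := volume)).ne c) = inner ℝ (f ((j : ℝ) / 2 ^ m)) c := by
  have hf : f ((j : ℝ) / 2 ^ m) =
      ∑ k ∈ Finset.range j, (f (((k : ℝ) + 1) / 2 ^ m) - f ((k : ℝ) / 2 ^ m)) := by
    have := Finset.sum_range_sub (fun k : ℕ => f ((k : ℝ) / 2 ^ m)) j
    simp only [Nat.cast_add, Nat.cast_one, Nat.cast_zero, zero_div, h0, sub_zero] at this
    exact this.symm
  rw [dyadicSlope, sum_inner, hf, sum_inner]
  have hsub : Finset.range j ⊆ Finset.range (2 ^ m) := Finset.range_subset_range.2 hj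
  rw [← Finset.sum_subset hsub]
  · refine Finset.sum_congr rfl fun k hk => ?_
    rw [L2.inner_indicatorConstLp_indicatorConstLp measurableSet_Ioc measurableSet_Ioc
      measure_Ioc_lt_top.ne measure_Ioc_lt_top.ne, volume_real_dyadic_inter_initial,
      if_pos (Finset.mem_range.1 hk), inner_smul_left]
    simp only [RCLike.conj_to_real, smul_eq_mul]
    field_simp
  · intro k _ hk
    rw [L2.inner_indicatorConstLp_indicatorConstLp measurableSet_Ioc measurableSet_Ioc
      measure_Ioc_lt_top.ne measure_Ioc_lt_top.ne, volume_real_dyadic_inter_initial,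
      if_neg (by simpa using hk), zero_smul]

/-- A continuous path with bounded dyadic energies is a primitive of an `L²` function, obtained as
a weak limit of the slopes. -/
theorem exists_primitive_of_dyadicEnergy_le {d : ℕ} {f : ℝ → EuclideanSpace ℝ (Fin d)}
    (hf : ContinuousOn f (Icc 0 1)) (h0 : f 0 = 0) {S : ℝ} (hS : ∀ m, dyadicEnergy m f ≤ S) :
    ∃ g : Lp (EuclideanSpace ℝ (Fin d)) 2 (volume : Measure ℝ), ‖g‖ ^ 2 ≤ S ∧
      EqOn f (fun t => ∫ s in (0 : ℝ)..t, g s) (Icc 0 1) := by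
  have hS0 : 0 ≤ S := (dyadicEnergy_nonneg 0 f).trans (hS 0)
  set H := Lp (EuclideanSpace ℝ (Fin d)) 2 (volume : Measure ℝ)
  let φ : ℕ → WeakDual ℝ H := fun m =>
    StrongDual.toWeakDual (InnerProductSpace.toDual ℝ H (dyadicSlope m f))
  have hball : ∀ m, φ m ∈ WeakDual.toStrongDual ⁻¹' Metric.closedBall (0 : StrongDual ℝ H) √S := by
    intro m
    rw [mem_preimage, mem_closedBall_zero_iff]
    change ‖InnerProductSpace.toDual ℝ H (dyadicSlope m f)‖ ≤ √S
    rw [LinearIsometryEquiv.norm_map]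
    refine Real.le_sqrt_of_sq_le ?_
    rw [norm_dyadicSlope_sq]
    exact hS m
  obtain ⟨ψ, hψ, hlim⟩ := (WeakDual.isCompact_closedBall (𝕜 := ℝ) (0 : StrongDual ℝ H) √S)
    |>.ultrafilter_le_nhds ((hyperfilter ℕ).map φ)
    (le_principal_iff.2 (mem_map.2 (univ_mem' hball)))
  set g : H := (InnerProductSpace.toDual ℝ H).symm (WeakDual.toStrongDual ψ) with hg
  have hinner : ∀ v : H, Tendsto (fun m => inner ℝ (dyadicSlope m f) v) (hyperfilter ℕ : Filter ℕ)
      (𝓝 (inner ℝ g v)) := by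
    intro v
    have h1 : Tendsto φ (hyperfilter ℕ : Filter ℕ) (𝓝 ψ) := hlim
    have h2 := ((WeakDual.eval_continuous (𝕜 := ℝ) v).tendsto ψ).comp h1
    have e : inner ℝ g v = ψ v := by
      rw [hg, ← InnerProductSpace.toDual_apply_apply, LinearIsometryEquiv.apply_symm_apply]
      rfl
    rw [e]
    refine h2.congr fun m => ?_
    exact InnerProductSpace.toDual_apply_apply
  have hgint : ∀ a b : ℝ, IntervalIntegrable g volume a b := fun a b => by
    rw [intervalIntegrable_iff]
    exact integrableOn_Lp_of_measure_ne_top g fact_one_le_two_ennreal.elim (by simp [uIoc])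
  refine ⟨g, ?_, eqOn_of_dyadic hf ?_ ?_⟩
  · rw [mem_preimage, mem_closedBall_zero_iff] at hψ
    have : ‖g‖ ≤ √S := by rwa [hg, LinearIsometryEquiv.norm_map]
    calc ‖g‖ ^ 2 ≤ √S ^ 2 := by gcongr
      _ = S := Real.sq_sqrt hS0
  · exact (intervalIntegral.continuous_primitive hgint 0).continuousOn
  · intro m k hk
    refine ext_inner_right ℝ fun c => ?_
    have h1 := hinner (indicatorConstLp 2 (s := Ioc 0 ((k : ℝ) / 2 ^ m)) measurableSet_Ioc
      (measure_Ioc_lt_top (μ := volume)).ne c)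
    have h2 : ∀ᶠ n in (hyperfilter ℕ : Filter ℕ), inner ℝ (dyadicSlope n f)
        (indicatorConstLp 2 (s := Ioc 0 ((k : ℝ) / 2 ^ m)) measurableSet_Ioc
        (measure_Ioc_lt_top (μ := volume)).ne c) = inner ℝ (f ((k : ℝ) / 2 ^ m)) c := by
      have hle : (hyperfilter ℕ : Filter ℕ) ≤ atTop := Nat.hyperfilter_le_atTop
      filter_upwards [hle (eventually_ge_atTop m)] with n hn
      obtain ⟨j, rfl⟩ := Nat.exists_eq_add_of_le hn
      have e : (k : ℝ) / 2 ^ m = ((k * 2 ^ j : ℕ) : ℝ) / 2 ^ (m + j) := by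
        push_cast
        rw [pow_add, mul_div_mul_right _ _ (by positivity)]
      have hk' : k * 2 ^ j ≤ 2 ^ (m + j) := by
        rw [pow_add]; exact Nat.mul_le_mul_right _ hk
      simp only [e]
      exact inner_dyadicSlope hk' h0 c
    have h3 := tendsto_nhds_unique (h1.congr' h2) tendsto_const_nhds
    rw [real_inner_comm, L2.inner_indicatorConstLp_eq_inner_setIntegral ℝ measurableSet_Ioc
      (measure_Ioc_lt_top (μ := volume)).ne] at h3
    rw [intervalIntegral.integral_of_le (by positivity), ← h3, real_inner_comm]

theorem isCameronMartin_of_dyadicEnergy_le {d : ℕ} {f : ℝ → EuclideanSpace ℝ (Fin d)}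
    (hf : ContinuousOn f (Icc 0 1)) (h0 : f 0 = 0) {S : ℝ} (hS : ∀ m, dyadicEnergy m f ≤ S) :
    IsCameronMartin f ∧ ∫⁻ t in Icc (0 : ℝ) 1, ‖deriv f t‖ₑ ^ 2 ≤ ENNReal.ofReal S := by
  obtain ⟨g, hgS, hfg⟩ := exists_primitive_of_dyadicEnergy_le hf h0 hS
  have hgint : IntervalIntegrable g volume 0 1 := by
    rw [intervalIntegrable_iff]
    exact integrableOn_Lp_of_measure_ne_top g fact_one_le_two_ennreal.elim (by simp [uIoc])
  have hd : ∀ᵐ t ∂(volume.restrict (Icc (0 : ℝ) 1)), deriv f t = g t := by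
    rw [Measure.restrict_congr_set Ioo_ae_eq_Icc.symm, ae_restrict_iff' measurableSet_Ioo]
    filter_upwards [hgint.ae_hasDerivAt_integral] with t h1 ht
    rw [uIcc_of_le zero_le_one] at h1
    have h2 := h1 (Ioo_subset_Icc_self ht) 0 ⟨le_rfl, zero_le_one⟩
    have h3 : f =ᶠ[𝓝 t] fun t => ∫ s in (0 : ℝ)..t, g s := by
      filter_upwards [Icc_mem_nhds ht.1 ht.2] with s hs using hfg hs
    rw [h3.deriv_eq, h2.deriv]
  have hac : AbsolutelyContinuousOnInterval f 0 1 :=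
    hgint.absolutelyContinuousOnInterval_primitive.congr (by rwa [uIcc_of_le zero_le_one])
  refine ⟨⟨⟨hac, h0⟩, ((Lp.memLp g).restrict _).ae_eq (Filter.EventuallyEq.symm hd)⟩, ?_⟩
  calc ∫⁻ t in Icc (0 : ℝ) 1, ‖deriv f t‖ₑ ^ 2 = ∫⁻ t in Icc (0 : ℝ) 1, ‖g t‖ₑ ^ 2 := by
        refine lintegral_congr_ae ?_
        filter_upwards [hd] with t ht
        rw [ht]
    _ ≤ ∫⁻ t, ‖g t‖ₑ ^ 2 := setLIntegral_le_lintegral _ _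
    _ = ENNReal.ofReal (‖g‖ ^ 2) := by
        have h1 := eLpNorm_nnreal_pow_eq_lintegral (μ := (volume : Measure ℝ)) (f := g) (p := 2)
          two_ne_zero
        rw [Lp.norm_def, ← ENNReal.toReal_pow, ENNReal.ofReal_toReal]
        · simpa using h1.symm
        · exact ENNReal.pow_ne_top (Lp.eLpNorm_ne_top g)
    _ ≤ ENNReal.ofReal S := ENNReal.ofReal_le_ofReal hgS

/-! ### Energy estimates along dyadic partitions -/

theorem sq_intervalIntegral_le {f : ℝ → ℝ} {s t : ℝ} (hst : s ≤ t)
    (hf : IntervalIntegrable f volume s t)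
    (hf2 : IntervalIntegrable (fun r => f r ^ 2) volume s t) :
    (∫ r in s..t, f r) ^ 2 ≤ (t - s) * ∫ r in s..t, f r ^ 2 := by
  rcases hst.eq_or_lt with rfl | hlt
  · simp
  have hL : 0 < t - s := sub_pos.2 hlt
  set A := ∫ r in s..t, f r with hA
  -- the variance of `f` is nonnegative
  have h0 : 0 ≤ ∫ r in s..t, (f r - A / (t - s)) ^ 2 :=
    intervalIntegral.integral_nonneg hst fun _ _ => sq_nonneg _
  have e : ∫ r in s..t, (f r - A / (t - s)) ^ 2 =
      (∫ r in s..t, f r ^ 2) - 2 * (A / (t - s)) * A + (t - s) * (A / (t - s)) ^ 2 := by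
    have : ∀ r, (f r - A / (t - s)) ^ 2 =
        (f r ^ 2 - 2 * (A / (t - s)) * f r) + (A / (t - s)) ^ 2 := fun r => by ring
    simp only [this]
    rw [intervalIntegral.integral_add (hf2.sub (hf.const_mul _)) intervalIntegrable_const,
      intervalIntegral.integral_sub hf2 (hf.const_mul _), intervalIntegral.integral_const_mul,
      intervalIntegral.integral_const, smul_eq_mul]
  rw [e] at h0
  have e2 : (∫ r in s..t, f r ^ 2) - 2 * (A / (t - s)) * A + (t - s) * (A / (t - s)) ^ 2 =
      (∫ r in s..t, f r ^ 2) - A ^ 2 / (t - s) := by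
    field_simp
    ring
  rw [e2, sub_nonneg, div_le_iff₀ hL] at h0
  linarith

theorem sum_integral_dyadic (m : ℕ) {f : ℝ → ℝ} (hf : IntervalIntegrable f volume 0 1) :
    ∑ k ∈ Finset.range (2 ^ m), ∫ r in (k : ℝ) / 2 ^ m..((k : ℝ) + 1) / 2 ^ m, f r =
      ∫ r in (0 : ℝ)..1, f r := by
  have h := intervalIntegral.sum_integral_adjacent_intervals (f := f) (μ := volume)
    (a := fun k : ℕ => (k : ℝ) / 2 ^ m) (n := 2 ^ m) fun k hk => by
      refine hf.mono_set (uIcc_subset_uIcc ?_ ?_) <;> rw [uIcc_of_le zero_le_one]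
      · exact dyadic_mem_Icc hk.le
      · exact dyadic_mem_Icc hk
  simpa using h

theorem sum_range_mul_eq_sum_blocks {M : Type*} [AddCommMonoid M] (a b : ℕ) (f : ℕ → M) :
    ∑ k ∈ Finset.range (a * b), f k =
      ∑ J ∈ Finset.range a, ∑ i ∈ Finset.range b, f (J * b + i) := by
  induction a with
  | zero => simp
  | succ a ih => rw [Nat.succ_mul, Finset.sum_range_add, ih, Finset.sum_range_succ]

theorem dyadic_add_eq (m j k : ℕ) :
    (k : ℝ) / 2 ^ m = ((k * 2 ^ j : ℕ) : ℝ) / 2 ^ (m + j) := by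
  push_cast
  rw [pow_add, mul_div_mul_right _ _ (by positivity)]

theorem dyadic_succ_add_eq (m j k : ℕ) :
    ((k : ℝ) + 1) / 2 ^ m = ((k * 2 ^ j + 2 ^ j : ℕ) : ℝ) / 2 ^ (m + j) := by
  have := dyadic_add_eq m j (k + 1)
  rw [add_one_mul] at this
  exact_mod_cast this

theorem dyadicEnergy_le_add {d : ℕ} (m j : ℕ) (f : ℝ → EuclideanSpace ℝ (Fin d)) :
    dyadicEnergy m f ≤ dyadicEnergy (m + j) f := by
  have e : dyadicEnergy (m + j) f = 2 ^ m * ∑ J ∈ Finset.range (2 ^ m), 2 ^ j *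
      ∑ i ∈ Finset.range (2 ^ j), ‖f (((J * 2 ^ j + i : ℕ) + 1 : ℝ) / 2 ^ (m + j)) -
        f (((J * 2 ^ j + i : ℕ) : ℝ) / 2 ^ (m + j))‖ ^ 2 := by
    have := sum_range_mul_eq_sum_blocks (2 ^ m) (2 ^ j) fun k : ℕ =>
      ‖f (((k : ℝ) + 1) / 2 ^ (m + j)) - f ((k : ℝ) / 2 ^ (m + j))‖ ^ 2
    rw [← pow_add] at this
    rw [dyadicEnergy, this, ← Finset.mul_sum, ← mul_assoc, ← pow_add]
  rw [e, dyadicEnergy]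
  refine mul_le_mul_of_nonneg_left (Finset.sum_le_sum fun J _ => ?_) (by positivity)
  have h := Finset.sum_range_sub (fun i : ℕ => f (((J * 2 ^ j + i : ℕ) : ℝ) / 2 ^ (m + j))) (2 ^ j)
  rw [dyadic_succ_add_eq m j J, dyadic_add_eq m j J]
  rw [add_zero] at h
  rw [← h]
  refine (pow_le_pow_left₀ (norm_nonneg _) (norm_sum_le _ _) 2).trans ?_
  refine sq_sum_le_card_mul_sum_sq.trans_eq ?_
  simp only [Finset.card_range, Nat.cast_pow, Nat.cast_ofNat]
  congr 1
  refine Finset.sum_congr rfl fun i _ => ?_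
  push_cast
  ring_nf

namespace IsCameronMartin

variable {d : ℕ} {h : ℝ → EuclideanSpace ℝ (Fin d)}

theorem intervalIntegrable_deriv (hh : IsCameronMartin h) {s t : ℝ} (hs : s ∈ Icc (0 : ℝ) 1)
    (ht : t ∈ Icc (0 : ℝ) 1) : IntervalIntegrable (deriv h) volume s t :=
  (hh.1.mono hs ht).intervalIntegrable_deriv_euclidean

theorem intervalIntegrable_norm_deriv_sq (hh : IsCameronMartin h) {s t : ℝ}
    (hs : s ∈ Icc (0 : ℝ) 1) (ht : t ∈ Icc (0 : ℝ) 1) :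
    IntervalIntegrable (fun r => ‖deriv h r‖ ^ 2) volume s t := by
  have h1 : IntegrableOn (fun r => ‖deriv h r‖ ^ 2) (Icc (0 : ℝ) 1) :=
    hh.2.integrable_norm_pow two_ne_zero
  have h2 : uIcc s t ⊆ Icc 0 1 := by
    rw [← uIcc_of_le (zero_le_one' ℝ)] at hs ht ⊢
    exact uIcc_subset_uIcc hs ht
  exact (h1.mono_set h2).intervalIntegrable

theorem sq_integral_norm_deriv_le (hh : IsCameronMartin h) {s t : ℝ} (hs : s ∈ Icc (0 : ℝ) 1)
    (ht : t ∈ Icc (0 : ℝ) 1) (hst : s ≤ t) :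
    (∫ r in s..t, ‖deriv h r‖) ^ 2 ≤ (t - s) * ∫ r in s..t, ‖deriv h r‖ ^ 2 :=
  sq_intervalIntegral_le hst (hh.intervalIntegrable_deriv hs ht).norm
    (hh.intervalIntegrable_norm_deriv_sq hs ht)

theorem sum_sq_integral_norm_deriv_le (hh : IsCameronMartin h) (m : ℕ) :
    2 ^ m * ∑ k ∈ Finset.range (2 ^ m),
      (∫ r in (k : ℝ) / 2 ^ m..((k : ℝ) + 1) / 2 ^ m, ‖deriv h r‖) ^ 2 ≤
        ∫ r in (0 : ℝ)..1, ‖deriv h r‖ ^ 2 := by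
  rw [← sum_integral_dyadic m (hh.intervalIntegrable_norm_deriv_sq ⟨le_rfl, zero_le_one⟩
    ⟨zero_le_one, le_rfl⟩), Finset.mul_sum]
  refine Finset.sum_le_sum fun k hk => ?_
  have hk := Finset.mem_range.1 hk
  have h1 := hh.sq_integral_norm_deriv_le (dyadic_mem_Icc hk.le) (dyadic_succ_mem_Icc hk)
    (by gcongr; linarith)
  have e : ((k : ℝ) + 1) / 2 ^ m - (k : ℝ) / 2 ^ m = (2 ^ m)⁻¹ := by ring
  rw [e] at h1
  calc _ ≤ 2 ^ m * ((2 ^ m)⁻¹ * _) := mul_le_mul_of_nonneg_left h1 (by positivity)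
    _ = _ := by rw [mul_inv_cancel_left₀ (by positivity)]

theorem integral_norm_deriv_le (hh : IsCameronMartin h) :
    ∫ r in (0 : ℝ)..1, ‖deriv h r‖ ≤ 1 + ∫ r in (0 : ℝ)..1, ‖deriv h r‖ ^ 2 := by
  have h1 := hh.sq_integral_norm_deriv_le ⟨le_rfl, zero_le_one⟩ ⟨zero_le_one, le_rfl⟩ zero_le_one
  nlinarith [sq_nonneg ((∫ r in (0 : ℝ)..1, ‖deriv h r‖) - 1)]

theorem dyadicEnergy_le (hh : IsCameronMartin h) (m : ℕ) :
    dyadicEnergy m h ≤ ∫ r in (0 : ℝ)..1, ‖deriv h r‖ ^ 2 := by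
  refine le_trans ?_ (hh.sum_sq_integral_norm_deriv_le m)
  unfold dyadicEnergy
  gcongr with k hk
  have hk := Finset.mem_range.1 hk
  exact (hh.1.mono (dyadic_mem_Icc hk.le)
    (dyadic_succ_mem_Icc hk)).norm_sub_le_integral_norm_deriv (by gcongr; linarith)

theorem cameronMartinNorm_sq (hh : IsCameronMartin h) :
    cameronMartinNorm h ^ (2 : ℝ) = ENNReal.ofReal (∫ r in (0 : ℝ)..1, ‖deriv h r‖ ^ 2) := by
  have h1 : IntegrableOn (fun r => ‖deriv h r‖ ^ 2) (Icc (0 : ℝ) 1) :=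
    hh.2.integrable_norm_pow two_ne_zero
  rw [cameronMartinNorm, ← ENNReal.rpow_mul, one_div_mul_cancel two_ne_zero, ENNReal.rpow_one,
    intervalIntegral.integral_of_le zero_le_one, ← integral_Icc_eq_integral_Ioc,
    ofReal_integral_eq_lintegral_ofReal h1 (Eventually.of_forall fun _ => by positivity)]
  refine lintegral_congr fun r => ?_
  rw [ENNReal.ofReal_pow (norm_nonneg _), ofReal_norm]

end IsCameronMartin

/-! ### Almost additive vertical increments -/

namespace StepTwoCarnotGroup

variable {d₁ d₂ : ℕ} (G : StepTwoCarnotGroup d₁ d₂)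

/-- The increments of `B` compensated by those of the Riemann sums of `∫ [x, dh] + ½ ∫ [h, dh]`.
For `x = π₁X` and `h = π₁Y - π₁X`, and the appropriate `B`, this is the vertical part of
`X_{s,t}⁻¹ Y_{s,t}`. -/
noncomputable def germ {ι : Type*} (x h : ι → EuclideanSpace ℝ (Fin d₁))
    (B : ι → EuclideanSpace ℝ (Fin d₂)) (s t : ι) : EuclideanSpace ℝ (Fin d₂) :=
  B t - B s - G.bracket (x t) (h t - h s) - (1 / 2 : ℝ) • G.bracket (h s) (h t)

/-- The failure of additivity of the germs. The terms `B` and the brackets with a fixed left argument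
telescope. -/
theorem germ_add (x h : ℕ → EuclideanSpace ℝ (Fin d₁)) (B : ℕ → EuclideanSpace ℝ (Fin d₂))
    (a N : ℕ) : G.germ x h B a (a + N) = ∑ i ∈ Finset.range N, (G.germ x h B (a + i) (a + i + 1) +
      G.bracket (x (a + i + 1) - x (a + N)) (h (a + i + 1) - h (a + i)) +
        (1 / 2 : ℝ) • G.bracket (h (a + i) - h a) (h (a + i + 1) - h (a + i))) := by
  have e : ∀ i, G.germ x h B (a + i) (a + i + 1) +
      G.bracket (x (a + i + 1) - x (a + N)) (h (a + i + 1) - h (a + i)) +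
        (1 / 2 : ℝ) • G.bracket (h (a + i) - h a) (h (a + i + 1) - h (a + i)) =
      (B (a + (i + 1)) - G.bracket (x (a + N)) (h (a + (i + 1))) -
          (1 / 2 : ℝ) • G.bracket (h a) (h (a + (i + 1)))) -
        (B (a + i) - G.bracket (x (a + N)) (h (a + i)) -
          (1 / 2 : ℝ) • G.bracket (h a) (h (a + i))) := by
    intro i
    simp only [germ, bracket_sub_left, bracket_sub_right, bracket_self, add_assoc]
    module
  rw [Finset.sum_congr rfl fun i _ => e i, Finset.sum_range_sub
    (fun i => B (a + i) - G.bracket (x (a + N)) (h (a + i)) -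
      (1 / 2 : ℝ) • G.bracket (h a) (h (a + i)))]
  simp only [germ, bracket_sub_right, bracket_self, add_zero]
  module

/-- In the expansion `germ_add`, the factors `h (a + i) - h a` are bounded by the total variation of
`h` on the block, which makes the last sum quadratic in it. -/
theorem norm_germ_add_le (x h : ℕ → EuclideanSpace ℝ (Fin d₁))
    (B : ℕ → EuclideanSpace ℝ (Fin d₂)) (a N : ℕ) {w : ℝ}
    (hw : ∀ i < N, ‖x (a + i + 1) - x (a + N)‖ ≤ w) :
    ‖G.germ x h B a (a + N)‖ ≤ ∑ i ∈ Finset.range N, ‖G.germ x h B (a + i) (a + i + 1)‖ +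
      G.bracketBound * w * ∑ i ∈ Finset.range N, ‖h (a + i + 1) - h (a + i)‖ +
        1 / 2 * G.bracketBound * (∑ i ∈ Finset.range N, ‖h (a + i + 1) - h (a + i)‖) ^ 2 := by
  have hK := G.bracketBound_nonneg
  set V := ∑ i ∈ Finset.range N, ‖h (a + i + 1) - h (a + i)‖ with hV
  have hVi : ∀ i < N, ‖h (a + i) - h a‖ ≤ V := by
    intro i hi
    have h1 := Finset.sum_range_sub (fun i => h (a + i)) i
    rw [add_zero] at h1
    rw [← h1]
    refine (norm_sum_le _ _).trans ?_
    exact Finset.sum_le_sum_of_subset_of_nonneg (Finset.range_subset_range.2 hi.le)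
      fun _ _ _ => norm_nonneg _
  have e : ∑ i ∈ Finset.range N, ‖G.germ x h B (a + i) (a + i + 1)‖ + G.bracketBound * w * V +
        1 / 2 * G.bracketBound * V ^ 2 =
      ∑ i ∈ Finset.range N, (‖G.germ x h B (a + i) (a + i + 1)‖ +
        G.bracketBound * w * ‖h (a + i + 1) - h (a + i)‖ +
          1 / 2 * (G.bracketBound * V * ‖h (a + i + 1) - h (a + i)‖)) := by
    rw [Finset.sum_add_distrib, Finset.sum_add_distrib, ← Finset.mul_sum, ← Finset.mul_sum,
      ← Finset.mul_sum, ← hV]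
    ring
  rw [e, germ_add]
  refine (norm_sum_le _ _).trans (Finset.sum_le_sum fun i hi => ?_)
  have hi := Finset.mem_range.1 hi
  have h1 := G.norm_bracket_le (x (a + i + 1) - x (a + N)) (h (a + i + 1) - h (a + i))
  have h2 := G.norm_bracket_le (h (a + i) - h a) (h (a + i + 1) - h (a + i))
  have h3 := hw i hi
  have h4 := hVi i hi
  refine (norm_add₃_le).trans ?_
  rw [norm_smul, Real.norm_of_nonneg (by norm_num : (0 : ℝ) ≤ 1 / 2)]
  gcongr
  · exact h1.trans (by gcongr)
  · exact h2.trans (by gcongr)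

/-- The sum of the norms of the germs over the dyadic intervals of length `2⁻ᵐ`. -/
noncomputable def germSum (m : ℕ) (x h : ℝ → EuclideanSpace ℝ (Fin d₁))
    (B : ℝ → EuclideanSpace ℝ (Fin d₂)) : ℝ :=
  ∑ k ∈ Finset.range (2 ^ m), ‖G.germ x h B ((k : ℝ) / 2 ^ m) (((k : ℝ) + 1) / 2 ^ m)‖

theorem germSum_congr (m : ℕ) (x : ℝ → EuclideanSpace ℝ (Fin d₁))
    {h h' : ℝ → EuclideanSpace ℝ (Fin d₁)} {B B' : ℝ → EuclideanSpace ℝ (Fin d₂)}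
    (hh : EqOn h h' (Icc 0 1)) (hB : EqOn B B' (Icc 0 1)) :
    G.germSum m x h B = G.germSum m x h' B' := by
  refine Finset.sum_congr rfl fun k hk => ?_
  have hk := Finset.mem_range.1 hk
  have h1 := dyadic_mem_Icc hk.le
  have h2 := dyadic_succ_mem_Icc hk
  rw [germ, germ, hh h1, hh h2, hB h1, hB h2]

/-- Coarsening a dyadic partition changes the sum of the germs by an amount controlled by the
oscillation of `x` and the energy of `h` at the finer scale. -/
theorem germSum_le_add (m j : ℕ) {x h : ℝ → EuclideanSpace ℝ (Fin d₁)}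
    (B : ℝ → EuclideanSpace ℝ (Fin d₂)) {w : ℝ}
    (hw : ∀ s ∈ Icc (0 : ℝ) 1, ∀ t ∈ Icc (0 : ℝ) 1, |s - t| ≤ (2 ^ m)⁻¹ → ‖x s - x t‖ ≤ w) :
    G.germSum m x h B ≤ G.germSum (m + j) x h B +
      G.bracketBound * w * (1 + dyadicEnergy (m + j) h) +
        1 / 2 * G.bracketBound * (2 ^ m)⁻¹ * dyadicEnergy (m + j) h := by
  have hK := G.bracketBound_nonneg
  have hw0 : 0 ≤ w := (norm_nonneg _).trans
    (hw 0 ⟨le_rfl, zero_le_one⟩ 0 ⟨le_rfl, zero_le_one⟩ (by simp))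
  set n := m + j with hn
  set u : ℕ → ℝ := fun k => (k : ℝ) / 2 ^ n with hu
  have hu1 : ∀ k : ℕ, ((k : ℝ) + 1) / 2 ^ n = u (k + 1) := fun k => by simp [hu]
  set V : ℕ → ℝ := fun J => ∑ i ∈ Finset.range (2 ^ j),
    ‖h (u (J * 2 ^ j + i + 1)) - h (u (J * 2 ^ j + i))‖ with hV
  have hsplit : ∀ f : ℕ → ℝ, ∑ k ∈ Finset.range (2 ^ n), f k =
      ∑ J ∈ Finset.range (2 ^ m), ∑ i ∈ Finset.range (2 ^ j), f (J * 2 ^ j + i) := fun f => by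
    rw [hn, pow_add, sum_range_mul_eq_sum_blocks]
  have hgs : G.germSum n x h B = ∑ J ∈ Finset.range (2 ^ m), ∑ i ∈ Finset.range (2 ^ j),
      ‖G.germ (x ∘ u) (h ∘ u) (B ∘ u) (J * 2 ^ j + i) (J * 2 ^ j + i + 1)‖ := by
    rw [germSum, hsplit fun k => ‖G.germ x h B ((k : ℝ) / 2 ^ n) (((k : ℝ) + 1) / 2 ^ n)‖]
    simp only [hu1]
    rfl
  have hE : dyadicEnergy n h = 2 ^ n * ∑ k ∈ Finset.range (2 ^ n), ‖h (u (k + 1)) - h (u k)‖ ^ 2 := by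
    simp only [dyadicEnergy, hu1]
    rfl
  have hVsum : ∑ J ∈ Finset.range (2 ^ m), V J ≤ 1 + dyadicEnergy n h := by
    rw [hV, ← hsplit fun k => ‖h (u (k + 1)) - h (u k)‖, hE]
    have h1 := sq_sum_le_card_mul_sum_sq (s := Finset.range (2 ^ n))
      (f := fun k => ‖h (u (k + 1)) - h (u k)‖)
    rw [Finset.card_range, Nat.cast_pow, Nat.cast_ofNat] at h1
    nlinarith [sq_nonneg (∑ k ∈ Finset.range (2 ^ n), ‖h (u (k + 1)) - h (u k)‖ - 1)]
  have hVsq : ∑ J ∈ Finset.range (2 ^ m), V J ^ 2 ≤ (2 ^ m)⁻¹ * dyadicEnergy n h := by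
    have e : (2 ^ m : ℝ)⁻¹ * dyadicEnergy n h = ∑ J ∈ Finset.range (2 ^ m), (2 ^ j : ℝ) *
        ∑ i ∈ Finset.range (2 ^ j), ‖h (u (J * 2 ^ j + i + 1)) - h (u (J * 2 ^ j + i))‖ ^ 2 := by
      rw [hE, hsplit fun k => ‖h (u (k + 1)) - h (u k)‖ ^ 2, ← Finset.mul_sum, hn, pow_add]
      field_simp
    rw [e]
    refine Finset.sum_le_sum fun J _ => sq_sum_le_card_mul_sum_sq.trans_eq ?_
    rw [Finset.card_range, Nat.cast_pow, Nat.cast_ofNat]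
  have hblock : ∀ J ∈ Finset.range (2 ^ m),
      ‖G.germ x h B ((J : ℝ) / 2 ^ m) (((J : ℝ) + 1) / 2 ^ m)‖ ≤
        ∑ i ∈ Finset.range (2 ^ j),
          ‖G.germ (x ∘ u) (h ∘ u) (B ∘ u) (J * 2 ^ j + i) (J * 2 ^ j + i + 1)‖ +
          G.bracketBound * w * V J + 1 / 2 * G.bracketBound * V J ^ 2 := by
    intro J hJ
    have hJ := Finset.mem_range.1 hJ
    rw [dyadic_succ_add_eq m j J, dyadic_add_eq m j J]
    refine G.norm_germ_add_le (x ∘ u) (h ∘ u) (B ∘ u) (J * 2 ^ j) (2 ^ j) fun i hi => ?_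
    have hle : J * 2 ^ j + 2 ^ j ≤ 2 ^ n := by
      rw [hn, pow_add, ← Nat.succ_mul]
      exact Nat.mul_le_mul_right _ hJ
    refine hw _ (dyadic_mem_Icc (by omega)) _ (dyadic_mem_Icc hle) ?_
    have e : ((J * 2 ^ j + i + 1 : ℕ) : ℝ) / 2 ^ n - ((J * 2 ^ j + 2 ^ j : ℕ) : ℝ) / 2 ^ n =
        -(((2 ^ j : ℝ) - (i + 1)) / 2 ^ n) := by
      push_cast
      ring
    have hi' : ((i : ℝ) + 1) ≤ 2 ^ j := by exact_mod_cast hi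
    rw [e, abs_neg, abs_of_nonneg (div_nonneg (by linarith) (by positivity)),
      div_le_iff₀ (by positivity), hn, pow_add, inv_mul_cancel_left₀ (by positivity)]
    linarith [(Nat.cast_nonneg i : (0 : ℝ) ≤ i)]
  refine (Finset.sum_le_sum hblock).trans ?_
  rw [Finset.sum_add_distrib, Finset.sum_add_distrib, ← Finset.mul_sum, ← Finset.mul_sum, hgs]
  have e : 1 / 2 * G.bracketBound * (2 ^ m : ℝ)⁻¹ * dyadicEnergy n h =
    1 / 2 * G.bracketBound * ((2 ^ m : ℝ)⁻¹ * dyadicEnergy n h) := by ring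
  rw [e]
  gcongr

end StepTwoCarnotGroup

/-! ### Continuous lower bounds for the costs -/

namespace StepTwoCarnotGroup

variable {d₁ d₂ : ℕ} (G : StepTwoCarnotGroup d₁ d₂)

/-- The vertical drift created by the shift of a path with first level `x` along `h`. -/
noncomputable def shiftDrift (x h : ℝ → EuclideanSpace ℝ (Fin d₁)) (t : ℝ) :
    EuclideanSpace ℝ (Fin d₂) :=
  (∫ r in (0 : ℝ)..t, G.bracket (x r) (deriv h r)) + (G.lift h t).2

/-- For the drift of a shift the germ is the error of the Riemann sum of `∫ [x, dh]`, plus the second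
level of the increment of the lift of `h`. -/
theorem germ_shiftDrift {x h : ℝ → EuclideanSpace ℝ (Fin d₁)} (hx : Continuous x)
    (hh : IsACZero h) {s t : ℝ} (hs : s ∈ Icc (0 : ℝ) 1) (ht : t ∈ Icc (0 : ℝ) 1) :
    G.germ x h (G.shiftDrift x h) s t =
      (∫ r in s..t, G.bracket (x r - x t) (deriv h r)) +
        (G.incr (G.lift h s) (G.lift h t)).2 := by
  have h0 : (0 : ℝ) ∈ Icc (0 : ℝ) 1 := ⟨le_rfl, zero_le_one⟩
  have i1 := (hh.mono h0 hs).intervalIntegrable_deriv_euclidean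
  have i2 := (hh.mono h0 ht).intervalIntegrable_deriv_euclidean
  have ast := hh.mono hs ht
  have i3 := ast.intervalIntegrable_deriv_euclidean
  have e1 : ∫ r in s..t, G.bracket (x r - x t) (deriv h r) =
      (∫ r in (0 : ℝ)..t, G.bracket (x r) (deriv h r)) -
        (∫ r in (0 : ℝ)..s, G.bracket (x r) (deriv h r)) - G.bracket (x t) (h t - h s) := by
    simp only [bracket_sub_left]
    rw [intervalIntegral.integral_sub (G.intervalIntegrable_bracket hx.continuousOn i3)
      (G.intervalIntegrable_bracket continuousOn_const i3),
      intervalIntegral.integral_interval_sub_left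
        (G.intervalIntegrable_bracket hx.continuousOn i2)
        (G.intervalIntegrable_bracket hx.continuousOn i1)]
    congr 1
    rw [← ast.integral_deriv_eq_sub_euclidean]
    exact (G.bracketL (x t)).intervalIntegral_comp_comm i3
  rw [e1, incr_snd, germ, shiftDrift, shiftDrift]
  simp only [lift]
  module

theorem norm_germ_shiftDrift_le {x h : ℝ → EuclideanSpace ℝ (Fin d₁)} (hx : Continuous x)
    (hh : IsACZero h) {s t w : ℝ} (hs : s ∈ Icc (0 : ℝ) 1) (ht : t ∈ Icc (0 : ℝ) 1)
    (hst : s ≤ t) (hw : ∀ r ∈ Icc s t, ‖x r - x t‖ ≤ w) :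
    ‖G.germ x h (G.shiftDrift x h) s t‖ ≤ G.bracketBound * w * (∫ r in s..t, ‖deriv h r‖) +
      1 / 2 * G.bracketBound * (∫ r in s..t, ‖deriv h r‖) ^ 2 := by
  have i3 := (hh.mono hs ht).intervalIntegrable_deriv_euclidean
  have hi : ∀ r ∈ Icc s t, ‖h r - h s‖ ≤ ∫ r in s..t, ‖deriv h r‖ := by
    intro r hr
    have hr1 : r ∈ Icc (0 : ℝ) 1 := ⟨hs.1.trans hr.1, hr.2.trans ht.2⟩
    rw [← (hh.mono hs hr1).integral_deriv_eq_sub_euclidean]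
    refine (intervalIntegral.norm_integral_le_integral_norm hr.1).trans ?_
    exact intervalIntegral.integral_mono_interval le_rfl hr.1 hr.2
      (Eventually.of_forall fun _ => norm_nonneg _) i3.norm
  rw [G.germ_shiftDrift hx hh hs ht, G.incr_lift_snd hh hs ht]
  refine (norm_add_le _ _).trans ?_
  rw [norm_smul, Real.norm_of_nonneg (by norm_num : (0 : ℝ) ≤ 1 / 2)]
  have h1 := G.norm_integral_bracket_le hst hw i3
  have h2 := G.norm_integral_bracket_le hst hi i3
  rw [mul_assoc, ← sq] at h2
  linarith

theorem germSum_shiftDrift_le (m : ℕ) {x h : ℝ → EuclideanSpace ℝ (Fin d₁)} (hx : Continuous x)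
    (hh : IsCameronMartin h) {w : ℝ}
    (hw : ∀ s ∈ Icc (0 : ℝ) 1, ∀ t ∈ Icc (0 : ℝ) 1, |s - t| ≤ (2 ^ m)⁻¹ → ‖x s - x t‖ ≤ w) :
    G.germSum m x h (G.shiftDrift x h) ≤
      G.bracketBound * (w + (2 ^ m)⁻¹) * (1 + ∫ r in (0 : ℝ)..1, ‖deriv h r‖ ^ 2) := by
  have hK := G.bracketBound_nonneg
  have hw0 : 0 ≤ w := (norm_nonneg _).trans
    (hw 0 ⟨le_rfl, zero_le_one⟩ 0 ⟨le_rfl, zero_le_one⟩ (by simp))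
  set Q := ∫ r in (0 : ℝ)..1, ‖deriv h r‖ ^ 2 with hQ
  have hQ0 : 0 ≤ Q := intervalIntegral.integral_nonneg zero_le_one fun _ _ => by positivity
  have h1 : ∀ k ∈ Finset.range (2 ^ m),
      ‖G.germ x h (G.shiftDrift x h) ((k : ℝ) / 2 ^ m) (((k : ℝ) + 1) / 2 ^ m)‖ ≤
      G.bracketBound * w * (∫ r in (k : ℝ) / 2 ^ m..((k : ℝ) + 1) / 2 ^ m, ‖deriv h r‖) +
      1 / 2 * G.bracketBound *
        (∫ r in (k : ℝ) / 2 ^ m..((k : ℝ) + 1) / 2 ^ m, ‖deriv h r‖) ^ 2 := by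
    intro k hk
    have hk := Finset.mem_range.1 hk
    have hs := dyadic_mem_Icc hk.le
    have ht := dyadic_succ_mem_Icc hk
    refine G.norm_germ_shiftDrift_le hx hh.1 hs ht (by gcongr; linarith) fun r hr => ?_
    refine hw r ⟨hs.1.trans hr.1, hr.2.trans ht.2⟩ _ ht ?_
    rw [abs_sub_comm, abs_of_nonneg (sub_nonneg.2 hr.2)]
    have e : (2 ^ m : ℝ)⁻¹ = ((k : ℝ) + 1) / 2 ^ m - (k : ℝ) / 2 ^ m := by ring
    rw [e]
    linarith [hr.1]
  refine (Finset.sum_le_sum h1).trans ?_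
  rw [Finset.sum_add_distrib, ← Finset.mul_sum, ← Finset.mul_sum,
    sum_integral_dyadic m (hh.intervalIntegrable_deriv ⟨le_rfl, zero_le_one⟩
      ⟨zero_le_one, le_rfl⟩).norm]
  have h2 := hh.sum_sq_integral_norm_deriv_le m
  rw [← le_inv_mul_iff₀ (by positivity)] at h2
  have h3 := hh.integral_norm_deriv_le
  calc _ ≤ G.bracketBound * w * (1 + Q) + 1 / 2 * G.bracketBound * ((2 ^ m)⁻¹ * Q) := by gcongr
    _ ≤ _ := by
      have p1 : 0 ≤ G.bracketBound * (2 ^ m : ℝ)⁻¹ := by positivity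
      have p2 : 0 ≤ G.bracketBound * (2 ^ m : ℝ)⁻¹ * Q := by positivity
      linarith

end StepTwoCarnotGroup

namespace CarnotPath

variable {d₁ d₂ : ℕ} {G : StepTwoCarnotGroup d₁ d₂}

/-- The modulus of continuity of the first level of `X` at scale `2⁻ᵐ`. -/
noncomputable def modulus (m : ℕ) (X : CarnotPath G) : ℝ :=
  sSup ((fun p : ℝ × ℝ => ‖(X p.1).1 - (X p.2).1‖) ''
    {p | p ∈ Icc (0 : ℝ) 1 ×ˢ Icc (0 : ℝ) 1 ∧ |p.1 - p.2| ≤ (2 ^ m)⁻¹})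

theorem isCompact_modulus_set (m : ℕ) :
    IsCompact {p : ℝ × ℝ | p ∈ Icc (0 : ℝ) 1 ×ˢ Icc (0 : ℝ) 1 ∧ |p.1 - p.2| ≤ (2 ^ m)⁻¹} :=
  (isCompact_Icc.prod isCompact_Icc).inter_right
    (isClosed_le (continuous_fst.sub continuous_snd).abs continuous_const)

theorem continuous_modulus (m : ℕ) : Continuous (modulus (G := G) m) := by
  refine (isCompact_modulus_set m).continuous_sSup ?_
  have h1 : Continuous fun q : CarnotPath G × (ℝ × ℝ) => q.1 q.2.1 :=
    continuous_eval_prod.comp (continuous_fst.prodMk (continuous_fst.comp continuous_snd))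
  have h2 : Continuous fun q : CarnotPath G × (ℝ × ℝ) => q.1 q.2.2 :=
    continuous_eval_prod.comp (continuous_fst.prodMk (continuous_snd.comp continuous_snd))
  exact (h1.fst.sub h2.fst).norm

theorem norm_sub_le_modulus (m : ℕ) (X : CarnotPath G) : ∀ s ∈ Icc (0 : ℝ) 1,
    ∀ t ∈ Icc (0 : ℝ) 1, |s - t| ≤ (2 ^ m)⁻¹ → ‖(X s).1 - (X t).1‖ ≤ modulus m X := by
  intro s hs t ht hst
  refine le_csSup ?_ ⟨(s, t), ⟨⟨hs, ht⟩, hst⟩, rfl⟩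
  refine ((isCompact_modulus_set m).image ?_).bddAbove
  have h1 : Continuous fun p : ℝ × ℝ => X p.1 := X.continuous_coe.comp continuous_fst
  have h2 : Continuous fun p : ℝ × ℝ => X p.2 := X.continuous_coe.comp continuous_snd
  exact (h1.fst.sub h2.fst).norm

theorem modulus_nonneg (m : ℕ) (X : CarnotPath G) : 0 ≤ modulus m X :=
  (norm_nonneg _).trans (norm_sub_le_modulus m X 0 ⟨le_rfl, zero_le_one⟩ 0 ⟨le_rfl, zero_le_one⟩
    (by simp))

theorem tendsto_modulus (X : CarnotPath G) : Tendsto (fun m => modulus m X) atTop (𝓝 0) := by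
  have hu := isCompact_Icc.uniformContinuousOn_of_continuous (s := Icc (0 : ℝ) 1)
    (f := fun t => (X t).1) X.continuous_coe.fst.continuousOn
  rw [Metric.uniformContinuousOn_iff_le] at hu
  rw [Metric.tendsto_atTop]
  intro ε hε
  obtain ⟨δ, hδ, h⟩ := hu (ε / 2) (by positivity)
  have hlim : Tendsto (fun m : ℕ => ((2 : ℝ) ^ m)⁻¹) atTop (𝓝 0) :=
    tendsto_inv_atTop_zero.comp (tendsto_pow_atTop_atTop_of_one_lt one_lt_two)
  obtain ⟨N, hN⟩ := (hlim.eventually (gt_mem_nhds hδ)).exists_forall_of_atTop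
  refine ⟨N, fun m hm => ?_⟩
  rw [Real.dist_eq, sub_zero, abs_of_nonneg (modulus_nonneg m X)]
  refine lt_of_le_of_lt (Real.sSup_le ?_ (by positivity)) (half_lt_self hε)
  rintro _ ⟨⟨s, t⟩, ⟨⟨hs, ht⟩, hst⟩, rfl⟩
  have := h s hs t ht (hst.trans (hN m hm).le)
  rwa [dist_eq_norm] at this

/-- The second level of `Y` relative to `X`, in the coordinates in which it is the drift
`∫ [x, dh] + ½ ∫ [h, dh]` if `Y = T_h X`. -/
noncomputable def drift (X Y : CarnotPath G) (t : ℝ) : EuclideanSpace ℝ (Fin d₂) :=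
  (Y t).2 - (X t).2 - (1 / 2 : ℝ) • G.bracket (firstLevelDiff X Y t) (X t).1

theorem incr_incr (X Y : CarnotPath G) (s t : ℝ) :
    G.incr (G.incr (X s) (X t)) (G.incr (Y s) (Y t)) =
      (firstLevelDiff X Y t - firstLevelDiff X Y s,
        G.germ (fun r => (X r).1) (firstLevelDiff X Y) (drift X Y) s t) := by
  refine Prod.ext ?_ ?_
  · simp only [StepTwoCarnotGroup.incr_fst, firstLevelDiff]
    abel
  · simp only [StepTwoCarnotGroup.incr_fst, StepTwoCarnotGroup.incr_snd, firstLevelDiff,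
      StepTwoCarnotGroup.germ, drift, StepTwoCarnotGroup.bracket_sub_left,
      StepTwoCarnotGroup.bracket_sub_right, StepTwoCarnotGroup.bracket_self]
    rw [G.bracket_swap (X t).1 (Y s).1, G.bracket_swap (X t).1 (Y t).1,
      G.bracket_swap (X s).1 (Y s).1, G.bracket_swap (X s).1 (X t).1]
    module

theorem continuous_firstLevelDiff (X Y : CarnotPath G) : Continuous (firstLevelDiff X Y) :=
  Y.continuous_coe.fst.sub X.continuous_coe.fst

theorem firstLevelDiff_zero (X Y : CarnotPath G) : firstLevelDiff X Y 0 = 0 := by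
  rw [firstLevelDiff, Y.coe_zero, X.coe_zero, sub_self]

theorem continuous_drift (X Y : CarnotPath G) : Continuous (drift X Y) :=
  (Y.continuous_coe.snd.sub X.continuous_coe.snd).sub (Continuous.fun_const_smul
    (G.continuous_bracket.comp ((continuous_firstLevelDiff X Y).prodMk X.continuous_coe.fst)) _)

theorem drift_zero (X Y : CarnotPath G) : drift X Y 0 = 0 := by
  rw [drift, Y.coe_zero, X.coe_zero]
  simp [G.bracket_zero_right]

/-- The sum over the dyadic intervals of the vertical parts of `X_{s,t}⁻¹ Y_{s,t}`. -/
noncomputable def verticalSum (m : ℕ) (X Y : CarnotPath G) : ℝ :=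
  G.germSum m (fun r => (X r).1) (firstLevelDiff X Y) (drift X Y)

variable (G) in
/-- The weight that compensates `verticalSum m`; it tends to zero as `m → ∞`. -/
noncomputable def verticalWeight (m : ℕ) (X : CarnotPath G) : ℝ :=
  (G.bracketBound + 1) * (modulus m X + (2 ^ m)⁻¹)

theorem verticalWeight_pos (m : ℕ) (X : CarnotPath G) : 0 < verticalWeight G m X := by
  have := G.bracketBound_nonneg
  have := modulus_nonneg m X
  unfold verticalWeight
  positivity

theorem tendsto_verticalWeight (X : CarnotPath G) :
    Tendsto (fun m => verticalWeight G m X) atTop (𝓝 0) := by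
  have hlim : Tendsto (fun m : ℕ => ((2 : ℝ) ^ m)⁻¹) atTop (𝓝 0) :=
    tendsto_inv_atTop_zero.comp (tendsto_pow_atTop_atTop_of_one_lt one_lt_two)
  simpa [verticalWeight] using ((tendsto_modulus X).add hlim).const_mul (G.bracketBound + 1)

/-- A continuous function on pairs of paths that bounds `C_n²` from below for all `n ≥ m`, and whose
supremum over `m` is `C_ℋ²`. -/
noncomputable def costLowerBound (m : ℕ) (X Y : CarnotPath G) : ℝ :=
  max (dyadicEnergy m (firstLevelDiff X Y)) (verticalSum m X Y / verticalWeight G m X - 1)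

theorem costLowerBound_le_iff {m : ℕ} {X Y : CarnotPath G} {S : ℝ} :
    costLowerBound m X Y ≤ S ↔ dyadicEnergy m (firstLevelDiff X Y) ≤ S ∧
      verticalSum m X Y ≤ verticalWeight G m X * (1 + S) := by
  rw [costLowerBound, max_le_iff, sub_le_iff_le_add, div_le_iff₀ (verticalWeight_pos m X),
    mul_comm, add_comm S]

theorem continuous_costLowerBound (m : ℕ) :
    Continuous fun p : CarnotPath G × CarnotPath G => costLowerBound m p.1 p.2 := by
  have hX : ∀ t : ℝ, Continuous fun p : CarnotPath G × CarnotPath G => p.1 t := fun t =>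
    continuous_eval_prod.comp (continuous_fst.prodMk continuous_const)
  have hY : ∀ t : ℝ, Continuous fun p : CarnotPath G × CarnotPath G => p.2 t := fun t =>
    continuous_eval_prod.comp (continuous_snd.prodMk continuous_const)
  have hh : ∀ t : ℝ, Continuous fun p : CarnotPath G × CarnotPath G =>
      firstLevelDiff p.1 p.2 t := fun t => (hY t).fst.sub (hX t).fst
  have hbr : ∀ {a b : CarnotPath G × CarnotPath G → EuclideanSpace ℝ (Fin d₁)}, Continuous a →
      Continuous b → Continuous fun p => G.bracket (a p) (b p) := fun ha hb =>
    G.continuous_bracket.comp (ha.prodMk hb)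
  have hB : ∀ t : ℝ, Continuous fun p : CarnotPath G × CarnotPath G => drift p.1 p.2 t := fun t =>
    ((hY t).snd.sub (hX t).snd).sub ((hbr (hh t) (hX t).fst).fun_const_smul _)
  have hw : Continuous fun p : CarnotPath G × CarnotPath G => verticalWeight G m p.1 :=
    (((continuous_modulus m).comp continuous_fst).add continuous_const).const_mul _
  refine Continuous.max ?_ ((Continuous.div ?_ hw fun p => (verticalWeight_pos m p.1).ne').sub
    continuous_const)
  · unfold dyadicEnergy
    exact (continuous_finsetSum _ fun k _ => (((hh _).sub (hh _)).norm.pow 2)).const_mul _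
  · unfold verticalSum StepTwoCarnotGroup.germSum StepTwoCarnotGroup.germ
    refine continuous_finsetSum _ fun k _ => Continuous.norm ?_
    exact (((hB _).sub (hB _)).sub (hbr (hX _).fst ((hh _).sub (hh _)))).sub
      ((hbr (hh _) (hh _)).fun_const_smul _)

theorem cost_sq (n : ℕ) (X Y : CarnotPath G) : cost n X Y ^ (2 : ℝ) =
    2 ^ n * ∑ k ∈ Finset.range (2 ^ n),
      G.dcc (G.incr (X ((k : ℝ) / 2 ^ n)) (X (((k : ℝ) + 1) / 2 ^ n)))
        (G.incr (Y ((k : ℝ) / 2 ^ n)) (Y (((k : ℝ) + 1) / 2 ^ n))) ^ 2 := by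
  rw [cost, ← ENNReal.rpow_mul, one_div_mul_cancel two_ne_zero, ENNReal.rpow_one]

/-- The first level of `X_{s,t}⁻¹ Y_{s,t}` controls the energy of `h` at level `m + j` and the second
level the germs at level `m + j`; both are then transferred to the coarser level `m`. -/
theorem costLowerBound_le_cost (m j : ℕ) (X Y : CarnotPath G) :
    ENNReal.ofReal (costLowerBound m X Y) ≤ cost (m + j) X Y ^ (2 : ℝ) := by
  by_cases htop : cost (m + j) X Y ^ (2 : ℝ) = ∞
  · rw [htop]; exact le_top
  refine ENNReal.ofReal_le_of_le_toReal ?_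
  set M := (cost (m + j) X Y ^ (2 : ℝ)).toReal with hM
  set n := m + j with hn
  set D : ℕ → ℝ≥0∞ := fun k => G.dcc (G.incr (X ((k : ℝ) / 2 ^ n)) (X (((k : ℝ) + 1) / 2 ^ n)))
        (G.incr (Y ((k : ℝ) / 2 ^ n)) (Y (((k : ℝ) + 1) / 2 ^ n))) with hD
  have hK := G.bracketBound_nonneg
  have hDtop : ∀ k ∈ Finset.range (2 ^ n), D k ≠ ∞ := by
    intro k hk hDk
    rw [cost_sq] at htop
    have h1 := ENNReal.lt_top_of_mul_ne_top_right htop (by positivity)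
    have h2 := (ENNReal.sum_lt_top.1 h1 k hk).ne
    exact h2 (by rw [show G.dcc _ _ = ∞ from hDk]; simp)
  have hMs : M = 2 ^ n * ∑ k ∈ Finset.range (2 ^ n), (D k).toReal ^ 2 := by
    rw [hM, cost_sq, ENNReal.toReal_mul, ENNReal.toReal_sum fun k hk =>
      ENNReal.pow_ne_top (hDtop k hk)]
    simp [hD]
  have hM0 : 0 ≤ M := ENNReal.toReal_nonneg
  have hE : dyadicEnergy n (firstLevelDiff X Y) ≤ M := by
    rw [hMs, dyadicEnergy]
    gcongr with k hk
    have h := G.norm_fst_sub_le_dcc (hDtop k hk)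
    have e := congrArg Prod.fst (incr_incr X Y ((k : ℝ) / 2 ^ n) (((k : ℝ) + 1) / 2 ^ n))
    simp only [StepTwoCarnotGroup.incr_fst] at e h
    rwa [e] at h
  have hV : verticalSum n X Y ≤ 1 / 2 * G.bracketBound * (2 ^ n)⁻¹ * M := by
    have e : 1 / 2 * G.bracketBound * (2 ^ n : ℝ)⁻¹ * M =
        ∑ k ∈ Finset.range (2 ^ n), G.bracketBound / 2 * (D k).toReal ^ 2 := by
      rw [hMs, ← Finset.mul_sum]
      field_simp
    rw [e, verticalSum, StepTwoCarnotGroup.germSum]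
    refine Finset.sum_le_sum fun k hk => ?_
    have h := G.norm_incr_snd_le_dcc (hDtop k hk)
    rwa [incr_incr] at h
  have hlow := G.germSum_le_add m j (h := firstLevelDiff X Y) (drift X Y) (norm_sub_le_modulus m X)
  have hpow : ((2 : ℝ) ^ n)⁻¹ ≤ (2 ^ m)⁻¹ :=
    inv_anti₀ (by positivity) (pow_le_pow_right₀ one_le_two (Nat.le_add_right m j))
  have hw0 := modulus_nonneg m X
  rw [costLowerBound_le_iff]
  refine ⟨(dyadicEnergy_le_add m j _).trans hE, ?_⟩
  have b1 : G.bracketBound * modulus m X * (1 + dyadicEnergy n (firstLevelDiff X Y)) ≤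
      G.bracketBound * modulus m X * (1 + M) := by gcongr
  have b2 : 1 / 2 * G.bracketBound * (2 ^ m)⁻¹ * dyadicEnergy n (firstLevelDiff X Y) ≤
      1 / 2 * G.bracketBound * (2 ^ m)⁻¹ * M := by gcongr
  have b3 : 1 / 2 * G.bracketBound * (2 ^ n)⁻¹ * M ≤ 1 / 2 * G.bracketBound * (2 ^ m)⁻¹ * M := by
    gcongr
  have b4 : 0 ≤ (modulus m X + (2 ^ m)⁻¹) * (1 + M) := by positivity
  have b5 : 0 ≤ G.bracketBound * (2 ^ m : ℝ)⁻¹ := by positivity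
  unfold verticalWeight
  unfold verticalSum at hV ⊢
  linarith

/-! ### Identification of the limit cost -/

/-- `Y = T_h X` in terms of the first level and the drift of `Y` relative to `X`. -/
theorem isShift_iff_drift {h : ℝ → EuclideanSpace ℝ (Fin d₁)} (hh : IsACZero h)
    (X Y : CarnotPath G) : IsShift h X Y ↔ EqOn (firstLevelDiff X Y) h (Icc 0 1) ∧
      EqOn (drift X Y) (G.shiftDrift (fun r => (X r).1) h) (Icc 0 1) := by
  rw [isShift_iff hh]
  constructor
  · intro hs
    have h1 : EqOn (firstLevelDiff X Y) h (Icc 0 1) := fun t ht => by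
      simp [firstLevelDiff, hs t ht, StepTwoCarnotGroup.shift]
    refine ⟨h1, fun t ht => ?_⟩
    rw [drift, h1 ht, hs t ht]
    simp only [StepTwoCarnotGroup.shift, StepTwoCarnotGroup.shiftDrift]
    abel
  · rintro ⟨h1, h2⟩ t ht
    have e1 := h1 ht
    have e2 := h2 ht
    rw [drift, e1, StepTwoCarnotGroup.shiftDrift, sub_eq_iff_eq_add, sub_eq_iff_eq_add] at e2
    refine Prod.ext ?_ ?_
    · rw [StepTwoCarnotGroup.shift, ← e1, firstLevelDiff]; module
    · rw [e2, StepTwoCarnotGroup.shift]; simp only; abel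

theorem costLowerBound_le_cameronMartinNorm {h : ℝ → EuclideanSpace ℝ (Fin d₁)}
    (hh : IsCameronMartin h) {X Y : CarnotPath G} (hs : IsShift h X Y) (m : ℕ) :
    ENNReal.ofReal (costLowerBound m X Y) ≤ cameronMartinNorm h ^ (2 : ℝ) := by
  obtain ⟨h1, h2⟩ := (isShift_iff_drift hh.1 X Y).1 hs
  rw [hh.cameronMartinNorm_sq]
  refine ENNReal.ofReal_le_ofReal (costLowerBound_le_iff.2 ⟨?_, ?_⟩)
  · refine le_trans (le_of_eq ?_) (hh.dyadicEnergy_le m)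
    unfold dyadicEnergy
    congr 1
    refine Finset.sum_congr rfl fun k hk => ?_
    have hk := Finset.mem_range.1 hk
    rw [h1 (dyadic_mem_Icc hk.le), h1 (dyadic_succ_mem_Icc hk)]
  · rw [verticalSum, G.germSum_congr m _ h1 h2]
    refine (G.germSum_shiftDrift_le m X.continuous_coe.fst hh (norm_sub_le_modulus m X)).trans ?_
    have hQ0 : 0 ≤ ∫ r in (0 : ℝ)..1, ‖deriv h r‖ ^ 2 :=
      intervalIntegral.integral_nonneg zero_le_one fun _ _ => by positivity
    have := modulus_nonneg m X
    unfold verticalWeight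
    gcongr
    linarith

/-- If the lower bounds are bounded, then the germs of `drift X Y` and of the drift of the shift
have the same increments up to sums that tend to zero, so the two drifts agree. -/
theorem isShift_of_costLowerBound_le {X Y : CarnotPath G} {S : ℝ}
    (hS : ∀ m, costLowerBound m X Y ≤ S) :
    IsCameronMartin (firstLevelDiff X Y) ∧ IsShift (firstLevelDiff X Y) X Y ∧
      cameronMartinNorm (firstLevelDiff X Y) ^ (2 : ℝ) ≤ ENNReal.ofReal S := by
  set h := firstLevelDiff X Y with hh
  obtain ⟨hcm, hnorm⟩ := isCameronMartin_of_dyadicEnergy_le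
    (continuous_firstLevelDiff X Y).continuousOn (firstLevelDiff_zero X Y)
    fun m => (costLowerBound_le_iff.1 (hS m)).1
  refine ⟨hcm, ?_, ?_⟩
  swap
  · rwa [cameronMartinNorm, ← ENNReal.rpow_mul, one_div_mul_cancel two_ne_zero, ENNReal.rpow_one]
  rw [isShift_iff_drift hcm.1]
  refine ⟨eqOn_refl _ _, ?_⟩
  set x : ℝ → EuclideanSpace ℝ (Fin d₁) := fun r => (X r).1 with hx
  have hxc : Continuous x := X.continuous_coe.fst
  set Q := ∫ r in (0 : ℝ)..1, ‖deriv h r‖ ^ 2 with hQ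
  have hQ0 : 0 ≤ Q := intervalIntegral.integral_nonneg zero_le_one fun _ _ => by positivity
  have hsmall : ∀ m, verticalSum m X Y + G.germSum m x h (G.shiftDrift x h) ≤
      verticalWeight G m X * ((1 + S) + (1 + Q)) := by
    intro m
    have h1 := (costLowerBound_le_iff.1 (hS m)).2
    have h2 := G.germSum_shiftDrift_le m hxc hcm (norm_sub_le_modulus m X)
    have h3 : 0 ≤ (modulus m X + (2 ^ m)⁻¹) * (1 + Q) := by
      have := modulus_nonneg m X
      positivity
    unfold verticalWeight at h1 ⊢
    linarith
  have hlim : Tendsto (fun m => verticalWeight G m X * ((1 + S) + (1 + Q))) atTop (𝓝 0) := by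
    simpa using (tendsto_verticalWeight X).mul_const ((1 + S) + (1 + Q))
  have hbound : ∀ n k : ℕ, k ≤ 2 ^ n →
      ‖drift X Y ((k : ℝ) / 2 ^ n) - G.shiftDrift x h ((k : ℝ) / 2 ^ n)‖ ≤
        verticalWeight G n X * ((1 + S) + (1 + Q)) := by
    intro n k hk
    refine le_trans ?_ (hsmall n)
    have e := Finset.sum_range_sub
      (fun i : ℕ => drift X Y ((i : ℝ) / 2 ^ n) - G.shiftDrift x h ((i : ℝ) / 2 ^ n)) k
    have e0 : G.shiftDrift x h 0 = 0 := by simp [StepTwoCarnotGroup.shiftDrift,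
      StepTwoCarnotGroup.lift]
    simp only [Nat.cast_zero, zero_div, drift_zero, e0, sub_zero] at e
    rw [← e]
    refine (norm_sum_le _ _).trans ?_
    refine (Finset.sum_le_sum_of_subset_of_nonneg (Finset.range_subset_range.2 hk)
      fun _ _ _ => norm_nonneg _).trans ?_
    rw [verticalSum, StepTwoCarnotGroup.germSum, StepTwoCarnotGroup.germSum,
      ← Finset.sum_add_distrib]
    refine Finset.sum_le_sum fun i _ => ?_
    refine le_trans (le_of_eq ?_) (norm_sub_le _ _)
    simp only [StepTwoCarnotGroup.germ, Nat.cast_add, Nat.cast_one, ← hh]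
    congr 1
    abel
  refine eqOn_of_dyadic (continuous_drift X Y).continuousOn ?_ fun m k hk => ?_
  · refine ContinuousOn.add ?_ (G.continuousOn_lift hcm).snd
    have hi := G.intervalIntegrable_bracket (x := x) hxc.continuousOn
      (hcm.intervalIntegrable_deriv ⟨le_rfl, zero_le_one⟩ ⟨zero_le_one, le_rfl⟩)
    have := intervalIntegral.continuousOn_primitive_interval (μ := volume)
      (f := fun r => G.bracket (x r) (deriv h r)) (a := 0) (b := 1)
      (by rw [uIcc_of_le zero_le_one]; exact (intervalIntegrable_iff_integrableOn_Icc_of_le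
        zero_le_one).1 hi)
    rwa [uIcc_of_le zero_le_one] at this
  · rw [← sub_eq_zero, ← norm_le_zero_iff]
    refine ge_of_tendsto' (hlim.comp (tendsto_add_atTop_nat m)) fun j => ?_
    rw [dyadic_add_eq m j k, add_comm m j]
    refine hbound _ _ ?_
    rw [add_comm, pow_add]
    exact Nat.mul_le_mul_right _ hk

theorem iSup_costLowerBound_le_costH (X Y : CarnotPath G) :
    ⨆ m, ENNReal.ofReal (costLowerBound m X Y) ≤ costH X Y ^ (2 : ℝ) := by
  refine iSup_le fun m => ?_
  rw [← ENNReal.rpow_inv_le_iff (by norm_num)]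
  refine le_iInf₂ fun h hh => ?_
  rw [ENNReal.rpow_inv_le_iff (by norm_num)]
  exact costLowerBound_le_cameronMartinNorm hh.1 hh.2 m

/-- If the supremum of the lower bounds is finite, then `Y = T_h X` with `h = π₁Y - π₁X ∈ ℋ`, and
`‖h‖_ℋ²` is at most this supremum. -/
theorem isShift_of_iSup_ne_top {X Y : CarnotPath G}
    (hfin : ⨆ m, ENNReal.ofReal (costLowerBound m X Y) ≠ ∞) :
    IsCameronMartin (firstLevelDiff X Y) ∧ IsShift (firstLevelDiff X Y) X Y ∧
      cameronMartinNorm (firstLevelDiff X Y) ^ (2 : ℝ) ≤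
        ⨆ m, ENNReal.ofReal (costLowerBound m X Y) := by
  have h := isShift_of_costLowerBound_le (X := X) (Y := Y)
    (S := (⨆ m, ENNReal.ofReal (costLowerBound m X Y)).toReal) fun m => by
      rw [← ENNReal.ofReal_le_iff_le_toReal hfin]
      exact le_iSup (fun m => ENNReal.ofReal (costLowerBound m X Y)) m
  rwa [ENNReal.ofReal_toReal hfin] at h

theorem costH_sq_eq_iSup (X Y : CarnotPath G) :
    costH X Y ^ (2 : ℝ) = ⨆ m, ENNReal.ofReal (costLowerBound m X Y) := by
  refine le_antisymm ?_ (iSup_costLowerBound_le_costH X Y)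
  by_cases hfin : ⨆ m, ENNReal.ofReal (costLowerBound m X Y) = ∞
  · rw [hfin]; exact le_top
  obtain ⟨h1, h2, h3⟩ := isShift_of_iSup_ne_top hfin
  refine le_trans ?_ h3
  gcongr
  exact iInf₂_le_of_le _ ⟨h1, h2⟩ le_rfl

theorem isShift_iff_costH_ne_top (X Y : CarnotPath G) :
    (IsCameronMartin (firstLevelDiff X Y) ∧ IsShift (firstLevelDiff X Y) X Y) ↔
      costH X Y ^ (2 : ℝ) ≠ ∞ := by
  constructor
  · rintro ⟨h1, h2⟩
    refine ne_top_of_le_ne_top (b := cameronMartinNorm (firstLevelDiff X Y) ^ (2 : ℝ)) ?_ ?_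
    · rw [h1.cameronMartinNorm_sq]; exact ENNReal.ofReal_ne_top
    · gcongr
      exact iInf₂_le_of_le _ ⟨h1, h2⟩ le_rfl
  · intro h
    rw [costH_sq_eq_iSup] at h
    exact ⟨(isShift_of_iSup_ne_top h).1, (isShift_of_iSup_ne_top h).2.1⟩

theorem costH_sq_eq_ofReal {X Y : CarnotPath G} (hXY : IsCameronMartin (firstLevelDiff X Y) ∧
    IsShift (firstLevelDiff X Y) X Y) : costH X Y ^ (2 : ℝ) =
      ENNReal.ofReal (∫ r in (0 : ℝ)..1, ‖deriv (firstLevelDiff X Y) r‖ ^ 2) := by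
  rw [← hXY.1.cameronMartinNorm_sq]
  refine le_antisymm ?_ ?_
  · gcongr
    exact iInf₂_le_of_le _ hXY le_rfl
  · have h := (isShift_iff_costH_ne_top X Y).1 hXY
    rw [costH_sq_eq_iSup] at h ⊢
    exact (isShift_of_iSup_ne_top h).2.2

end CarnotPath

/-! ### Lower semicontinuity of transport costs -/

section Transport

/-- The running maxima of the functions `g k`, truncated so as to be bounded. -/
noncomputable def truncatedSups {α : Type*} (g : ℕ → α → ℝ≥0) (m : ℕ) (a : α) : ℝ≥0 :=
  min (partialSups (fun k => g k a) m) m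

theorem truncatedSups_le {α : Type*} {g : ℕ → α → ℝ≥0} {m : ℕ} {a : α} {b : ℝ≥0∞}
    (h : ∀ k ≤ m, (g k a : ℝ≥0∞) ≤ b) : (truncatedSups g m a : ℝ≥0∞) ≤ b := by
  induction b using ENNReal.recTopCoe with
  | top => exact le_top
  | coe b =>
    refine ENNReal.coe_le_coe.2 ((min_le_left _ _).trans (partialSups_le _ _ _ fun k hk => ?_))
    exact ENNReal.coe_le_coe.1 (h k hk)

theorem iSup_truncatedSups {α : Type*} (g : ℕ → α → ℝ≥0) (a : α) :
    ⨆ m, (truncatedSups g m a : ℝ≥0∞) = ⨆ m, (g m a : ℝ≥0∞) := by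
  refine le_antisymm (iSup_le fun m => truncatedSups_le fun k _ =>
    le_iSup (fun k => (g k a : ℝ≥0∞)) k) (iSup_le fun m => ?_)
  obtain ⟨n, hn⟩ := exists_nat_ge (g m a)
  refine le_iSup_of_le (max m n) (ENNReal.coe_le_coe.2 (le_min ?_ (hn.trans ?_)))
  · exact le_partialSups_of_le (fun k => g k a) (le_max_left _ _)
  · exact_mod_cast le_max_right m n

theorem monotone_truncatedSups {α : Type*} (g : ℕ → α → ℝ≥0) : Monotone (truncatedSups g) :=
  fun _ _ hmn _ => min_le_min ((partialSups _).monotone hmn) (Nat.cast_le.2 hmn)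

theorem continuous_truncatedSups {α : Type*} [TopologicalSpace α] {g : ℕ → α → ℝ≥0}
    (hg : ∀ k, Continuous (g k)) (m : ℕ) : Continuous (truncatedSups g m) :=
  (Continuous.partialSups_apply fun k _ => hg k).min continuous_const

/-- The truncated maxima as bounded continuous functions. -/
noncomputable def truncatedSupsBCF {α : Type*} [TopologicalSpace α] {g : ℕ → α → ℝ≥0}
    (hg : ∀ k, Continuous (g k)) (m : ℕ) : α →ᵇ ℝ≥0 :=
  BoundedContinuousFunction.mkOfBound ⟨truncatedSups g m, continuous_truncatedSups hg m⟩ m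
    fun x y => by
      have hx : (truncatedSups g m x : ℝ) ≤ m := by exact_mod_cast min_le_right _ _
      have hy : (truncatedSups g m y : ℝ) ≤ m := by exact_mod_cast min_le_right _ _
      rw [NNReal.dist_eq, abs_le]
      have := (truncatedSups g m x).2
      have := (truncatedSups g m y).2
      constructor <;> simp only [ContinuousMap.coe_mk] <;> simp only [NNReal.val_eq_coe] at * <;>
        linarith

variable {E : Type*} [MeasurableSpace E]

theorem IsOptimalPlan.transportCost_eq {c : E → E → ℝ≥0∞} {p : ℝ} {η ν : ProbabilityMeasure E}
    {π : ProbabilityMeasure (E × E)} (h : IsOptimalPlan c p η ν π) :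
    transportCost c p η ν = (∫⁻ z, c z.1 z.2 ^ p ∂(π : Measure (E × E))) ^ (1 / p) := by
  rw [transportCost]
  congr 1
  exact le_antisymm (iInf₂_le _ h.1) (le_iInf₂ h.2)

theorem transportCost_le {c : E → E → ℝ≥0∞} {p : ℝ} (hp : 0 < p) {η ν : ProbabilityMeasure E}
    {π : ProbabilityMeasure (E × E)} (h : π ∈ couplings η ν) {a : ℝ≥0∞}
    (ha : ∫⁻ z, c z.1 z.2 ^ p ∂(π : Measure (E × E)) ≤ a) :
    transportCost c p η ν ≤ a ^ (1 / p) := by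
  unfold transportCost
  gcongr
  exact iInf₂_le_of_le π h ha

variable [TopologicalSpace E]

theorem lintegral_iSup_eq_iSup_truncatedSups [OpensMeasurableSpace E] {g : ℕ → E → ℝ≥0}
    (hg : ∀ k, Continuous (g k)) (π : Measure E) :
    ∫⁻ p, ⨆ m, (g m p : ℝ≥0∞) ∂π = ⨆ m, ∫⁻ p, truncatedSupsBCF hg m p ∂π := by
  rw [← lintegral_iSup]
  · exact lintegral_congr fun p => (iSup_truncatedSups g p).symm
  · exact fun m => (truncatedSupsBCF hg m).continuous.measurable.coe_nnreal_ennreal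
  · exact fun m n hmn p => ENNReal.coe_le_coe.2 (monotone_truncatedSups g hmn p)

theorem lowerSemicontinuous_lintegral_iSup [OpensMeasurableSpace E] {g : ℕ → E → ℝ≥0}
    (hg : ∀ k, Continuous (g k)) : LowerSemicontinuous fun π : ProbabilityMeasure E =>
      ∫⁻ p, ⨆ m, (g m p : ℝ≥0∞) ∂(π : Measure E) := by
  simp only [lintegral_iSup_eq_iSup_truncatedSups hg]
  refine lowerSemicontinuous_iSup fun m => Continuous.lowerSemicontinuous ?_
  exact ProbabilityMeasure.continuous_iff_forall_continuous_lintegral.1 continuous_id _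

theorem prod_mem_couplings [BorelSpace E] [SecondCountableTopology E]
    (μ ν : ProbabilityMeasure E) : μ.prod ν ∈ couplings μ ν := by
  constructor <;> simp [ProbabilityMeasure.toMeasure_prod]

variable [PolishSpace E] [BorelSpace E]

/-- The couplings of `η` with the elements of a compact set of measures form a compact set. -/
theorem isCompact_couplings (η : ProbabilityMeasure E) {K : Set (ProbabilityMeasure E)}
    (hK : IsCompact K) : IsCompact {π | ∃ ν ∈ K, π ∈ couplings η ν} := by
  let := TopologicalSpace.upgradeIsCompletelyMetrizable E
  set S : Set (ProbabilityMeasure (E × E)) := {π | ∃ ν ∈ K, π ∈ couplings η ν} with hS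
  have hS' : S = (fun π : ProbabilityMeasure (E × E) => π.map measurable_fst.aemeasurable) ⁻¹' {η} ∩
      (fun π : ProbabilityMeasure (E × E) => π.map measurable_snd.aemeasurable) ⁻¹' K := by
    ext π
    constructor
    · rintro ⟨ν, hν, h1, h2⟩
      refine ⟨Subtype.ext h1, ?_⟩
      have : π.map measurable_snd.aemeasurable = ν := Subtype.ext h2
      exact mem_preimage.2 (this ▸ hν)
    · rintro ⟨h1, h2⟩
      exact ⟨_, h2, congrArg Subtype.val h1, rfl⟩
  have hclosed : IsClosed S := by
    rw [hS']
    exact (isClosed_singleton.preimage (ProbabilityMeasure.continuous_map continuous_fst)).inter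
      (hK.isClosed.preimage (ProbabilityMeasure.continuous_map continuous_snd))
  rw [← hclosed.closure_eq]
  refine isCompact_closure_of_isTightMeasureSet (IsTightMeasureSet.prodMk ?_ ?_)
  · refine (isTightMeasureSet_singleton (μ := (η : Measure E))).subset ?_
    rintro _ ⟨_, ⟨π, ⟨ν, -, h1, -⟩, rfl⟩, rfl⟩
    exact h1
  · refine (isTightMeasureSet_of_isCompact_closure (S := K) (by rwa [hK.isClosed.closure_eq])).subset ?_
    rintro _ ⟨_, ⟨π, ⟨ν, hν, -, h2⟩, rfl⟩, rfl⟩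
    exact ⟨ν, hν, h2.symm⟩

theorem isCompact_couplings_singleton (η ν : ProbabilityMeasure E) :
    IsCompact (couplings η ν) := by
  simpa using isCompact_couplings η (isCompact_singleton (x := ν))

/-- Optimal plans exist if `cᵖ` is a supremum of continuous functions. -/
theorem exists_isOptimalPlan (c : E → E → ℝ≥0∞) {p : ℝ} {g : ℕ → E × E → ℝ≥0}
    (hg : ∀ k, Continuous (g k)) (hc : ∀ z, c z.1 z.2 ^ p = ⨆ m, (g m z : ℝ≥0∞))
    (η ν : ProbabilityMeasure E) : ∃ π, IsOptimalPlan c p η ν π := by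
  obtain ⟨π, hπ, hmin⟩ := ((lowerSemicontinuous_lintegral_iSup hg).lowerSemicontinuousOn
    (couplings η ν)).exists_isMinOn ⟨_, prod_mem_couplings η ν⟩ (isCompact_couplings_singleton η ν)
  refine ⟨π, hπ, fun π' hπ' => ?_⟩
  simp only [hc]
  exact hmin hπ'

/-- If the functions `g k` are continuous, eventually below the costs `cₙᵖ`, and have supremum `cᵖ`,
then the transport costs satisfy the `liminf` inequality. -/
theorem transportCost_le_liminf {c : E → E → ℝ≥0∞} {cn : ℕ → E → E → ℝ≥0∞} {p : ℝ} (hp : 0 < p)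
    {g : ℕ → E × E → ℝ≥0} (hg : ∀ k, Continuous (g k))
    (hc : ∀ z, c z.1 z.2 ^ p = ⨆ m, (g m z : ℝ≥0∞))
    (hcn : ∀ m n, m ≤ n → ∀ z : E × E, (g m z : ℝ≥0∞) ≤ cn n z.1 z.2 ^ p)
    (η : ProbabilityMeasure E) {ν : ProbabilityMeasure E} {νn : ℕ → ProbabilityMeasure E}
    (hν : Tendsto νn atTop (𝓝 ν)) :
    transportCost c p η ν ≤ liminf (fun n => transportCost (cn n) p η (νn n)) atTop := by
  refine le_of_forall_gt_imp_ge_of_dense fun a ha => ?_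
  -- an ultrafilter concentrated on the indices with cost below `a` replaces a subsequence
  have hfreq : ∃ᶠ n in atTop, transportCost (cn n) p η (νn n) < a :=
    frequently_lt_of_liminf_lt (by isBoundedDefault) ha
  have := frequently_iff_neBot.1 hfreq
  set U := Ultrafilter.of (atTop ⊓ 𝓟 {n | transportCost (cn n) p η (νn n) < a}) with hU
  have hUtop : (U : Filter ℕ) ≤ atTop := (Ultrafilter.of_le _).trans inf_le_left
  have hUlt : ∀ᶠ n in (U : Filter ℕ), transportCost (cn n) p η (νn n) < a :=
    (Ultrafilter.of_le _).trans inf_le_right (mem_principal_self _)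
  have hex : ∀ n, transportCost (cn n) p η (νn n) < a → ∃ π ∈ couplings η (νn n),
      ∫⁻ z, cn n z.1 z.2 ^ p ∂(π : Measure (E × E)) ≤ a ^ p := by
    intro n hn
    rw [transportCost, one_div, ENNReal.rpow_inv_lt_iff hp] at hn
    simp only [iInf_lt_iff] at hn
    obtain ⟨π, hπ, h⟩ := hn
    exact ⟨π, hπ, h.le⟩
  have : Nonempty (ProbabilityMeasure (E × E)) := ⟨η.prod ν⟩
  choose! π hπ hπa using hex
  obtain ⟨π', ⟨ν', -, h1, -⟩, hlim⟩ := (isCompact_couplings η hν.isCompact_insert_range)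
    |>.ultrafilter_le_nhds (U.map π) (le_principal_iff.2 (mem_map.2 (by
      filter_upwards [hUlt] with n hn
      exact ⟨νn n, mem_insert_of_mem _ (mem_range_self n), hπ n hn⟩)))
  have hlim : Tendsto π U (𝓝 π') := hlim
  have h2 : π'.map measurable_snd.aemeasurable = ν := by
    refine tendsto_nhds_unique
      (((ProbabilityMeasure.continuous_map continuous_snd).tendsto π').comp hlim)
      ((hν.mono_left hUtop).congr' ?_)
    filter_upwards [hUlt] with n hn
    exact Subtype.ext (hπ n hn).2.symm
  have hle : ∫⁻ z, c z.1 z.2 ^ p ∂(π' : Measure (E × E)) ≤ a ^ p := by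
    simp only [hc]
    rw [lintegral_iSup_eq_iSup_truncatedSups hg]
    refine iSup_le fun m => ?_
    refine le_of_tendsto (ProbabilityMeasure.tendsto_iff_forall_lintegral_tendsto.1 hlim
      (truncatedSupsBCF hg m)) ?_
    filter_upwards [hUlt, hUtop (eventually_ge_atTop m)] with n hn hmn
    refine le_trans (lintegral_mono fun z => ?_) (hπa n hn)
    exact truncatedSups_le fun k hk => hcn k n (hk.trans hmn) z
  refine (transportCost_le hp ⟨h1, congrArg Subtype.val h2⟩ hle).trans_eq ?_
  rw [← ENNReal.rpow_mul, mul_one_div_cancel hp.ne', ENNReal.rpow_one]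

end Transport

/-! ### The recovery map -/

theorem StepTwoCarnotGroup.measurable_bracket {d₁ d₂ : ℕ} (G : StepTwoCarnotGroup d₁ d₂)
    {α : Type*} [MeasurableSpace α] {f g : α → EuclideanSpace ℝ (Fin d₁)} (hf : Measurable f)
    (hg : Measurable g) : Measurable fun a => G.bracket (f a) (g a) := by
  have h := G.continuous_bracket.measurable.comp (hf.prodMk hg)
  exact h

namespace CarnotPath

variable {d₁ d₂ : ℕ} {G : StepTwoCarnotGroup d₁ d₂} {X Y : CarnotPath G}

theorem commError_eq (s t : ℝ) : commError X Y s t =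
    G.germ (fun r => (X r).1) (firstLevelDiff X Y) (drift X Y) s t -
      (G.incr (G.lift (firstLevelDiff X Y) s) (G.lift (firstLevelDiff X Y) t)).2 := by
  change (G.incr _ (G.incr (G.incr (X s) (X t)) (G.incr (Y s) (Y t)))).2 = _
  rw [incr_incr, StepTwoCarnotGroup.incr_snd, StepTwoCarnotGroup.incr_fst]
  simp only [StepTwoCarnotGroup.lift, StepTwoCarnotGroup.bracket_self]
  simp

theorem commError_self (t : ℝ) : commError X Y t t = 0 := by
  simp [commError_eq, StepTwoCarnotGroup.germ, StepTwoCarnotGroup.incr_self,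
    StepTwoCarnotGroup.bracket_self, StepTwoCarnotGroup.bracket_zero_right]

/-- The error is the remainder of order one in the Riemann sums of `∫ [x, dh]`. -/
theorem commError_eq_integral (hXY : IsCameronMartin (firstLevelDiff X Y) ∧
    IsShift (firstLevelDiff X Y) X Y) {s t : ℝ} (hs : s ∈ Icc (0 : ℝ) 1)
    (ht : t ∈ Icc (0 : ℝ) 1) : commError X Y s t =
      ∫ r in s..t, G.bracket ((X r).1 - (X t).1) (deriv (firstLevelDiff X Y) r) := by
  have h2 := ((isShift_iff_drift hXY.1.1 X Y).1 hXY.2).2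
  have e : G.germ (fun r => (X r).1) (firstLevelDiff X Y) (drift X Y) s t =
      G.germ (fun r => (X r).1) (firstLevelDiff X Y)
        (G.shiftDrift (fun r => (X r).1) (firstLevelDiff X Y)) s t := by
    rw [StepTwoCarnotGroup.germ, StepTwoCarnotGroup.germ, h2 hs, h2 ht]
  rw [commError_eq, e, G.germ_shiftDrift X.continuous_coe.fst hXY.1.1 hs ht, add_sub_cancel_right]

theorem norm_corrector_le (hXY : IsCameronMartin (firstLevelDiff X Y) ∧
    IsShift (firstLevelDiff X Y) X Y) (n : ℕ) {t : ℝ} (ht : t ∈ Icc (0 : ℝ) 1) :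
    ‖corrector n X Y t‖ ≤ G.bracketBound * modulus n X *
      ∫ r in (0 : ℝ)..1, ‖deriv (firstLevelDiff X Y) r‖ := by
  have hK := G.bracketBound_nonneg
  have hw := modulus_nonneg n X
  set h := firstLevelDiff X Y
  have h0 : (0 : ℝ) ∈ Icc (0 : ℝ) 1 := ⟨le_rfl, zero_le_one⟩
  have hi : IntervalIntegrable (fun r => ‖deriv h r‖) volume 0 1 :=
    (hXY.1.intervalIntegrable_deriv h0 ⟨zero_le_one, le_rfl⟩).norm
  have hmin : ∀ {s : ℝ}, 0 ≤ s → min s t ∈ Icc (0 : ℝ) 1 := fun hs =>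
    ⟨le_min hs ht.1, (min_le_right _ _).trans ht.2⟩
  have hk : ∀ k ∈ Finset.range (2 ^ n),
      ‖commError X Y (min ((k : ℝ) / 2 ^ n) t) (min (((k : ℝ) + 1) / 2 ^ n) t)‖ ≤
        G.bracketBound * modulus n X *
          ∫ r in min ((k : ℝ) / 2 ^ n) t..min (((k : ℝ) + 1) / 2 ^ n) t, ‖deriv h r‖ := by
    intro k _
    have hs' := hmin (s := (k : ℝ) / 2 ^ n) (by positivity)
    have ht' := hmin (s := ((k : ℝ) + 1) / 2 ^ n) (by positivity)
    have hle : (k : ℝ) / 2 ^ n ≤ ((k : ℝ) + 1) / 2 ^ n := by gcongr; linarith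
    have e : ((k : ℝ) + 1) / 2 ^ n = (k : ℝ) / 2 ^ n + (2 ^ n)⁻¹ := by ring
    rw [commError_eq_integral hXY hs' ht']
    refine G.norm_integral_bracket_le (min_le_min_right _ hle) (fun r hr => ?_)
      (hXY.1.intervalIntegrable_deriv hs' ht')
    refine norm_sub_le_modulus n X r ⟨hs'.1.trans hr.1, hr.2.trans ht'.2⟩ _ ht' ?_
    rw [abs_sub_comm, abs_of_nonneg (sub_nonneg.2 hr.2)]
    have h1 := hr.1
    rcases le_total ((k : ℝ) / 2 ^ n) t with h2 | h2
    · rw [min_eq_left h2] at h1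
      have := min_le_left (((k : ℝ) + 1) / 2 ^ n) t
      linarith
    · rw [min_eq_right h2] at h1
      have := min_le_right (((k : ℝ) + 1) / 2 ^ n) t
      have : (0 : ℝ) ≤ (2 ^ n)⁻¹ := by positivity
      linarith
  refine (norm_sum_le _ _).trans ((Finset.sum_le_sum hk).trans ?_)
  rw [← Finset.mul_sum]
  refine mul_le_mul_of_nonneg_left ?_ (by positivity)
  have hsum := intervalIntegral.sum_integral_adjacent_intervals (f := fun r => ‖deriv h r‖)
    (μ := volume) (a := fun k : ℕ => min ((k : ℝ) / 2 ^ n) t) (n := 2 ^ n) fun k _ =>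
      (hXY.1.intervalIntegrable_deriv (hmin (by positivity)) (hmin (by positivity))).norm
  simp only [Nat.cast_add, Nat.cast_one, Nat.cast_zero, zero_div, Nat.cast_pow, Nat.cast_ofNat,
    min_eq_left ht.1] at hsum
  rw [hsum, div_self (by positivity), min_eq_right ht.2]
  exact intervalIntegral.integral_mono_interval le_rfl ht.1 ht.2
    (Eventually.of_forall fun _ => norm_nonneg _) hi

theorem correctedCurve_eq (n : ℕ) (t : ℝ) :
    correctedCurve n X Y t = ((Y t).1, (Y t).2 - corrector n X Y t) := by
  simp [correctedCurve, StepTwoCarnotGroup.mul, StepTwoCarnotGroup.inv, G.bracket_zero_right,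
    sub_eq_add_neg]

theorem recovery_apply (hXY : IsCameronMartin (firstLevelDiff X Y) ∧
    IsShift (firstLevelDiff X Y) X Y) (n : ℕ) {t : ℝ} (ht : t ∈ Icc (0 : ℝ) 1) :
    recovery n X Y t = correctedCurve n X Y t := by
  rw [recovery, dif_pos hXY, coe_of_mem _ ht]
  rfl

theorem recovery_of_not (hXY : ¬(IsCameronMartin (firstLevelDiff X Y) ∧
    IsShift (firstLevelDiff X Y) X Y)) (n : ℕ) : recovery n X Y = Y :=
  dif_neg hXY

theorem tendsto_recovery (X Y : CarnotPath G) :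
    Tendsto (fun n => recovery n X Y) atTop (𝓝 Y) := by
  by_cases hXY : IsCameronMartin (firstLevelDiff X Y) ∧ IsShift (firstLevelDiff X Y) X Y
  · refine tendsto_of_norm_sub_le (a := fun n => G.bracketBound * modulus n X *
      ∫ r in (0 : ℝ)..1, ‖deriv (firstLevelDiff X Y) r‖) ?_ fun n t ht => ?_
    · simpa using ((tendsto_modulus X).const_mul G.bracketBound).mul_const
        (∫ r in (0 : ℝ)..1, ‖deriv (firstLevelDiff X Y) r‖)
    · refine le_trans (le_of_eq ?_) (norm_corrector_le hXY n ht)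
      rw [recovery_apply hXY n ht, correctedCurve_eq, Prod.norm_def]
      simp
  · simp only [recovery_of_not hXY]
    exact tendsto_const_nhds

theorem corrector_succ_sub {n j : ℕ} (hj : j < 2 ^ n) :
    corrector n X Y (((j : ℝ) + 1) / 2 ^ n) - corrector n X Y ((j : ℝ) / 2 ^ n) =
      commError X Y ((j : ℝ) / 2 ^ n) (((j : ℝ) + 1) / 2 ^ n) := by
  have hle : ∀ {a b : ℝ}, a ≤ b → a / 2 ^ n ≤ b / 2 ^ n := fun h => by gcongr
  rw [corrector, corrector, ← Finset.sum_sub_distrib,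
    Finset.sum_eq_single_of_mem j (Finset.mem_range.2 hj)]
  · rw [min_self, min_self, min_eq_left (hle (by linarith)), min_eq_right (hle (by linarith)),
      commError_self, sub_zero]
  · intro k _ hkj
    rcases lt_or_gt_of_ne hkj with h | h
    · have h' : (k : ℝ) + 1 ≤ j := by exact_mod_cast h
      rw [min_eq_left (hle (by linarith)), min_eq_left (hle (by linarith)),
        min_eq_left (hle (by linarith)), min_eq_left (hle (by linarith)), sub_self]
    · have h' : (j : ℝ) + 1 ≤ k := by exact_mod_cast h
      rw [min_eq_right (hle (by linarith)), min_eq_right (hle (by linarith)),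
        min_eq_right (hle (by linarith)), min_eq_right (hle (by linarith)), commError_self,
        commError_self, sub_self]

/-- Over each dyadic interval the increment of the corrected path differs from that of `X` by the
increment of the lift of `h`. -/
theorem incr_correctedCurve {n j : ℕ} (hj : j < 2 ^ n) :
    G.incr (correctedCurve n X Y ((j : ℝ) / 2 ^ n))
      (correctedCurve n X Y (((j : ℝ) + 1) / 2 ^ n)) =
    G.mul (G.incr (X ((j : ℝ) / 2 ^ n)) (X (((j : ℝ) + 1) / 2 ^ n)))
      (G.incr (G.lift (firstLevelDiff X Y) ((j : ℝ) / 2 ^ n))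
        (G.lift (firstLevelDiff X Y) (((j : ℝ) + 1) / 2 ^ n))) := by
  have hc := corrector_succ_sub (X := X) (Y := Y) hj
  set s : ℝ := (j : ℝ) / 2 ^ n
  set t : ℝ := ((j : ℝ) + 1) / 2 ^ n
  have h1 := G.mul_incr (G.incr (X s) (X t)) (G.incr (Y s) (Y t))
  rw [incr_incr] at h1
  have e := commError_eq (X := X) (Y := Y) s t
  rw [← hc, eq_sub_iff_add_eq, ← eq_sub_iff_add_eq'] at e
  have h2 := congrArg Prod.snd h1
  have h3 := congrArg Prod.fst h1
  simp only [StepTwoCarnotGroup.mul, StepTwoCarnotGroup.incr_snd,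
    StepTwoCarnotGroup.incr_fst] at h2 h3
  refine Prod.ext ?_ ?_
  · simp only [StepTwoCarnotGroup.mul, StepTwoCarnotGroup.incr_fst, correctedCurve_eq, ← h3,
      StepTwoCarnotGroup.lift]
  · rw [StepTwoCarnotGroup.mul, e]
    simp only [StepTwoCarnotGroup.incr_fst, StepTwoCarnotGroup.incr_snd, correctedCurve_eq,
      StepTwoCarnotGroup.lift]
    rw [← sub_eq_zero] at h2 ⊢
    rw [← neg_eq_zero, ← h2]
    module

/-- The Cauchy–Schwarz inequality on each dyadic interval, where `h` has the same increment of its lift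
as the corrected path relative to `X`. -/
theorem cost_recovery_le (n : ℕ) (X Y : CarnotPath G) :
    cost n X (recovery n X Y) ^ (2 : ℝ) ≤ costH X Y ^ (2 : ℝ) := by
  by_cases hXY : IsCameronMartin (firstLevelDiff X Y) ∧ IsShift (firstLevelDiff X Y) X Y
  · rw [costH_sq_eq_ofReal hXY, cost_sq]
    refine le_trans ?_ (ENNReal.ofReal_le_ofReal (hXY.1.sum_sq_integral_norm_deriv_le n))
    rw [ENNReal.ofReal_mul (by positivity), ENNReal.ofReal_pow (by positivity),
      ENNReal.ofReal_sum_of_nonneg fun _ _ => by positivity]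
    simp only [ENNReal.ofReal_ofNat]
    gcongr with k hk
    have hk := Finset.mem_range.1 hk
    have hs := dyadic_mem_Icc hk.le
    have ht := dyadic_succ_mem_Icc hk
    have hlt : (k : ℝ) / 2 ^ n < ((k : ℝ) + 1) / 2 ^ n := by gcongr; linarith
    rw [recovery_apply hXY n hs, recovery_apply hXY n ht, incr_correctedCurve hk,
      ENNReal.ofReal_pow (intervalIntegral.integral_nonneg hlt.le fun _ _ => norm_nonneg _)]
    exact pow_le_pow_left' (G.dcc_mul_incr_lift_le hXY.1.1 hs ht hlt _) 2
  · rw [(not_iff_comm.1 (isShift_iff_costH_ne_top X Y).symm).1 hXY]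
    exact le_top

/-! ### Measurability of the recovery map -/

theorem continuous_firstLevelDiff_uncurry :
    Continuous fun q : (CarnotPath G × CarnotPath G) × ℝ => firstLevelDiff q.1.1 q.1.2 q.2 := by
  have h1 : Continuous fun q : (CarnotPath G × CarnotPath G) × ℝ => q.1.1 q.2 :=
    continuous_eval_prod.comp ((continuous_fst.comp continuous_fst).prodMk continuous_snd)
  have h2 : Continuous fun q : (CarnotPath G × CarnotPath G) × ℝ => q.1.2 q.2 :=
    continuous_eval_prod.comp ((continuous_snd.comp continuous_fst).prodMk continuous_snd)
  exact h2.fst.sub h1.fst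

theorem measurable_deriv_firstLevelDiff :
    Measurable fun q : (CarnotPath G × CarnotPath G) × ℝ =>
      deriv (firstLevelDiff q.1.1 q.1.2) q.2 :=
  measurable_deriv_with_param (f := fun (p : CarnotPath G × CarnotPath G) (t : ℝ) =>
      firstLevelDiff p.1 p.2 t) continuous_firstLevelDiff_uncurry

theorem measurable_bracket_deriv_firstLevelDiff :
    Measurable fun q : (CarnotPath G × CarnotPath G) × ℝ =>
      G.bracket (firstLevelDiff q.1.1 q.1.2 q.2) (deriv (firstLevelDiff q.1.1 q.1.2) q.2) :=
  G.measurable_bracket continuous_firstLevelDiff_uncurry.measurable measurable_deriv_firstLevelDiff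

theorem measurable_lift_firstLevelDiff (t : ℝ) :
    Measurable fun p : CarnotPath G × CarnotPath G => G.lift (firstLevelDiff p.1 p.2) t := by
  have h1 : Measurable fun p : CarnotPath G × CarnotPath G => firstLevelDiff p.1 p.2 t :=
    continuous_firstLevelDiff_uncurry.measurable.comp measurable_prodMk_right
  have h2 : ∀ s : Set ℝ, Measurable fun p : CarnotPath G × CarnotPath G =>
      ∫ r in s, G.bracket (firstLevelDiff p.1 p.2 r) (deriv (firstLevelDiff p.1 p.2) r) := fun s =>
    (measurable_bracket_deriv_firstLevelDiff.stronglyMeasurable.integral_prod_right'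
      (ν := volume.restrict s)).measurable
  have h3 : Measurable fun p : CarnotPath G × CarnotPath G => ∫ r in (0 : ℝ)..t,
      G.bracket (firstLevelDiff p.1 p.2 r) (deriv (firstLevelDiff p.1 p.2) r) :=
    (h2 (Ioc 0 t)).sub (h2 (Ioc t 0))
  exact h1.prodMk (h3.const_smul (1 / 2 : ℝ))

theorem measurable_correctedCurve (n : ℕ) (t : ℝ) :
    Measurable fun p : CarnotPath G × CarnotPath G => correctedCurve n p.1 p.2 t := by
  have hmul : ∀ {f g : CarnotPath G × CarnotPath G → CarnotPoint d₁ d₂}, Measurable f →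
      Measurable g → Measurable fun p => G.mul (f p) (g p) := fun hf hg =>
    G.continuous_mul.measurable.comp (hf.prodMk hg)
  have hinv : ∀ {f : CarnotPath G × CarnotPath G → CarnotPoint d₁ d₂}, Measurable f →
      Measurable fun p => G.inv (f p) := fun hf => hf.neg
  have hX : ∀ t : ℝ, Measurable fun p : CarnotPath G × CarnotPath G => p.1 t := fun t =>
    (continuous_eval_prod.comp (continuous_fst.prodMk continuous_const)).measurable
  have hY : ∀ t : ℝ, Measurable fun p : CarnotPath G × CarnotPath G => p.2 t := fun t =>
    (continuous_eval_prod.comp (continuous_snd.prodMk continuous_const)).measurable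
  refine hmul (hY t) (hinv (measurable_const.prodMk (Finset.measurable_fun_sum _ fun k _ => ?_)))
  exact (hmul (hinv (hmul (hinv (measurable_lift_firstLevelDiff _))
    (measurable_lift_firstLevelDiff _)))
      (hmul (hinv (hmul (hinv (hX _)) (hX _))) (hmul (hinv (hY _)) (hY _)))).snd

/-- The cost is Borel as a supremum of continuous functions, although the infimum that defines it is
uncountable. -/
theorem measurable_costH_sq :
    Measurable fun p : CarnotPath G × CarnotPath G => costH p.1 p.2 ^ (2 : ℝ) := by
  simp only [costH_sq_eq_iSup]
  exact .iSup fun m => (continuous_costLowerBound m).measurable.ennreal_ofReal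

theorem measurable_recovery (n : ℕ) :
    Measurable fun p : CarnotPath G × CarnotPath G => recovery n p.1 p.2 := by
  classical
  refine measurable_of_eval fun t ht => ?_
  have hS : MeasurableSet {p : CarnotPath G × CarnotPath G | costH p.1 p.2 ^ (2 : ℝ) ≠ ∞} :=
    (measurable_costH_sq (measurableSet_singleton ∞)).compl
  have hY : Measurable fun p : CarnotPath G × CarnotPath G => p.2 t :=
    (continuous_eval_prod.comp (continuous_snd.prodMk continuous_const)).measurable
  have e : (fun p : CarnotPath G × CarnotPath G => recovery n p.1 p.2 t) = fun p =>
      if p ∈ {p : CarnotPath G × CarnotPath G | costH p.1 p.2 ^ (2 : ℝ) ≠ ∞} then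
        correctedCurve n p.1 p.2 t else p.2 t := by
    funext p
    by_cases hp : costH p.1 p.2 ^ (2 : ℝ) ≠ ∞
    · rw [if_pos (mem_ofPred_eq ▸ hp), recovery_apply ((isShift_iff_costH_ne_top _ _).2 hp) n ht]
    · rw [if_neg (mem_ofPred_eq ▸ hp),
        recovery_of_not (mt (isShift_iff_costH_ne_top _ _).1 hp)]
  rw [e]
  exact (measurable_correctedCurve n t).ite hS hY

theorem measurable_recoveryMap (n : ℕ) : Measurable (recoveryMap (G := G) n) :=
  measurable_fst.prodMk (measurable_recovery n)

/-! ### Convergence of the transport costs -/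

theorem transportCost_costH_le_liminf (η : ProbabilityMeasure (CarnotPath G))
    {ν : ProbabilityMeasure (CarnotPath G)} {νn : ℕ → ProbabilityMeasure (CarnotPath G)}
    (hν : Tendsto νn atTop (𝓝 ν)) :
    transportCost costH 2 η ν ≤ liminf (fun n => transportCost (cost n) 2 η (νn n)) atTop := by
  refine transportCost_le_liminf two_pos
    (g := fun m z => (costLowerBound m z.1 z.2).toNNReal)
    (fun m => continuous_real_toNNReal.comp (continuous_costLowerBound m))
    (fun z => costH_sq_eq_iSup z.1 z.2) (fun m n hmn z => ?_) η hν
  obtain ⟨j, rfl⟩ := Nat.exists_eq_add_of_le hmn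
  exact costLowerBound_le_cost m j z.1 z.2

/-- Every optimal plan works: the push-forward under the recovery map is a competitor whose cost is at
most the limit cost, by the pointwise inequality between the costs. -/
theorem exists_recovery_sequence (η ν : ProbabilityMeasure (CarnotPath G)) :
    ∃ π : ProbabilityMeasure (CarnotPath G × CarnotPath G), IsOptimalPlan costH 2 η ν π ∧
      ∃ νn : ℕ → ProbabilityMeasure (CarnotPath G),
        (∀ n, (νn n : Measure (CarnotPath G)) =
          ((π : Measure (CarnotPath G × CarnotPath G)).map (recoveryMap n)).map Prod.snd) ∧
        Tendsto νn atTop (𝓝 ν) ∧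
        Tendsto (fun n => transportCost (cost n) 2 η (νn n)) atTop
          (𝓝 (transportCost costH 2 η ν)) := by
  obtain ⟨π, hπ⟩ := exists_isOptimalPlan costH (p := 2)
    (g := fun m z => (costLowerBound m z.1 z.2).toNNReal)
    (fun m => continuous_real_toNNReal.comp (continuous_costLowerBound m))
    (fun z => costH_sq_eq_iSup (G := G) z.1 z.2) η ν
  have hmap : ∀ n, ((π : Measure (CarnotPath G × CarnotPath G)).map (recoveryMap n)).map Prod.snd =
      (π : Measure (CarnotPath G × CarnotPath G)).map fun p => recovery n p.1 p.2 := fun n =>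
    Measure.map_map measurable_snd (measurable_recoveryMap n)
  set νn : ℕ → ProbabilityMeasure (CarnotPath G) := fun n =>
    π.map (measurable_recovery n).aemeasurable with hνn
  have hlim : Tendsto νn atTop (𝓝 ν) := by
    rw [ProbabilityMeasure.tendsto_iff_forall_lintegral_tendsto]
    intro f
    have hf : Measurable fun x => (f x : ℝ≥0∞) := f.continuous.measurable.coe_nnreal_ennreal
    have e1 : ∀ n, ∫⁻ x, f x ∂(νn n : Measure (CarnotPath G)) =
        ∫⁻ p, f (recovery n p.1 p.2) ∂(π : Measure (CarnotPath G × CarnotPath G)) := fun n =>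
      lintegral_map hf (measurable_recovery n)
    have e2 : ∫⁻ x, f x ∂(ν : Measure (CarnotPath G)) =
        ∫⁻ p, f p.2 ∂(π : Measure (CarnotPath G × CarnotPath G)) := by
      rw [← hπ.1.2, lintegral_map hf measurable_snd]
    simp only [e1, e2]
    refine tendsto_lintegral_of_dominated_convergence (fun _ => (nndist f 0 : ℝ≥0∞))
      (fun n => hf.comp (measurable_recovery n)) (fun n => Eventually.of_forall fun p => ?_) ?_
      (Eventually.of_forall fun p => ?_)
    · exact ENNReal.coe_le_coe.2 (BoundedContinuousFunction.NNReal.upper_bound f _)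
    · simp
    · exact (ENNReal.continuous_coe.tendsto _).comp
        ((f.continuous.tendsto _).comp (tendsto_recovery p.1 p.2))
  have hle : ∀ n, transportCost (cost n) 2 η (νn n) ≤ transportCost costH 2 η ν := by
    intro n
    rw [hπ.transportCost_eq]
    refine transportCost_le two_pos (π := π.map (measurable_recoveryMap n).aemeasurable) ⟨?_, ?_⟩ ?_
    · rw [ProbabilityMeasure.toMeasure_map,
        Measure.map_map measurable_fst (measurable_recoveryMap n)]
      exact hπ.1.1
    · rw [ProbabilityMeasure.toMeasure_map, hmap n]
      rfl
    · rw [ProbabilityMeasure.toMeasure_map]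
      refine (lintegral_map_le _ _).trans (lintegral_mono fun p => ?_)
      exact cost_recovery_le n p.1 p.2
  refine ⟨π, hπ, νn, fun n => (hmap n).symm, hlim, ?_⟩
  refine tendsto_of_le_liminf_of_limsup_le (transportCost_costH_le_liminf η hlim) ?_
  exact limsup_le_of_le (by isBoundedDefault) (Eventually.of_forall hle)

end CarnotPath

theorem theorem5p19 {d₁ d₂ : ℕ} (G : StepTwoCarnotGroup d₁ d₂)
    (η : ProbabilityMeasure (CarnotPath G)) :
    GammaConverges (fun n => transportCost (CarnotPath.cost n) 2 η)
        (transportCost CarnotPath.costH 2 η) ∧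
      ∀ ν : ProbabilityMeasure (CarnotPath G),
        ∃ π : ProbabilityMeasure (CarnotPath G × CarnotPath G),
          IsOptimalPlan CarnotPath.costH 2 η ν π ∧
          ∃ νn : ℕ → ProbabilityMeasure (CarnotPath G),
            (∀ n, (νn n : Measure (CarnotPath G)) =
              ((π : Measure (CarnotPath G × CarnotPath G)).map
                (CarnotPath.recoveryMap n)).map Prod.snd) ∧
            Tendsto νn atTop (𝓝 ν) ∧
            Tendsto (fun n => transportCost (CarnotPath.cost n) 2 η (νn n)) atTop
              (𝓝 (transportCost CarnotPath.costH 2 η ν)) := by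
  refine ⟨⟨fun _ _ hν => CarnotPath.transportCost_costH_le_liminf η hν, fun ν => ?_⟩,
    CarnotPath.exists_recovery_sequence η⟩
  obtain ⟨-, -, νn, -, hlim, hcost⟩ := CarnotPath.exists_recovery_sequence η ν
  exact ⟨νn, hlim, hcost.limsup_eq.le⟩
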